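/- Lemma. Model: in the I/O model, main memory holds $M+O(1)$ words and external memory is accessed in blocks of $B$ words, where $1\le B\le M/2$. For an input of size $N$, words are integers below some $W\ge (N+2)^{c}$, with $c$ a constant chosen by the algorithm, i.e. $O(\log N)$-bit words suffice. Computation in main memory is free, and each transfer of one block costs one I/O. Write $\mathrm{scan}(N)=N/B$ and $\mathrm{sort}(N)=(N/B)\log_{M/B}(N/B)$, where $N/B$ and $\log_{M/B}(N/B)$ are each read as at least $1$. A finite simple graph is trivially perfect if it has no induced $P_4$ and no induced $C_4$. An ordering $\gamma=(v_1,\dots,v_n)$ of its vertices is a universal-in-a-component ordering (uco) if for every $i$ the vertex $v_i$ is adjacent to all other vertices of its connected component in $G[\{v_i,\dots,v_n\}]$. A non-increasing degree ordering of a graph is a uco if and only if the graph is trivially perfect. There is one algorithm (a fixed program, knowing $M$, $B$ and the word bound) that, given in external memory the adjacency arrays of any graph $G$ with $n$ vertices and $m$ edges (the array of starting positions followed by the concatenated adjacency lists, each list in arbitrary order), together with the numbers $n$ and $m$, certifies in $O(\mathrm{sort}(n+m))$ I/Os whether $G$ is trivially perfect, with constants independent of $G$, $n$, $m$, $M$,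 $B$. If $G$ is trivially perfect, the algorithm says so and then, in $O(\mathrm{scan}(n))$ further I/Os, outputs a non-increasing degree ordering $\gamma$ of $G$, which is a uco. Otherwise it says so and returns, within the $O(\mathrm{sort}(n+m))$ I/Os, a certificate of size $O(1)$, namely four vertices that induce a $P_4$ or a $C_4$, listed along the path or cycle. -/

import Mathlib

namespace ExtMem

/-! ### The external-memory (I/O) model

Main memory holds boundedly many words, external memory is an array of words that is accessed in
blocks of `B` consecutive words.  A program is a fixed finite piece of code.  Computation inside main
memory is free; each transfer of a block costs one I/O. -/

/-- The machine: memory parameter `M`, block size `B`, words are the naturals below `W`, and main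
memory has room for `cap` words. -/
structure Machine where
  M : ℕ
  B : ℕ
  W : ℕ
  cap : ℕ

/-- What a free internal computation may depend on: the parameters `(M, B, W)` of the machine and the
present content of main memory. -/
abbrev View : Type := (ℕ × ℕ × ℕ) × List ℕ

/-- Contents of main memory, of external memory (word by word; block `a` consists of the words
`a * B, …, a * B + B - 1`), and of the write-only output stream. -/
structure State where
  mem : List ℕ
  disk : ℕ → ℕ
  out : List ℕ

def Machine.view (μ : Machine) (l : List ℕ) : View := ((μ.M, μ.B, μ.W), l)

/-- `l` is a legal content of main memory. -/
def Machine.Fits (μ : Machine) (l : List ℕ) : Prop :=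
  l.length ≤ μ.cap ∧ ∀ w ∈ l, w < μ.W

/-- The content of block `a`. -/
def Machine.block (μ : Machine) (d : ℕ → ℕ) (a : ℕ) : List ℕ :=
  (List.range μ.B).map fun i => d (a * μ.B + i)

/-- Replaces block `a` by the words of `l`. -/
def Machine.setBlock (μ : Machine) (d : ℕ → ℕ) (a : ℕ) (l : List ℕ) : ℕ → ℕ :=
  fun x => if x / μ.B = a then l.getD (x % μ.B) 0 else d x

/-- Programs.  The internal computations and tests are computable functions of the machine parameters
and of the content of main memory; the program has no other storage. -/
inductive Prog : Type
  | compute (f : View → List ℕ) (hf : Computable f) : Prog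
  | read : Prog
  | write : Prog
  | emit : Prog
  | seq (p q : Prog) : Prog
  | ite (t : View → Bool) (ht : Computable t) (p q : Prog) : Prog
  | loop (t : View → Bool) (ht : Computable t) (p : Prog) : Prog

/-- `Exec μ p s t s'`: started in state `s`, the program `p` halts in state `s'` after exactly `t`
I/Os.  There is no rule (the run fails) if main memory would overflow.

* `read`: the first word of main memory is a block address; it is replaced by that block.
* `write`: the first word of main memory is a block address, the next `B` words are moved to that
  block.
* `emit`: the first word of main memory is a number `j ≤ B`, the next `j` words are moved to the end
  of the output. -/
inductive Exec (μ : Machine) : Prog → State → ℕ → State → Prop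
  | compute {f : View → List ℕ} {hf : Computable f} {s : State}
      (h : μ.Fits (f (μ.view s.mem))) :
      Exec μ (.compute f hf) s 0 { s with mem := f (μ.view s.mem) }
  | read {a : ℕ} {l : List ℕ} {d : ℕ → ℕ} {o : List ℕ}
      (h : μ.Fits (μ.block d a ++ l)) :
      Exec μ .read ⟨a :: l, d, o⟩ 1 ⟨μ.block d a ++ l, d, o⟩
  | write {a : ℕ} {b l : List ℕ} {d : ℕ → ℕ} {o : List ℕ} (h : b.length = μ.B) :
      Exec μ .write ⟨a :: (b ++ l), d, o⟩ 1 ⟨l, μ.setBlock d a b, o⟩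
  | emit {j : ℕ} {b l : List ℕ} {d : ℕ → ℕ} {o : List ℕ} (hj : j ≤ μ.B) (h : b.length = j) :
      Exec μ .emit ⟨j :: (b ++ l), d, o⟩ 1 ⟨l, d, o ++ b⟩
  | seq {p q : Prog} {s s' s'' : State} {t t' : ℕ}
      (h : Exec μ p s t s') (h' : Exec μ q s' t' s'') : Exec μ (.seq p q) s (t + t') s''
  | ite_true {c : View → Bool} {hc : Computable c} {p q : Prog} {s s' : State} {t : ℕ}
      (hb : c (μ.view s.mem) = true) (h : Exec μ p s t s') : Exec μ (.ite c hc p q) s t s'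
  | ite_false {c : View → Bool} {hc : Computable c} {p q : Prog} {s s' : State} {t : ℕ}
      (hb : c (μ.view s.mem) = false) (h : Exec μ q s t s') : Exec μ (.ite c hc p q) s t s'
  | loop_done {c : View → Bool} {hc : Computable c} {p : Prog} {s : State}
      (hb : c (μ.view s.mem) = false) : Exec μ (.loop c hc p) s 0 s
  | loop_step {c : View → Bool} {hc : Computable c} {p : Prog} {s s' s'' : State} {t t' : ℕ}
      (hb : c (μ.view s.mem) = true) (h : Exec μ p s t s')
      (h' : Exec μ (.loop c hc p) s' t' s'') : Exec μ (.loop c hc p) s (t + t') s''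

/-- `scan(N) = N / B`, at least one I/O. -/
noncomputable def scanIO (B N : ℕ) : ℝ := max 1 ((N : ℝ) / B)

/-- `sort(N) = (N / B) * log_{M/B} (N / B)`, where each of the two factors counts at least one. -/
noncomputable def sortIO (M B N : ℕ) : ℝ :=
  max 1 ((N : ℝ) / B) * max 1 (Real.logb ((M : ℝ) / B) ((N : ℝ) / B))

/-! ### Graphs -/

/-- `adj v` lists the neighbours of `v`, each once, in an arbitrary order. -/
def IsAdjLists {n : ℕ} (G : SimpleGraph (Fin n)) (adj : Fin n → List (Fin n)) : Prop :=
  ∀ v, (adj v).Nodup ∧ ∀ w, w ∈ adj v ↔ G.Adj v w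

/-- Adjacency row representation: the array `P` of the `n + 1` positions at which the adjacency lists
start (the last entry is the end of the last list), followed by the array `E` of all adjacency lists,
one after the other. -/
def adjRow {n : ℕ} (adj : Fin n → List (Fin n)) : List ℕ :=
  ((List.range (n + 1)).map fun i => ((List.ofFn adj).take i).flatten.length) ++
    (List.ofFn adj).flatten.map Fin.val

/-- Initially external memory holds the adjacency row representation, and main memory the numbers of
vertices and edges. -/
def initState {n : ℕ} (m : ℕ) (adj : Fin n → List (Fin n)) : State where
  mem := [n, m]
  disk := fun x => (adjRow adj).getD x 0
  out := []

/-- No vertex subset induces a `P₄` or a `C₄`. -/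
def IsTriviallyPerfect {V : Type*} (G : SimpleGraph V) : Prop :=
  ¬ (SimpleGraph.pathGraph 4).IsIndContained G ∧ ¬ (SimpleGraph.cycleGraph 4).IsIndContained G

/-- `l` lists the four vertices of an induced `P₄` along the path, or of an induced `C₄` along the
cycle. -/
def IsForbiddenList {V : Type*} (G : SimpleGraph V) (l : List V) : Prop :=
  (∃ e : SimpleGraph.pathGraph 4 ↪g G, l = List.ofFn e) ∨
    ∃ e : SimpleGraph.cycleGraph 4 ↪g G, l = List.ofFn e

/-- `v` is adjacent to all other vertices of its connected component in `H`. -/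
def IsUniversalInComponent {V : Type*} (H : SimpleGraph V) (v : V) : Prop :=
  ∀ w, H.Reachable v w → w ≠ v → H.Adj v w

/-- `γ` lists every vertex exactly once. -/
def IsOrdering {V : Type*} (γ : List V) : Prop :=
  γ.Nodup ∧ ∀ v, v ∈ γ

/-- Non-increasing degree ordering. -/
def IsDegreeOrdering {n : ℕ} (G : SimpleGraph (Fin n)) [DecidableRel G.Adj]
    (γ : List (Fin n)) : Prop :=
  IsOrdering γ ∧ γ.Pairwise fun u v => G.degree v ≤ G.degree u

/-- Universal-in-a-component ordering: each vertex `v` of the ordering is universal in its connected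
component of the subgraph induced by `v` and the vertices after it. -/
def IsUco {V : Type*} (G : SimpleGraph V) (γ : List V) : Prop :=
  IsOrdering γ ∧ ∀ (pre suf : List V) (v : V), γ = pre ++ v :: suf →
    IsUniversalInComponent (G.induce {w | w ∈ v :: suf}) ⟨v, List.mem_cons_self⟩

end ExtMem

/-! Graph theory. Call an ordering coherent if, for y before x before v with x adjacent to v, the
vertex y sees both or neither of x and v. This is the uco property (`isUco_iff_coherent`). Coherence
makes the centre of every induced three-vertex path precede both its ends. It therefore excludes P₄
and C₄, where two adjacent inner vertices are both such centres. Conversely, let b and c be adjacent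
with deg c ≤ deg b, and let w be a neighbour of c outside N[b]. Counting gives a neighbour x of b
outside N[c] (`exists_adj_not_adj`), and x, b, c, w induce a P₄ or a C₄ according to whether x and w
are adjacent. So a degree ordering of a trivially perfect graph is coherent.

Local test. Coherence is decided by one comparison per edge: for u before v, the last neighbour of v
before u must be the last neighbour of u before u (`coherent_of_prevRank`). An edge that fails
yields a triple b, c, w as above (`IsWitness`), and x is then found by comparing the neighbourhoods
of b and c.

Algorithm. Seven stages suffice. Each rewrites an array word by word, remembering only the last word
of a distinguished kind, and then sorts the result. Records are words of four digits in base
(n+m+2)³, which is why the exponent 12 suffices for the word bound. Three stages turn the adjacency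
arrays into the list of vertices by rank followed by all arcs sorted by head and tail. Two find a
witness or show that there is none. The last two find x. The sorted arc array is kept, and its first
n words are the degree ordering, so reporting it is one scan. Correctness is `Arcs.certificate` and
`KeyEntries.exists_isDegreeOrdering`.

Cost. Sorting is multiway merge sort with pages of about B/8 words and fan-in about M/(32B), so that
all run buffers fit in main memory (`fanIn_mul_le`). Every page costs boundedly many I/Os per level
(`exec_stage`), and the number of levels is O(log_{M/B}(N/B)) by `clog_numPages_le`. Programs act on
main memory through an encoding of lists of registers, and loops are analysed with an invariant and
an I/O potential (`exec_rloop`). -/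

namespace ExtMem

-- Closure rules for primitive recursive functions, from which computability of internal
-- computations follows.

attribute [fun_prop] Primrec

namespace Comp

variable {α β γ σ : Type*} [Primcodable α] [Primcodable β] [Primcodable γ] [Primcodable σ]

@[fun_prop] theorem id' : Primrec fun x : α => x := Primrec.id
@[fun_prop] theorem const' (c : σ) : Primrec fun _ : α => c := Primrec.const c
@[fun_prop] theorem comp' {f : β → σ} {g : α → β} (hf : Primrec f) (hg : Primrec g) :
    Primrec fun a => f (g a) := Primrec.comp hf hg
@[fun_prop] theorem pair' {f : α → β} {g : α → γ} (hf : Primrec f) (hg : Primrec g) :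
    Primrec fun a => (f a, g a) := Primrec.pair hf hg
@[fun_prop] theorem fst' {f : α → β × γ} (hf : Primrec f) : Primrec fun a => (f a).1 :=
  Primrec.fst.comp hf
@[fun_prop] theorem snd' {f : α → β × γ} (hf : Primrec f) : Primrec fun a => (f a).2 :=
  Primrec.snd.comp hf
@[fun_prop] theorem add' {f g : α → ℕ} (hf : Primrec f) (hg : Primrec g) :
    Primrec fun a => f a + g a := Primrec.nat_add.comp hf hg
@[fun_prop] theorem sub' {f g : α → ℕ} (hf : Primrec f) (hg : Primrec g) :
    Primrec fun a => f a - g a := Primrec.nat_sub.comp hf hg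
@[fun_prop] theorem mul' {f g : α → ℕ} (hf : Primrec f) (hg : Primrec g) :
    Primrec fun a => f a * g a := Primrec.nat_mul.comp hf hg
@[fun_prop] theorem div' {f g : α → ℕ} (hf : Primrec f) (hg : Primrec g) :
    Primrec fun a => f a / g a := Primrec.nat_div.comp hf hg
@[fun_prop] theorem mod' {f g : α → ℕ} (hf : Primrec f) (hg : Primrec g) :
    Primrec fun a => f a % g a := Primrec.nat_mod.comp hf hg
@[fun_prop] theorem min' {f g : α → ℕ} (hf : Primrec f) (hg : Primrec g) :
    Primrec fun a => min (f a) (g a) := Primrec.nat_min.comp hf hg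
@[fun_prop] theorem decide_lt {f g : α → ℕ} (hf : Primrec f) (hg : Primrec g) :
    Primrec fun a => decide (f a < g a) := (Primrec.nat_lt.comp hf hg).decide
@[fun_prop] theorem decide_le {f g : α → ℕ} (hf : Primrec f) (hg : Primrec g) :
    Primrec fun a => decide (f a ≤ g a) := (Primrec.nat_le.comp hf hg).decide
@[fun_prop] theorem decide_eq {f g : α → ℕ} (hf : Primrec f) (hg : Primrec g) :
    Primrec fun a => decide (f a = g a) := (Primrec.eq.comp hf hg).decide
@[fun_prop] theorem band {f g : α → Bool} (hf : Primrec f) (hg : Primrec g) :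
    Primrec fun a => f a && g a := Primrec.and.comp hf hg
@[fun_prop] theorem bor {f g : α → Bool} (hf : Primrec f) (hg : Primrec g) :
    Primrec fun a => f a || g a := Primrec.or.comp hf hg
@[fun_prop] theorem bnot {f : α → Bool} (hf : Primrec f) :
    Primrec fun a => !f a := Primrec.not.comp hf
@[fun_prop] theorem cond' {c : α → Bool} {f g : α → σ} (hc : Primrec c) (hf : Primrec f)
    (hg : Primrec g) : Primrec fun a => bif c a then f a else g a := Primrec.cond hc hf hg
@[fun_prop] theorem cons' {f : α → β} {g : α → List β} (hf : Primrec f) (hg : Primrec g) :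
    Primrec fun a => f a :: g a := Primrec.list_cons.comp hf hg
@[fun_prop] theorem append' {f g : α → List β} (hf : Primrec f) (hg : Primrec g) :
    Primrec fun a => f a ++ g a := Primrec.list_append.comp hf hg
@[fun_prop] theorem length' {f : α → List β} (hf : Primrec f) :
    Primrec fun a => (f a).length := Primrec.list_length.comp hf
@[fun_prop] theorem tail' {f : α → List β} (hf : Primrec f) :
    Primrec fun a => (f a).tail := Primrec.list_tail.comp hf
@[fun_prop] theorem reverse' {f : α → List β} (hf : Primrec f) :
    Primrec fun a => (f a).reverse := Primrec.list_reverse.comp hf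
@[fun_prop] theorem getD' {f : α → List β} {g : α → ℕ} (hf : Primrec f) (hg : Primrec g) (d : β) :
    Primrec fun a => (f a).getD (g a) d := (Primrec.list_getD d).comp hf hg
@[fun_prop] theorem take' {f : α → List β} {g : α → ℕ} (hf : Primrec f) (hg : Primrec g) :
    Primrec fun a => (f a).take (g a) := Primrec.list_take.comp hg hf
@[fun_prop] theorem drop' {f : α → List β} {g : α → ℕ} (hf : Primrec f) (hg : Primrec g) :
    Primrec fun a => (f a).drop (g a) := Primrec.list_drop.comp hg hf
@[fun_prop] theorem set' {f : α → List β} {g : α → ℕ} {h : α → β} (hf : Primrec f)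
    (hg : Primrec g) (hh : Primrec h) : Primrec fun a => (f a).set (g a) (h a) :=
  Primrec.list_set.comp hf (hg.pair hh)
@[fun_prop] theorem range' {f : α → ℕ} (hf : Primrec f) :
    Primrec fun a => List.range (f a) := Primrec.list_range.comp hf
@[fun_prop] theorem map' {f : α → List β} {g : α → β → σ} (hf : Primrec f)
    (hg : Primrec fun p : α × β => g p.1 p.2) : Primrec fun a => (f a).map (g a) :=
  Primrec.list_map hf hg
@[fun_prop] theorem flatMap' {f : α → List β} {g : α → β → List σ} (hf : Primrec f)
    (hg : Primrec fun p : α × β => g p.1 p.2) : Primrec fun a => (f a).flatMap (g a) :=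
  Primrec.list_flatMap hf hg
@[fun_prop] theorem findIdx' {f : α → List β} {g : α → β → Bool} (hf : Primrec f)
    (hg : Primrec fun p : α × β => g p.1 p.2) : Primrec fun a => (f a).findIdx (g a) :=
  Primrec.list_findIdx hf hg
@[fun_prop] theorem any' {f : α → List β} {g : α → β → Bool} (hf : Primrec f)
    (hg : Primrec fun p : α × β => g p.1 p.2) : Primrec fun a => (f a).any (g a) := by
  have h : Primrec fun a => decide ((f a).findIdx (g a) < (f a).length) := by fun_prop
  refine h.of_eq fun a => ?_
  rw [Bool.eq_iff_iff]
  simp [List.findIdx_lt_length]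
@[fun_prop] theorem filter' {f : α → List β} {g : α → β → Bool} (hf : Primrec f)
    (hg : Primrec fun p : α × β => g p.1 p.2) : Primrec fun a => (f a).filter (g a) := by
  have h : Primrec fun a => (f a).flatMap fun b => bif g a b then [b] else [] := by
    fun_prop
  refine h.of_eq fun a => ?_
  induction f a with
  | nil => rfl
  | cons b l ih => cases hb : g a b <;> simp_all
@[fun_prop] theorem foldl' {f : α → List β} {g : α → σ} {h : α → σ → β → σ} (hf : Primrec f)
    (hg : Primrec g) (hh : Primrec fun p : α × σ × β => h p.1 p.2.1 p.2.2) :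
    Primrec fun a => (f a).foldl (h a) (g a) :=
  Primrec.list_foldl (h := fun a p => h a p.1 p.2) hf hg hh
@[fun_prop] theorem foldr' {f : α → List β} {g : α → σ} {h : α → β → σ → σ} (hf : Primrec f)
    (hg : Primrec g) (hh : Primrec fun p : α × β × σ => h p.1 p.2.1 p.2.2) :
    Primrec fun a => (f a).foldr (h a) (g a) :=
  Primrec.list_foldr (h := fun a p => h a p.1 p.2) hf hg hh

end Comp

end ExtMem

namespace ExtMem

/-! ### Registers: lists of words stored one after the other in main memory -/

abbrev Params : Type := ℕ × ℕ × ℕ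

abbrev Regs : Type := List (List ℕ)

/-- The length prefixes make the encoding uniquely decodable; each register costs one extra word,
which `size` counts. -/
def enc (rs : Regs) : List ℕ := rs.flatMap fun l => l.length :: l

/-- The first component holds the registers in reverse order, the second the number of words still
missing from the current one. When it is 0, the next word is a length. -/
def decStep (p : Regs × ℕ) (w : ℕ) : Regs × ℕ :=
  bif decide (p.2 = 0) then ([] :: p.1, w) else ((p.1.getD 0 [] ++ [w]) :: p.1.tail, p.2 - 1)

def dec (l : List ℕ) : Regs := (l.foldl decStep ([], 0)).1.reverse

theorem foldl_decStep_partial (l : List ℕ) (a : List ℕ) (ls : Regs) (k : ℕ) :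
    l.foldl decStep (a :: ls, l.length + k) = ((a ++ l) :: ls, k) := by
  induction l generalizing a with
  | nil => simp
  | cons w l ih =>
    have : decStep (a :: ls, (w :: l).length + k) w = ((a ++ [w]) :: ls, l.length + k) := by
      simp [decStep, Nat.add_right_comm]
    rw [List.foldl_cons, this, ih]; simp

theorem foldl_decStep_enc (rs ls : Regs) :
    (enc rs).foldl decStep (ls, 0) = (rs.reverse ++ ls, 0) := by
  induction rs generalizing ls with
  | nil => simp [enc]
  | cons l rs ih =>
    have h : enc (l :: rs) = l.length :: l ++ enc rs := by simp [enc]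
    have h2 : decStep (ls, 0) l.length = ([] :: ls, l.length + 0) := by simp [decStep]
    rw [h, List.foldl_append, List.foldl_cons, h2, foldl_decStep_partial, ih]
    simp

@[simp] theorem dec_enc (rs : Regs) : dec (enc rs) = rs := by
  simp [dec, foldl_decStep_enc]

theorem enc_cons (l : List ℕ) (rs : Regs) : enc (l :: rs) = l.length :: (l ++ enc rs) := by
  simp [enc]

/-- Word `j` of register `i`. -/
def sc (rs : Regs) (i j : ℕ) : ℕ := (rs.getD i []).getD j 0

@[simp] theorem sc_zero (l : List ℕ) (rs : Regs) (j : ℕ) : sc (l :: rs) 0 j = l.getD j 0 := rfl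

@[simp] theorem sc_succ (l : List ℕ) (rs : Regs) (i j : ℕ) :
    sc (l :: rs) (i + 1) j = sc rs i j := rfl

def size (rs : Regs) : ℕ := (enc rs).length

@[simp] theorem size_nil : size [] = 0 := rfl

@[simp] theorem size_cons (l : List ℕ) (rs : Regs) : size (l :: rs) = l.length + 1 + size rs := by
  simp [size, enc_cons]; omega

/-- All words that are stored for the registers are below `W`. -/
def Good (W : ℕ) (rs : Regs) : Prop := ∀ l ∈ rs, l.length < W ∧ ∀ w ∈ l, w < W

@[simp] theorem good_nil (W : ℕ) : Good W [] := by simp [Good]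

@[simp] theorem good_cons (W : ℕ) (l : List ℕ) (rs : Regs) :
    Good W (l :: rs) ↔ (l.length < W ∧ ∀ w ∈ l, w < W) ∧ Good W rs := by simp [Good]

theorem Good.lt_of_mem_enc {W : ℕ} {rs : Regs} (h : Good W rs) : ∀ w ∈ enc rs, w < W := by
  intro w hw
  simp only [enc, List.mem_flatMap, List.mem_cons] at hw
  obtain ⟨l, hl, rfl | hw⟩ := hw
  · exact (h l hl).1
  · exact (h l hl).2 w hw

theorem fits_enc {μ : Machine} {rs : Regs} (h : size rs ≤ μ.cap) (hg : Good μ.W rs) :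
    μ.Fits (enc rs) := ⟨h, hg.lt_of_mem_enc⟩

section Primrec

variable {α : Type*} [Primcodable α]

@[fun_prop] theorem primrec_enc {f : α → Regs} (hf : Primrec f) : Primrec fun a => enc (f a) := by
  unfold enc; fun_prop

@[fun_prop] theorem primrec_decStep {f : α → Regs × ℕ} {g : α → ℕ} (hf : Primrec f)
    (hg : Primrec g) : Primrec fun a => decStep (f a) (g a) := by
  unfold decStep; fun_prop

@[fun_prop] theorem primrec_dec {f : α → List ℕ} (hf : Primrec f) :
    Primrec fun a => dec (f a) := by
  unfold dec; fun_prop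

@[fun_prop] theorem primrec_sc {f : α → Regs} {g h : α → ℕ} (hf : Primrec f) (hg : Primrec g)
    (hh : Primrec h) : Primrec fun a => sc (f a) (g a) (h a) := by
  unfold sc; fun_prop

end Primrec

/-! ### Basic programs on registers -/

theorem Exec.seq_eq {μ : Machine} {p q : Prog} {s s' s'' : State} {t t' u : ℕ}
    (h : Exec μ p s t s') (h' : Exec μ q s' t' s'') (hu : t + t' = u) :
    Exec μ (.seq p q) s u s'' := hu ▸ .seq h h'

theorem computable_cmp {F : Params → Regs → Regs}
    (hF : Primrec fun v : Params × Regs => F v.1 v.2) :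
    Computable fun v : View => enc (F v.1 (dec v.2)) :=
  Primrec.to_comp (by
    have : Primrec fun v : View => F v.1 (dec v.2) :=
      hF.comp (g := fun v : View => (v.1, dec v.2)) (by fun_prop)
    fun_prop)

/-- A computation on registers. -/
def cmp (F : Params → Regs → Regs) (hF : Primrec fun v : Params × Regs => F v.1 v.2) : Prog :=
  .compute (fun v => enc (F v.1 (dec v.2)))
    (computable_cmp hF)

theorem exec_cmp {μ : Machine} {F : Params → Regs → Regs}
    {hF : Primrec fun v : Params × Regs => F v.1 v.2} {rs rs' : Regs} {d : ℕ → ℕ} {o : List ℕ}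
    (h : F (μ.M, μ.B, μ.W) rs = rs') (hc : size rs' ≤ μ.cap) (hg : Good μ.W rs') :
    Exec μ (cmp F hF) ⟨enc rs, d, o⟩ 0 ⟨enc rs', d, o⟩ := by
  subst h
  have := @Exec.compute μ (fun v => enc (F v.1 (dec v.2))) (computable_cmp hF) ⟨enc rs, d, o⟩
    (by simpa [Machine.view] using fits_enc hc hg)
  simp only [Machine.view, dec_enc] at this
  exact this

theorem computable_test {T : Params → Regs → Bool}
    (hT : Primrec fun v : Params × Regs => T v.1 v.2) :
    Computable fun v : View => T v.1 (dec v.2) :=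
  Primrec.to_comp (hT.comp (g := fun v : View => (v.1, dec v.2)) (by fun_prop))

def rloop (T : Params → Regs → Bool) (hT : Primrec fun v : Params × Regs => T v.1 v.2)
    (p : Prog) : Prog := .loop (fun v => T v.1 (dec v.2)) (computable_test hT) p

def rite (T : Params → Regs → Bool) (hT : Primrec fun v : Params × Regs => T v.1 v.2)
    (p q : Prog) : Prog := .ite (fun v => T v.1 (dec v.2)) (computable_test hT) p q

theorem exec_rite_true {μ : Machine} {T : Params → Regs → Bool}
    {hT : Primrec fun v : Params × Regs => T v.1 v.2} {p q : Prog} {rs : Regs} {d : ℕ → ℕ}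
    {o : List ℕ} {t : ℕ} {s' : State} (h : T (μ.M, μ.B, μ.W) rs = true)
    (hp : Exec μ p ⟨enc rs, d, o⟩ t s') : Exec μ (rite T hT p q) ⟨enc rs, d, o⟩ t s' :=
  .ite_true (by simpa [Machine.view] using h) hp

theorem exec_rite_false {μ : Machine} {T : Params → Regs → Bool}
    {hT : Primrec fun v : Params × Regs => T v.1 v.2} {p q : Prog} {rs : Regs} {d : ℕ → ℕ}
    {o : List ℕ} {t : ℕ} {s' : State} (h : T (μ.M, μ.B, μ.W) rs = false)
    (hq : Exec μ q ⟨enc rs, d, o⟩ t s') : Exec μ (rite T hT p q) ⟨enc rs, d, o⟩ t s' :=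
  .ite_false (by simpa [Machine.view] using h) hq

/-- Loops with an invariant `I` on abstract states `a`, represented by `regs a`, `disk a` and
`out a`, a termination measure `ms` and an I/O potential `pot`. -/
theorem exec_rloop {μ : Machine} {T : Params → Regs → Bool}
    {hT : Primrec fun v : Params × Regs => T v.1 v.2} {p : Prog} {A : Type*}
    (regs : A → Regs) (disk : A → ℕ → ℕ) (out : A → List ℕ) (I : A → Prop) (ms pot : A → ℕ)
    (step : ∀ a, I a → T (μ.M, μ.B, μ.W) (regs a) = true → ∃ a' t,
      Exec μ p ⟨enc (regs a), disk a, out a⟩ t ⟨enc (regs a'), disk a', out a'⟩ ∧ I a' ∧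
        ms a' < ms a ∧ t + pot a' ≤ pot a)
    (a : A) (ha : I a) :
    ∃ a' t, Exec μ (rloop T hT p) ⟨enc (regs a), disk a, out a⟩ t
        ⟨enc (regs a'), disk a', out a'⟩ ∧ I a' ∧ T (μ.M, μ.B, μ.W) (regs a') = false ∧
        t + pot a' ≤ pot a := by
  induction hn : ms a using Nat.strong_induction_on generalizing a with
  | _ n ih =>
    cases hb : T (μ.M, μ.B, μ.W) (regs a) with
    | false =>
      exact ⟨a, 0, .loop_done (by simpa [Machine.view] using hb), ha, hb, by simp⟩
    | true =>
      obtain ⟨a', t, h, hI, hm, hp⟩ := step a ha hb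
      obtain ⟨a'', t', h', hI', hb', hp'⟩ := ih (ms a') (hn ▸ hm) a' hI rfl
      exact ⟨a'', t + t', .loop_step (by simpa [Machine.view] using hb) h h', hI', hb', by omega⟩

theorem computable_addr {A : Params → Regs → ℕ}
    (hA : Primrec fun v : Params × Regs => A v.1 v.2) :
    Computable fun v : View => A v.1 (dec v.2) :: v.2 :=
  Primrec.to_comp (by
    have : Primrec fun v : View => A v.1 (dec v.2) :=
      hA.comp (g := fun v : View => (v.1, dec v.2)) (by fun_prop)
    fun_prop)

theorem primrec_mem : Primrec fun v : View => dec (v.2.drop v.1.2.1) := by fun_prop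

theorem primrec_load {β : Type*} [Primcodable β] {G : Params → List ℕ → Regs → β}
    (hG : Primrec fun v : Params × List ℕ × Regs => G v.1 v.2.1 v.2.2) :
    Primrec fun v : View => G v.1 (v.2.take v.1.2.1) (dec (v.2.drop v.1.2.1)) :=
  hG.comp (g := fun v : View => (v.1, v.2.take v.1.2.1, dec (v.2.drop v.1.2.1)))
    (Comp.pair' Primrec.fst (Comp.pair' (by fun_prop) primrec_mem))

theorem computable_load {G : Params → List ℕ → Regs → Regs}
    (hG : Primrec fun v : Params × List ℕ × Regs => G v.1 v.2.1 v.2.2) :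
    Computable fun v : View => enc (G v.1 (v.2.take v.1.2.1) (dec (v.2.drop v.1.2.1))) :=
  Primrec.to_comp (primrec_enc (primrec_load hG))

theorem computable_store {A : Params → Regs → ℕ}
    (hA : Primrec fun v : Params × Regs => A v.1 v.2) {G : Params → List ℕ → Regs → List ℕ}
    (hG : Primrec fun v : Params × List ℕ × Regs => G v.1 v.2.1 v.2.2) :
    Computable fun v : View => A v.1 (dec (v.2.drop v.1.2.1)) ::
      (G v.1 (v.2.take v.1.2.1) (dec (v.2.drop v.1.2.1)) ++ v.2.drop v.1.2.1) :=
  Primrec.to_comp (Comp.cons' (hA.comp (g := fun v : View => (v.1, dec (v.2.drop v.1.2.1)))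
    (Comp.pair' Primrec.fst primrec_mem)) (Comp.append' (primrec_load hG) (by fun_prop)))

/-- Reads the block with address `A` and lets `G` store it. -/
def rd (A : Params → Regs → ℕ) (hA : Primrec fun v : Params × Regs => A v.1 v.2)
    (G : Params → List ℕ → Regs → Regs)
    (hG : Primrec fun v : Params × List ℕ × Regs => G v.1 v.2.1 v.2.2) : Prog :=
  .seq (.compute (fun v => A v.1 (dec v.2) :: v.2) (computable_addr hA))
    (.seq .read (.compute (fun v => enc (G v.1 (v.2.take v.1.2.1) (dec (v.2.drop v.1.2.1))))
      (computable_load hG)))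

theorem length_block (μ : Machine) (d : ℕ → ℕ) (a : ℕ) : (μ.block d a).length = μ.B := by
  simp [Machine.block]

theorem exec_rd {μ : Machine} {A : Params → Regs → ℕ}
    {hA : Primrec fun v : Params × Regs => A v.1 v.2} {G : Params → List ℕ → Regs → Regs}
    {hG : Primrec fun v : Params × List ℕ × Regs => G v.1 v.2.1 v.2.2} {rs rs' : Regs}
    {d : ℕ → ℕ} {o : List ℕ} {a : ℕ} (hB : 1 ≤ μ.B) (ha : A (μ.M, μ.B, μ.W) rs = a)
    (haW : a < μ.W) (hd : ∀ y, d y < μ.W) (hg : Good μ.W rs) (hs : μ.B + size rs ≤ μ.cap)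
    (h : G (μ.M, μ.B, μ.W) (μ.block d a) rs = rs') (hs' : size rs' ≤ μ.cap)
    (hg' : Good μ.W rs') :
    Exec μ (rd A hA G hG) ⟨enc rs, d, o⟩ 1 ⟨enc rs', d, o⟩ := by
  subst ha h
  refine Exec.seq_eq (t := 0) (t' := 1)
    (s' := ⟨A (μ.M, μ.B, μ.W) rs :: enc rs, d, o⟩) ?_ (Exec.seq_eq (t := 1) (t' := 0)
    (s' := ⟨μ.block d (A (μ.M, μ.B, μ.W) rs) ++ enc rs, d, o⟩) ?_ ?_ rfl) rfl
  · have := @Exec.compute μ (fun v => A v.1 (dec v.2) :: v.2) (computable_addr hA) ⟨enc rs, d, o⟩ ⟨by simp [Machine.view]; unfold size at hs; omega, by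
        simpa [Machine.view] using ⟨haW, hg.lt_of_mem_enc⟩⟩
    simpa [Machine.view] using this
  · refine .read ⟨by simp [length_block]; unfold size at hs; omega, fun w hw => ?_⟩
    rcases List.mem_append.1 hw with hw | hw
    · simp only [Machine.block, List.mem_map] at hw
      obtain ⟨i, -, rfl⟩ := hw
      exact hd _
    · exact hg.lt_of_mem_enc w hw
  · have hl := length_block μ d (A (μ.M, μ.B, μ.W) rs)
    have := @Exec.compute μ (fun v => enc (G v.1 (v.2.take v.1.2.1) (dec (v.2.drop v.1.2.1))))
      (computable_load hG) ⟨μ.block d (A (μ.M, μ.B, μ.W) rs) ++ enc rs, d, o⟩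
        (by simpa [Machine.view, List.take_left' hl, List.drop_left' hl] using fits_enc hs' hg')
    simpa [Machine.view, List.take_left' hl, List.drop_left' hl] using this

/-- Replaces the block with address `A` by what `G` computes from it. -/
def upd (A : Params → Regs → ℕ) (hA : Primrec fun v : Params × Regs => A v.1 v.2)
    (G : Params → List ℕ → Regs → List ℕ)
    (hG : Primrec fun v : Params × List ℕ × Regs => G v.1 v.2.1 v.2.2) : Prog :=
  .seq (.compute (fun v => A v.1 (dec v.2) :: v.2) (computable_addr hA))
    (.seq .read (.seq (.compute (fun v => A v.1 (dec (v.2.drop v.1.2.1)) ::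
        (G v.1 (v.2.take v.1.2.1) (dec (v.2.drop v.1.2.1)) ++ v.2.drop v.1.2.1))
      (computable_store hA hG)) .write))

/-- Before the write, the address stands in front of a full block and all registers; the strict
inequality in `hs` pays for this extra word. -/
theorem exec_upd {μ : Machine} {A : Params → Regs → ℕ}
    {hA : Primrec fun v : Params × Regs => A v.1 v.2} {G : Params → List ℕ → Regs → List ℕ}
    {hG : Primrec fun v : Params × List ℕ × Regs => G v.1 v.2.1 v.2.2} {rs : Regs}
    {d : ℕ → ℕ} {o blk : List ℕ} {a : ℕ} (hB : 1 ≤ μ.B) (ha : A (μ.M, μ.B, μ.W) rs = a)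
    (haW : a < μ.W) (hd : ∀ y, d y < μ.W) (hg : Good μ.W rs) (hs : μ.B + size rs < μ.cap)
    (h : G (μ.M, μ.B, μ.W) (μ.block d a) rs = blk) (hl' : blk.length = μ.B)
    (hW : ∀ w ∈ blk, w < μ.W) :
    Exec μ (upd A hA G hG) ⟨enc rs, d, o⟩ 2 ⟨enc rs, μ.setBlock d a blk, o⟩ := by
  subst ha h
  refine Exec.seq_eq (t := 0) (t' := 2)
    (s' := ⟨A (μ.M, μ.B, μ.W) rs :: enc rs, d, o⟩) ?_ (Exec.seq_eq (t := 1) (t' := 1)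
    (s' := ⟨μ.block d (A (μ.M, μ.B, μ.W) rs) ++ enc rs, d, o⟩) ?_
      (Exec.seq_eq (t := 0) (t' := 1) (s' := ⟨A (μ.M, μ.B, μ.W) rs ::
        (G (μ.M, μ.B, μ.W) (μ.block d (A (μ.M, μ.B, μ.W) rs)) rs ++ enc rs), d, o⟩) ?_
        (.write hl') rfl) rfl) rfl
  · have := @Exec.compute μ (fun v => A v.1 (dec v.2) :: v.2) (computable_addr hA) ⟨enc rs, d, o⟩ ⟨by simp [Machine.view]; unfold size at hs; omega, by
        simpa [Machine.view] using ⟨haW, hg.lt_of_mem_enc⟩⟩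
    simpa [Machine.view] using this
  · refine .read ⟨by simp [length_block]; unfold size at hs; omega, fun w hw => ?_⟩
    rcases List.mem_append.1 hw with hw | hw
    · simp only [Machine.block, List.mem_map] at hw
      obtain ⟨i, -, rfl⟩ := hw
      exact hd _
    · exact hg.lt_of_mem_enc w hw
  · have hl := length_block μ d (A (μ.M, μ.B, μ.W) rs)
    have := @Exec.compute μ (fun v => A v.1 (dec (v.2.drop v.1.2.1)) ::
        (G v.1 (v.2.take v.1.2.1) (dec (v.2.drop v.1.2.1)) ++ v.2.drop v.1.2.1))
      (computable_store hA hG) ⟨μ.block d (A (μ.M, μ.B, μ.W) rs) ++ enc rs, d, o⟩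
        ⟨by
          simp [Machine.view, List.take_left' hl, List.drop_left' hl, hl']
          unfold size at hs; omega, by
          simp only [Machine.view, List.take_left' hl, List.drop_left' hl, dec_enc,
            List.mem_cons, List.mem_append]
          rintro w (rfl | hw | hw)
          exacts [haW, hW w hw, hg.lt_of_mem_enc w hw]⟩
    simpa [Machine.view, List.take_left' hl, List.drop_left' hl] using this

/-! ### Access to an arbitrary range of at most `B` words -/

/-- The words `x, …, x + j - 1` of external memory. -/
def region (d : ℕ → ℕ) (x j : ℕ) : List ℕ := (List.range j).map fun i => d (x + i)

@[simp] theorem length_region (d : ℕ → ℕ) (x j : ℕ) : (region d x j).length = j := by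
  simp [region]

/-- Here `l` was read from the block of `x` and `blk` is the next block; word `i` comes from the
latter once its offset reaches `B`. -/
def pickWord (B x : ℕ) (l blk : List ℕ) (i : ℕ) : ℕ :=
  bif decide (x % B + i < B) then l.getD i 0 else blk.getD (x % B + i - B) 0

@[fun_prop] theorem primrec_pickWord {α : Type*} [Primcodable α] {B x i : α → ℕ}
    {l blk : α → List ℕ} (hB : Primrec B) (hx : Primrec x) (hi : Primrec i) (hl : Primrec l)
    (hb : Primrec blk) : Primrec fun a => pickWord (B a) (x a) (l a) (blk a) (i a) := by
  unfold pickWord; fun_prop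

/-- Registers `[x, j] :: rs` become `region d x j :: rs`. -/
def readRange : Prog :=
  .seq (rd (fun P rs => sc rs 0 0 / P.2.1) (by fun_prop)
      (fun P blk rs => (List.range (sc rs 0 1)).map
        (fun i => blk.getD (sc rs 0 0 % P.2.1 + i) 0) :: rs) (by fun_prop))
    (rd (fun P rs => sc rs 1 0 / P.2.1 + 1) (by fun_prop)
      (fun P blk rs => (List.range (sc rs 1 1)).map
        (fun i => pickWord P.2.1 (sc rs 1 0) (rs.getD 0 []) blk i) :: rs.drop 2)
      (by fun_prop))

theorem getD_block {μ : Machine} {d : ℕ → ℕ} {a i : ℕ} (hi : i < μ.B) :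
    (μ.block d a).getD i 0 = d (a * μ.B + i) := by
  simp [Machine.block, hi, List.getD_eq_getElem?_getD]

/-- At most `B` consecutive words meet at most two blocks. Both are always read, so no alignment of
arrays to blocks is needed and the cost is constant. -/
theorem exec_readRange {μ : Machine} {x j : ℕ} {rs : Regs} {d : ℕ → ℕ} {o : List ℕ}
    (hB : 1 ≤ μ.B) (hj : j ≤ μ.B) (hx : x + 3 < μ.W) (hjW : j < μ.W) (hd : ∀ y, d y < μ.W)
    (hg : Good μ.W rs) (hs : μ.B + j + 4 + size rs ≤ μ.cap) :
    Exec μ readRange ⟨enc ([x, j] :: rs), d, o⟩ 2 ⟨enc (region d x j :: rs), d, o⟩ := by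
  have hxW : x / μ.B ≤ x := Nat.div_le_self _ _
  refine Exec.seq_eq (t := 1) (t' := 1) (exec_rd (a := x / μ.B) hB (by simp) (by omega) hd
    (by simp; exact ⟨⟨by omega, by omega, by omega⟩, hg⟩) (by simp; omega) rfl
      (by simp; omega) ?_) (exec_rd (a := x / μ.B + 1) hB (by simp) (by omega) hd
      ?_ (by simp; omega) ?_ (by simp; omega) ?_) rfl
  · simp only [good_cons, sc_zero, List.getD_cons_zero, List.getD_cons_succ, List.length_map,
      List.length_range, List.mem_map, List.mem_range]
    refine ⟨⟨by omega, ?_⟩, ⟨by simp; omega, by simp; omega⟩, hg⟩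
    rintro w ⟨i, hi, rfl⟩
    by_cases h : x % μ.B + i < μ.B
    · rw [getD_block h]; exact hd _
    -- Words beyond the first block are provisionally 0 until the second read replaces them.
    · rw [List.getD_eq_default _ _ (by rw [length_block]; omega)]; omega
  · simp only [good_cons, sc_zero, List.getD_cons_zero, List.getD_cons_succ, List.length_map,
      List.length_range, List.mem_map, List.mem_range]
    refine ⟨⟨by omega, ?_⟩, ⟨by simp; omega, by simp; omega⟩, hg⟩
    rintro w ⟨i, hi, rfl⟩
    by_cases h : x % μ.B + i < μ.B
    · rw [getD_block h]; exact hd _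
    · rw [List.getD_eq_default _ _ (by rw [length_block]; omega)]; omega
  · have hdm := Nat.div_add_mod x μ.B
    have hml := Nat.mod_lt x hB
    simp only [pickWord, sc_zero, sc_succ, List.getD_cons_zero, List.getD_cons_succ, List.drop_succ_cons, List.drop_zero,
      region, List.cons.injEq, and_true]
    refine List.map_congr_left fun i hi => ?_
    simp only [List.mem_range] at hi
    by_cases h : x % μ.B + i < μ.B
    · simp only [h, decide_true, cond_true]
      rw [List.getD_eq_getElem _ _ (by simpa using hi)]
      simp only [List.getElem_map, List.getElem_range]
      rw [getD_block h, ← add_assoc, mul_comm, hdm]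
    · simp only [h, decide_false, cond_false]
      rw [getD_block (by omega)]
      congr 1
      rw [add_mul, mul_comm]; omega
  · simp only [good_cons, region, List.mem_map]
    refine ⟨⟨by simpa using hjW, ?_⟩, hg⟩
    rintro w ⟨i, hi, rfl⟩
    exact hd _

/-- Overwrites the words from address `x` on by the list `l`. -/
def patch (d : ℕ → ℕ) (x : ℕ) (l : List ℕ) (y : ℕ) : ℕ :=
  if x ≤ y ∧ y < x + l.length then l.getD (y - x) 0 else d y

/-- The offset `e` is 0 or 1 and selects the block of `x` or the one after it. -/
def patchWord (B e x : ℕ) (l blk : List ℕ) (i : ℕ) : ℕ :=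
  bif decide (x ≤ (x / B + e) * B + i) && decide ((x / B + e) * B + i < x + l.length) then
    l.getD ((x / B + e) * B + i - x) 0
  else blk.getD i 0

@[fun_prop] theorem primrec_patchWord {α : Type*} [Primcodable α] (e : ℕ) {B x i : α → ℕ}
    {l blk : α → List ℕ} (hB : Primrec B) (hx : Primrec x) (hi : Primrec i) (hl : Primrec l)
    (hb : Primrec blk) : Primrec fun a => patchWord (B a) e (x a) (l a) (blk a) (i a) := by
  unfold patchWord; fun_prop

def patchBlock (P : Params) (e : ℕ) (blk : List ℕ) (rs : Regs) : List ℕ :=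
  (List.range P.2.1).map fun i =>
    patchWord P.2.1 e (sc rs 0 0) (rs.getD 1 []) blk i

theorem primrec_patchBlock (e : ℕ) :
    Primrec fun v : Params × List ℕ × Regs => patchBlock v.1 e v.2.1 v.2.2 := by
  unfold patchBlock; fun_prop

/-- Registers `[x] :: l :: rs` become `rs`, and `l` is written to the addresses from `x` on. -/
def writeRange : Prog :=
  .seq (upd (fun P rs => sc rs 0 0 / P.2.1 + 0) (by fun_prop)
      (fun P blk rs => patchBlock P 0 blk rs) (primrec_patchBlock 0))
    (.seq (upd (fun P rs => sc rs 0 0 / P.2.1 + 1) (by fun_prop)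
      (fun P blk rs => patchBlock P 1 blk rs) (primrec_patchBlock 1))
      (cmp (fun _ rs => rs.drop 2) (by fun_prop)))

theorem patchBlock_eq {μ : Machine} {x e : ℕ} {l : List ℕ} {rs : Regs} {d : ℕ → ℕ} :
    patchBlock (μ.M, μ.B, μ.W) e (μ.block d (x / μ.B + e)) ([x] :: l :: rs) =
      μ.block (patch d x l) (x / μ.B + e) := by
  unfold patchBlock Machine.block
  refine List.map_congr_left fun i hi => ?_
  simp only [List.mem_range] at hi
  have := getD_block (d := d) (a := x / μ.B + e) hi
  unfold Machine.block at this
  simp only [patchWord, sc_zero, List.getD_cons_zero, List.getD_cons_succ, this, patch, ← Bool.decide_and]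
  by_cases h : x ≤ (x / μ.B + e) * μ.B + i ∧ (x / μ.B + e) * μ.B + i < x + l.length <;>
    simp [h]

theorem patch_lt {d : ℕ → ℕ} {x : ℕ} {l : List ℕ} {W : ℕ} (hd : ∀ y, d y < W)
    (hl : ∀ w ∈ l, w < W) (y : ℕ) : patch d x l y < W := by
  unfold patch
  split_ifs with h
  · rw [List.getD_eq_getElem _ _ (by omega)]
    exact hl _ (List.getElem_mem _)
  · exact hd y

theorem setBlock_block {μ : Machine} (hB : 1 ≤ μ.B) (d d' : ℕ → ℕ) (a : ℕ) :
    μ.setBlock d a (μ.block d' a) = fun y => if y / μ.B = a then d' y else d y := by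
  funext y
  unfold Machine.setBlock
  split_ifs with h
  · rw [getD_block (Nat.mod_lt _ hB), ← h, mul_comm, Nat.div_add_mod]
  · rfl

/-- Since `l` has at most `B` words, every overwritten address lies in one of the two blocks. The
second patch is computed from a memory that already contains the first, which is harmless because
patching is idempotent. -/
theorem patch_eq_setBlock {μ : Machine} {x : ℕ} {l : List ℕ} {d : ℕ → ℕ}
    (hB : 1 ≤ μ.B) (hl : l.length ≤ μ.B) :
    μ.setBlock (μ.setBlock d (x / μ.B + 0) (μ.block (patch d x l) (x / μ.B + 0))) (x / μ.B + 1)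
      (μ.block (patch (μ.setBlock d (x / μ.B + 0) (μ.block (patch d x l) (x / μ.B + 0))) x l)
        (x / μ.B + 1)) = patch d x l := by
  rw [setBlock_block hB, setBlock_block hB]
  funext y
  have hdm := Nat.div_add_mod x μ.B
  have hml := Nat.mod_lt x hB
  have hdm' := Nat.div_add_mod y μ.B
  have hml' := Nat.mod_lt y hB
  unfold patch
  by_cases h : x ≤ y ∧ y < x + l.length
  · have h1 : x / μ.B ≤ y / μ.B := Nat.div_le_div_right h.1
    have h2 : y / μ.B < x / μ.B + 2 := by
      refine Nat.div_lt_of_lt_mul ?_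
      rw [mul_add]; omega
    have : y / μ.B = x / μ.B ∨ y / μ.B = x / μ.B + 1 := by omega
    rcases this with h' | h' <;> simp [h, h']
  · simp [h]

theorem exec_writeRange {μ : Machine} {x : ℕ} {l : List ℕ} {rs : Regs} {d : ℕ → ℕ} {o : List ℕ}
    (hB : 1 ≤ μ.B) (hl : l.length ≤ μ.B) (hx : x + 3 < μ.W) (hlW : l.length < μ.W)
    (hd : ∀ y, d y < μ.W) (hlw : ∀ w ∈ l, w < μ.W)
    (hg : Good μ.W rs) (hs : μ.B + l.length + 4 + size rs ≤ μ.cap) :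
    Exec μ writeRange ⟨enc ([x] :: l :: rs), d, o⟩ 4 ⟨enc rs, patch d x l, o⟩ := by
  have hxW : x / μ.B ≤ x := Nat.div_le_self _ _
  have hg' : Good μ.W ([x] :: l :: rs) := by
    simp; exact ⟨⟨by omega, by omega⟩, ⟨hlW, hlw⟩, hg⟩
  have hs' : μ.B + size ([x] :: l :: rs) < μ.cap := by simp; omega
  have hb : ∀ (d : ℕ → ℕ) (a : ℕ), (∀ y, d y < μ.W) → ∀ w ∈ μ.block d a, w < μ.W := by
    intro d a hd w hw
    simp only [Machine.block, List.mem_map] at hw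
    obtain ⟨i, -, rfl⟩ := hw
    exact hd _
  have hd' : ∀ y, μ.setBlock d (x / μ.B + 0) (μ.block (patch d x l) (x / μ.B + 0)) y < μ.W := by
    rw [setBlock_block hB]
    intro y
    dsimp only
    split_ifs
    exacts [patch_lt hd hlw y, hd y]
  rw [← patch_eq_setBlock (d := d) hB hl]
  refine Exec.seq_eq (t := 2) (t' := 2) (exec_upd (a := x / μ.B + 0) hB (by simp) (by omega) hd
    hg' hs' patchBlock_eq (length_block _ _ _) (hb _ _ (patch_lt hd hlw))) 
    (Exec.seq_eq (t := 2) (t' := 0) (exec_upd (a := x / μ.B + 1) hB (by simp) (by omega) hd'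
    hg' hs' patchBlock_eq (length_block _ _ _) (hb _ _ (patch_lt hd' hlw)))
      (exec_cmp (by simp) (by omega) hg) rfl) rfl

end ExtMem

namespace ExtMem

/-! ### Internal sorting -/

/-- Splitting by two filters avoids recursion, so primitive recursiveness is immediate; the running
time of internal sorting does not matter. -/
def ins (x : ℕ) (l : List ℕ) : List ℕ :=
  l.filter (fun y => decide (y < x)) ++ x :: l.filter (fun y => !decide (y < x))

/-- Sorts a list. -/
def sortl (l : List ℕ) : List ℕ := l.foldr ins []

@[fun_prop] theorem primrec_ins {α : Type*} [Primcodable α] {f : α → ℕ} {g : α → List ℕ}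
    (hf : Primrec f) (hg : Primrec g) : Primrec fun a => ins (f a) (g a) := by
  unfold ins; fun_prop

@[fun_prop] theorem primrec_sortl {α : Type*} [Primcodable α] {g : α → List ℕ}
    (hg : Primrec g) : Primrec fun a => sortl (g a) := by
  unfold sortl; fun_prop

theorem ins_perm (x : ℕ) (l : List ℕ) : (ins x l).Perm (x :: l) :=
  List.perm_middle.trans ((List.filter_append_perm _ l).cons x)

theorem sortl_perm (l : List ℕ) : (sortl l).Perm l := by
  induction l with
  | nil => exact .nil
  | cons x l ih => exact (ins_perm x _).trans (ih.cons x)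

theorem sortl_sorted (l : List ℕ) : (sortl l).Pairwise (· ≤ ·) := by
  induction l with
  | nil => exact .nil
  | cons x l ih =>
    change (ins x (sortl l)).Pairwise (· ≤ ·)
    unfold ins
    refine List.pairwise_append.2 ⟨ih.filter _, List.pairwise_cons.2 ⟨?_, ih.filter _⟩, ?_⟩
    · simp
    · simp only [List.mem_filter, List.mem_cons, decide_eq_true_eq, Bool.not_eq_true',
        decide_eq_false_iff_not, not_lt]
      rintro a ⟨-, ha⟩ c (rfl | ⟨-, hc⟩) <;> omega

@[simp] theorem length_sortl (l : List ℕ) : (sortl l).length = l.length := (sortl_perm l).length_eq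

@[simp] theorem mem_sortl {l : List ℕ} {x : ℕ} : x ∈ sortl l ↔ x ∈ l := (sortl_perm l).mem_iff

theorem eq_sortl {l l' : List ℕ} (h : l'.Perm l) (hs : l'.Pairwise (· ≤ ·)) : l' = sortl l :=
  (h.trans (sortl_perm l).symm).eq_of_pairwise (fun _ _ _ _ => le_antisymm) hs (sortl_sorted l)

/-! ### Geometry of external memory -/

/-- Number of words that are transferred at a time. -/
def pageLen (B n m : ℕ) : ℕ := min (B / 8 + 1) (n + 2 * m + 1)

/-- Number of pages that hold an array of `n + 2 * m + 1` words. -/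
def numPages (B n m : ℕ) : ℕ := (n + 2 * m) / pageLen B n m + 1

/-- Number of words of an array. -/
def arrLen (B n m : ℕ) : ℕ := numPages B n m * pageLen B n m

/-- Number of runs that are merged at a time. -/
def fanIn (M B : ℕ) : ℕ := M / (32 * B) + 2

section Primrec

variable {α : Type*} [Primcodable α]

@[fun_prop] theorem primrec_pageLen {f g h : α → ℕ} (hf : Primrec f) (hg : Primrec g)
    (hh : Primrec h) : Primrec fun a => pageLen (f a) (g a) (h a) := by
  unfold pageLen; fun_prop

@[fun_prop] theorem primrec_numPages {f g h : α → ℕ} (hf : Primrec f) (hg : Primrec g)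
    (hh : Primrec h) : Primrec fun a => numPages (f a) (g a) (h a) := by
  unfold numPages; fun_prop

@[fun_prop] theorem primrec_arrLen {f g h : α → ℕ} (hf : Primrec f) (hg : Primrec g)
    (hh : Primrec h) : Primrec fun a => arrLen (f a) (g a) (h a) := by
  unfold arrLen; fun_prop

@[fun_prop] theorem primrec_fanIn {f g : α → ℕ} (hf : Primrec f) (hg : Primrec g) :
    Primrec fun a => fanIn (f a) (g a) := by
  unfold fanIn; fun_prop

end Primrec

/-- Page `j` of a list. -/
def page (b : ℕ) (l : List ℕ) (j : ℕ) : List ℕ := (l.drop (j * b)).take b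

/-- The last element of `l` with property `p`, and `s` if there is none. -/
def lastM (p : ℕ → Bool) (s : ℕ) (l : List ℕ) : ℕ := l.foldl (fun s x => bif p x then x else s) s

/-- Replaces each word `x` by a function of its index, of the last word with property `p` before it,
and of `x`. -/
def passOut (p : ℕ → Bool) (f : ℕ → ℕ → ℕ → ℕ) (i s : ℕ) (l : List ℕ) : List ℕ :=
  (List.range l.length).map fun j => f (i + j) (lastM p s (l.take j)) (l.getD j 0)

/-! ### Word-by-word passes, and their compatibility with the division into pages. -/

theorem length_passOut (p : ℕ → Bool) (f : ℕ → ℕ → ℕ → ℕ) (i s : ℕ) (l : List ℕ) :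
    (passOut p f i s l).length = l.length := by simp [passOut]

theorem lastM_append (p : ℕ → Bool) (s : ℕ) (l l' : List ℕ) :
    lastM p s (l ++ l') = lastM p (lastM p s l) l' := by simp [lastM]

theorem lastM_mem (p : ℕ → Bool) (s : ℕ) (l : List ℕ) : lastM p s l = s ∨ lastM p s l ∈ l := by
  induction l generalizing s with
  | nil => exact .inl rfl
  | cons x l ih =>
    change lastM p (bif p x then x else s) l = s ∨ lastM p (bif p x then x else s) l ∈ x :: l
    cases hp : p x with
    | false =>
      rcases ih s with h | h
      · exact .inl h
      · exact .inr (List.mem_cons_of_mem _ h)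
    | true =>
      rcases ih x with h | h
      · exact .inr (by simp [h])
      · exact .inr (List.mem_cons_of_mem _ h)

/-- A pass can be carried out one page at a time: all that must be remembered from earlier pages is
the last word with property `p`. -/
theorem passOut_page (p : ℕ → Bool) (f : ℕ → ℕ → ℕ → ℕ) (l : List ℕ) (b j : ℕ) :
    passOut p f (j * b) (lastM p 0 (l.take (j * b))) (page b l j) =
      page b (passOut p f 0 0 l) j := by
  refine List.ext_getElem ?_ fun t h1 h2 => ?_
  · simp [passOut, page]
  · simp only [passOut, page, List.length_map, List.length_range, List.length_take,
      List.length_drop] at h1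
    have ht : t < b := by omega
    simp only [passOut, page, List.getElem_map, List.getElem_range, List.getElem_take,
      List.getElem_drop, zero_add, ← lastM_append, List.take_take, min_eq_left ht.le]
    rw [← List.take_add]
    congr 1
    rw [List.getD_eq_getElem _ _ (by simp; omega), List.getD_eq_getElem _ _ (by omega)]
    simp

theorem region_add (d : ℕ → ℕ) (x i j : ℕ) :
    region d x (i + j) = region d x i ++ region d (x + i) j := by
  simp [region, List.range_add, add_assoc, Function.comp_def]

theorem region_congr {d d' : ℕ → ℕ} {x j : ℕ} (h : ∀ i < j, d (x + i) = d' (x + i)) :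
    region d x j = region d' x j :=
  List.map_congr_left fun i hi => h i (List.mem_range.1 hi)

theorem page_region {d : ℕ → ℕ} {x b j np : ℕ} (h : j < np) :
    page b (region d x (np * b)) j = region d (x + j * b) b := by
  have : np * b = j * b + (b + (np - j - 1) * b) := by
    obtain ⟨k, rfl⟩ := Nat.exists_eq_add_of_lt h
    rw [show j + k + 1 - j - 1 = k by omega]; ring
  rw [this, region_add, page, List.drop_left' (by simp), region_add, List.take_left' (by simp)]

theorem mem_region {d : ℕ → ℕ} {x j w : ℕ} : w ∈ region d x j ↔ ∃ i < j, d (x + i) = w := by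
  simp [region]

theorem region_patch_same {d : ℕ → ℕ} {x : ℕ} {l : List ℕ} {j : ℕ} (h : l.length = j) :
    region (patch d x l) x j = l := by
  refine List.ext_getElem (by simp [h]) fun i h1 h2 => ?_
  simp [region, patch, h2]

theorem patch_of_not {d : ℕ → ℕ} {x y : ℕ} {l : List ℕ} (h : ¬ (x ≤ y ∧ y < x + l.length)) :
    patch d x l y = d y := if_neg h

section Primrec

variable {α : Type*} [Primcodable α]

@[fun_prop] theorem primrec_lastM {p : α → ℕ → Bool} {s : α → ℕ} {l : α → List ℕ}
    (hp : Primrec fun v : α × ℕ => p v.1 v.2) (hs : Primrec s) (hl : Primrec l) :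
    Primrec fun a => lastM (p a) (s a) (l a) := by
  have : Primrec fun v : α × ℕ × ℕ => p v.1 v.2.2 :=
    hp.comp (g := fun v : α × ℕ × ℕ => (v.1, v.2.2)) (by fun_prop)
  unfold lastM; fun_prop

@[fun_prop] theorem primrec_passOut {p : α → ℕ → Bool} {f : α → ℕ → ℕ → ℕ → ℕ} {i s : α → ℕ}
    {l : α → List ℕ} (hp : Primrec fun v : α × ℕ => p v.1 v.2)
    (hf : Primrec fun v : α × ℕ × ℕ × ℕ => f v.1 v.2.1 v.2.2.1 v.2.2.2)
    (hi : Primrec i) (hs : Primrec s) (hl : Primrec l) :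
    Primrec fun a => passOut (p a) (f a) (i a) (s a) (l a) := by
  have h1 : Primrec fun v : (α × ℕ) × ℕ => p v.1.1 v.2 :=
    hp.comp (g := fun v : (α × ℕ) × ℕ => (v.1.1, v.2)) (by fun_prop)
  have h2 : Primrec fun v : α × ℕ => lastM (p v.1) (s v.1) ((l v.1).take v.2) := by fun_prop
  have h3 : Primrec fun v : α × ℕ => f v.1 (i v.1 + v.2) (lastM (p v.1) (s v.1) ((l v.1).take v.2))
      ((l v.1).getD v.2 0) :=
    hf.comp (g := fun v : α × ℕ => (v.1, i v.1 + v.2, lastM (p v.1) (s v.1) ((l v.1).take v.2),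
      (l v.1).getD v.2 0)) (Comp.pair' Primrec.fst (Comp.pair' (by fun_prop)
        (Comp.pair' h2 (by fun_prop))))
  exact Comp.map' (by fun_prop) h3

end Primrec

/-- What a pass over an array does; the first argument is the header `[n, m, aux]`. -/
structure PassFn where
  master : List ℕ → ℕ → Bool
  fn : List ℕ → ℕ → ℕ → ℕ → ℕ
  primrec_master : Primrec fun v : List ℕ × ℕ => master v.1 v.2
  primrec_fn : Primrec fun v : List ℕ × ℕ × ℕ × ℕ => fn v.1 v.2.1 v.2.2.1 v.2.2.2

/-- The registers are left as `writeRange` expects them, followed by the page counter and the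
carried word for the next page. -/
def passStep (f : PassFn) (hdr : List ℕ) (b i s : ℕ) (pg : List ℕ) (rest : Regs) (dst : ℕ) : Regs :=
  [dst + i * b] :: sortl (passOut (f.master hdr) (f.fn hdr) (i * b) s pg) ::
    [i + 1, lastM (f.master hdr) s pg] :: rest

@[fun_prop] theorem primrec_passStep {α : Type*} [Primcodable α] (f : PassFn) {hdr : α → List ℕ}
    {b i s dst : α → ℕ} {pg : α → List ℕ} {rest : α → Regs} (h1 : Primrec hdr) (h2 : Primrec b)
    (h3 : Primrec i) (h4 : Primrec s) (h5 : Primrec pg) (h6 : Primrec rest) (h7 : Primrec dst) :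
    Primrec fun a => passStep f (hdr a) (b a) (i a) (s a) (pg a) (rest a) (dst a) := by
  have h8 : Primrec fun v : α × ℕ => f.master (hdr v.1) v.2 :=
    f.primrec_master.comp (g := fun v : α × ℕ => (hdr v.1, v.2)) (by fun_prop)
  have h9 : Primrec fun v : α × ℕ × ℕ × ℕ => f.fn (hdr v.1) v.2.1 v.2.2.1 v.2.2.2 :=
    f.primrec_fn.comp (g := fun v : α × ℕ × ℕ × ℕ => (hdr v.1, v.2.1, v.2.2.1, v.2.2.2))
      (by fun_prop)
  unfold passStep
  have h10 := primrec_passOut (p := fun v => f.master (hdr v)) (f := fun v => f.fn (hdr v)) h8 h9 (Comp.mul' h3 h2) h4 h5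
  have h11 := primrec_lastM (p := fun v => f.master (hdr v)) h8 h4 h5
  exact Comp.cons' (by fun_prop) (Comp.cons' (primrec_sortl h10)
    (Comp.cons' (Comp.cons' (by fun_prop) (Comp.cons' h11 (by fun_prop))) h6))

/-- Applies `f` to array number `src`; the pages of the result are sorted and written to array
number `dst`. -/
def pass (f : PassFn) (src dst : ℕ) : Prog :=
  .seq (cmp (fun _ rs => [0, 0] :: rs) (by fun_prop))
    (.seq (rloop (fun P rs => decide (sc rs 0 0 < numPages P.2.1 (sc rs 1 0) (sc rs 1 1)))
        (by fun_prop)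
        (.seq (cmp (fun P rs => [src * arrLen P.2.1 (sc rs 1 0) (sc rs 1 1) +
              sc rs 0 0 * pageLen P.2.1 (sc rs 1 0) (sc rs 1 1),
              pageLen P.2.1 (sc rs 1 0) (sc rs 1 1)] :: rs) (by fun_prop))
          (.seq readRange
            (.seq (cmp (fun P rs => passStep f (rs.getD 2 []) (pageLen P.2.1 (sc rs 2 0) (sc rs 2 1))
                (sc rs 1 0) (sc rs 1 1) (rs.getD 0 []) (rs.drop 2)
                (dst * arrLen P.2.1 (sc rs 2 0) (sc rs 2 1))) (by fun_prop))
              writeRange))))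
      (cmp (fun _ rs => rs.tail) (by fun_prop)))

/-- What the parameters have to satisfy for the programs to run without overflow. -/
structure Room (μ : Machine) (n m : ℕ) : Prop where
  hB : 1 ≤ μ.B
  cap : μ.B + 2 * pageLen μ.B n m + fanIn μ.M μ.B * (pageLen μ.B n m + 3) + 40 ≤ μ.cap
  addr : 4 * arrLen μ.B n m + 8 ≤ μ.W
  hn : n < μ.W
  hm : m < μ.W

theorem one_le_pageLen (B n m : ℕ) : 1 ≤ pageLen B n m := by unfold pageLen; omega

theorem pageLen_le {B : ℕ} (hB : 1 ≤ B) (n m : ℕ) : pageLen B n m ≤ B := by unfold pageLen; omega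

theorem pageLen_le_arrLen (B n m : ℕ) : pageLen B n m ≤ arrLen B n m :=
  Nat.le_mul_of_pos_left _ (Nat.succ_pos _)

theorem numPages_le_arrLen (B n m : ℕ) : numPages B n m ≤ arrLen B n m :=
  Nat.le_mul_of_pos_right _ (one_le_pageLen B n m)

/-- Each page costs two I/Os for reading and four for writing. Source and target may coincide, since
a page is read before it is overwritten and later pages are still untouched. -/
theorem exec_pass {μ : Machine} {n m aux : ℕ} (hR : Room μ n m) (f : PassFn) {src dst : ℕ}
    (hsrc : src ≤ 3) (hdst : dst ≤ 3) {rest : Regs} {d : ℕ → ℕ} {o : List ℕ} {b np L : ℕ}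
    (hb : pageLen μ.B n m = b) (hnp : numPages μ.B n m = np) (hL : arrLen μ.B n m = L)
    (haux : aux < μ.W) (hd : ∀ y, d y < μ.W)
    (hf : ∀ i s x, s < μ.W → x < μ.W → f.fn [n, m, aux] i s x < μ.W)
    (hg : Good μ.W rest) (hs : size rest ≤ 8) :
    ∃ d' t, Exec μ (pass f src dst) ⟨enc ([n, m, aux] :: rest), d, o⟩ t
        ⟨enc ([n, m, aux] :: rest), d', o⟩ ∧ t ≤ 6 * np ∧ (∀ y, d' y < μ.W) ∧
      (∀ y, ¬ (dst * L ≤ y ∧ y < dst * L + L) → d' y = d y) ∧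
      ∀ j < np, region d' (dst * L + j * b) b = sortl (page b (passOut (f.master [n, m, aux])
        (f.fn [n, m, aux]) 0 0 (region d (src * L) L)) j) := by
  have hLe : L = np * b := by rw [← hL, ← hnp, ← hb]; rfl
  have hB := hR.hB
  have hbB := pageLen_le hB n m
  have hb1 := one_le_pageLen μ.B n m
  have hbL := pageLen_le_arrLen μ.B n m
  have hnL := numPages_le_arrLen μ.B n m
  have hcap := hR.cap
  have haddr := hR.addr
  have hn := hR.hn
  have hm := hR.hm
  rw [hb] at hbB hb1 hcap hbL
  rw [hL] at haddr hbL hnL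
  rw [hnp] at hnL
  have hfb : b + 3 ≤ fanIn μ.M μ.B * (b + 3) := Nat.le_mul_of_pos_left _ (Nat.succ_pos _)
  have hsrcL : src * L ≤ 3 * L := Nat.mul_le_mul_right _ hsrc
  have hdstL : dst * L ≤ 3 * L := Nat.mul_le_mul_right _ hdst
  -- Two arrays are equal or disjoint; in each case the writes made so far have not reached page `i`
  -- of the source.
  have hdisj : dst * L = src * L ∨ src * L + L ≤ dst * L ∨ dst * L + L ≤ src * L := by
    rcases lt_trichotomy src dst with h | h | h
    · exact .inr (.inl (by rw [← Nat.succ_mul]; exact Nat.mul_le_mul_right _ h))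
    · exact .inl (by rw [h])
    · exact .inr (.inr (by rw [← Nat.succ_mul]; exact Nat.mul_le_mul_right _ h))
  set l := region d (src * L) L with hl
  have hlW : ∀ w ∈ l, w < μ.W := by
    intro w hw
    obtain ⟨i, -, rfl⟩ := mem_region.1 hw
    exact hd _
  have hlast : ∀ i, lastM (f.master [n, m, aux]) 0 (l.take i) < μ.W := by
    intro i
    rcases lastM_mem (f.master [n, m, aux]) 0 (l.take i) with h | h
    · omega
    · exact hlW _ (List.mem_of_mem_take h)
  obtain ⟨⟨i, d'⟩, t, hex, ⟨hi, hdW, hout, hreg⟩, hT, ht⟩ := exec_rloop (μ := μ)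
    (T := fun P rs => decide (sc rs 0 0 < numPages P.2.1 (sc rs 1 0) (sc rs 1 1)))
    (hT := by fun_prop)
    (p := .seq (cmp (fun P rs => [src * arrLen P.2.1 (sc rs 1 0) (sc rs 1 1) +
              sc rs 0 0 * pageLen P.2.1 (sc rs 1 0) (sc rs 1 1),
              pageLen P.2.1 (sc rs 1 0) (sc rs 1 1)] :: rs) (by fun_prop))
          (.seq readRange
            (.seq (cmp (fun P rs => passStep f (rs.getD 2 []) (pageLen P.2.1 (sc rs 2 0) (sc rs 2 1))
                (sc rs 1 0) (sc rs 1 1) (rs.getD 0 []) (rs.drop 2)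
                (dst * arrLen P.2.1 (sc rs 2 0) (sc rs 2 1))) (by fun_prop))
              writeRange)))
    (A := ℕ × (ℕ → ℕ))
    (fun a => [a.1, lastM (f.master [n, m, aux]) 0 (l.take (a.1 * b))] :: [n, m, aux] :: rest)
    (fun a => a.2) (fun _ => o)
    (fun a => a.1 ≤ np ∧ (∀ y, a.2 y < μ.W) ∧
      (∀ y, ¬ (dst * L ≤ y ∧ y < dst * L + a.1 * b) → a.2 y = d y) ∧
      ∀ j < a.1, region a.2 (dst * L + j * b) b = sortl (page b (passOut (f.master [n, m, aux])
        (f.fn [n, m, aux]) 0 0 l) j))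
    (fun a => np - a.1) (fun a => 6 * (np - a.1))
    (by
      rintro ⟨i, e⟩ ⟨hi, heW, hout, hreg⟩ hT
      dsimp only at hi heW hout hreg hT ⊢
      have hi' : i < np := by simpa [hnp] using hT
      have hib : i * b + b ≤ L := by
        rw [hLe, ← Nat.succ_mul]; exact Nat.mul_le_mul_right _ hi'
      have hpg : region e (src * L + i * b) b = page b l i := by
        rw [hl, hLe, page_region hi', ← hLe]
        refine region_congr fun t ht => hout _ ?_
        rcases hdisj with h | h | h <;> omega
      have hpgl : (page b l i).length = b := by rw [← hpg]; simp
      have hpo := passOut_page (f.master [n, m, aux]) (f.fn [n, m, aux]) l b i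
      have hlm : lastM (f.master [n, m, aux]) (lastM (f.master [n, m, aux]) 0 (l.take (i * b)))
          (page b l i) = lastM (f.master [n, m, aux]) 0 (l.take ((i + 1) * b)) := by
        rw [← lastM_append, page, ← List.take_add, Nat.succ_mul]
      set sp := sortl (page b (passOut (f.master [n, m, aux]) (f.fn [n, m, aux]) 0 0 l) i) with hsp
      have hspl : sp.length = b := by
        rw [hsp, ← hpo, length_sortl, length_passOut, hpgl]
      have hspW : ∀ w ∈ sp, w < μ.W := by
        intro w hw
        rw [hsp, mem_sortl, ← hpo] at hw
        simp only [passOut, List.mem_map, List.mem_range] at hw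
        obtain ⟨j, hj, rfl⟩ := hw
        refine hf _ _ _ ?_ ?_
        · rw [← lastM_append]
          rcases lastM_mem (f.master [n, m, aux]) 0 (l.take (i * b) ++ (page b l i).take j)
            with h | h
          · omega
          · refine hlW _ ?_
            rcases List.mem_append.1 h with h | h
            · exact List.mem_of_mem_take h
            · exact List.mem_of_mem_drop (List.mem_of_mem_take (List.mem_of_mem_take h))
        · rw [List.getD_eq_getElem _ _ hj]
          exact hlW _ (List.mem_of_mem_drop (List.mem_of_mem_take (List.getElem_mem hj)))
      refine ⟨(i + 1, patch e (dst * L + i * b) sp), 6, ?_, ⟨hi', patch_lt heW hspW, ?_, ?_⟩,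
        by dsimp only; omega, by dsimp only; omega⟩
      · refine Exec.seq_eq (t := 0) (t' := 6) (exec_cmp
          (rs' := [src * L + i * b, b] :: [i, lastM (f.master [n, m, aux]) 0 (l.take (i * b))] ::
            [n, m, aux] :: rest) (by simp [hb, hL]) ?_ ?_)
          (Exec.seq_eq (t := 2) (t' := 4) (exec_readRange hB hbB (by omega) (by omega) heW ?_ ?_)
          (Exec.seq_eq (t := 0) (t' := 4) (exec_cmp
            (rs' := [dst * L + i * b] :: sp :: [i + 1, lastM (f.master [n, m, aux]) 0
              (l.take ((i + 1) * b))] :: [n, m, aux] :: rest) ?_ ?_ ?_)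
            (exec_writeRange hB (by omega) (by omega) (by omega) heW hspW ?_ ?_) rfl) rfl) rfl
        · simp; omega
        · simp only [good_cons, List.length_cons, List.length_nil, List.forall_mem_cons]
          have := hlast (i * b)
          refine ⟨⟨by omega, by omega, by omega, by simp⟩, ⟨by omega, by omega, by omega, by simp⟩,
            ⟨by omega, by omega, by omega, by omega, by simp⟩, hg⟩
        · simp only [good_cons, List.length_cons, List.length_nil, List.forall_mem_cons]
          have := hlast (i * b)
          refine ⟨⟨by omega, by omega, by omega, by simp⟩,
            ⟨by omega, by omega, by omega, by omega, by simp⟩, hg⟩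
        · simp; omega
        · simp [passStep, hb, hL, hpg, hpo, hlm, hsp]
        · simp [hspl]; omega
        · simp only [good_cons, List.length_cons, List.length_nil, List.forall_mem_cons]
          have := hlast ((i + 1) * b)
          refine ⟨⟨by omega, by omega, by simp⟩, ⟨by omega, hspW⟩,
            ⟨by omega, by omega, by omega, by simp⟩,
            ⟨by omega, by omega, by omega, by omega, by simp⟩, hg⟩
        · simp only [good_cons, List.length_cons, List.length_nil, List.forall_mem_cons]
          have := hlast ((i + 1) * b)
          refine ⟨⟨by omega, by omega, by omega, by simp⟩,
            ⟨by omega, by omega, by omega, by omega, by simp⟩, hg⟩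
        · simp [hspl]; omega
      · intro y hy
        dsimp only at hy ⊢
        rw [Nat.succ_mul] at hy
        rw [patch_of_not (by omega)]
        exact hout y (by omega)
      · intro j hj
        dsimp only at hj ⊢
        rcases Nat.lt_succ_iff_lt_or_eq.1 hj with hj | rfl
        · have : j * b + b ≤ i * b := by
            rw [← Nat.succ_mul]; exact Nat.mul_le_mul_right _ hj
          rw [← hreg j hj]
          exact region_congr fun t ht => patch_of_not (by omega)
        · exact region_patch_same hspl)
    (0, d) ⟨by simp, hd, by simp, by simp⟩
  dsimp only at hi hdW hout hreg hT ht hex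
  have hi' : i = np := by
    have : np ≤ i := by simpa [hnp] using hT
    omega
  subst hi'
  refine ⟨d', t, Exec.seq_eq (t := 0) (t' := t) (exec_cmp
    (rs' := [0, lastM (f.master [n, m, aux]) 0 (l.take (0 * b))] :: [n, m, aux] :: rest)
    (by simp [lastM]) ?_ ?_) (Exec.seq_eq (t := t) (t' := 0) hex (exec_cmp (by simp) ?_ ?_) rfl)
    (by omega), by omega, hdW, fun y hy => hout y (by omega), hreg⟩
  · simp; omega
  · have := hlast (0 * b)
    simp only [good_cons, List.length_cons, List.length_nil, List.forall_mem_cons]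
    exact ⟨⟨by omega, by omega, by omega, by simp⟩,
      ⟨by omega, by omega, by omega, by omega, by simp⟩, hg⟩
  · simp; omega
  · simp only [good_cons, List.length_cons, List.length_nil, List.forall_mem_cons]
    exact ⟨⟨by omega, by omega, by omega, by omega, by simp⟩, hg⟩

end ExtMem

namespace ExtMem

/-! ### Merging, on lists -/

/-- `acc` is the sorted output so far, and `rems` are the remainders of the runs in a merge of `G`. -/
structure MergeInv (acc : List ℕ) (rems : List (List ℕ)) (G : List ℕ) : Prop where
  sorted : acc.Pairwise (· ≤ ·)
  le : ∀ a ∈ acc, ∀ l ∈ rems, ∀ x ∈ l, a ≤ x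
  runs : ∀ l ∈ rems, l.Pairwise (· ≤ ·)
  perm : (acc ++ rems.flatten).Perm G

/-- A word that is minimal among all remaining ones can be moved to the output: it dominates the
output by `le`, and stays below whatever remains by `hmin`. -/
theorem MergeInv.pop {acc : List ℕ} {rems : List (List ℕ)} {G : List ℕ} (h : MergeInv acc rems G)
    {i x : ℕ} {t : List ℕ} (hi : i < rems.length) (hx : rems[i] = x :: t)
    (hmin : ∀ l ∈ rems, ∀ y ∈ l, x ≤ y) : MergeInv (acc ++ [x]) (rems.set i t) G := by
  have hmem : x :: t ∈ rems := hx ▸ List.getElem_mem hi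
  have hsub : ∀ l ∈ rems.set i t, ∃ l' ∈ rems, (∀ y ∈ l, y ∈ l') ∧ l.Pairwise (· ≤ ·) := by
    intro l hl
    rcases List.mem_or_eq_of_mem_set hl with hl | rfl
    · exact ⟨l, hl, fun _ h => h, h.runs l hl⟩
    · exact ⟨_, hmem, fun y hy => List.mem_cons_of_mem _ hy,
        (List.pairwise_cons.1 (h.runs _ hmem)).2⟩
  refine ⟨?_, ?_, ?_, ?_⟩
  · refine List.pairwise_append.2 ⟨h.sorted, List.pairwise_singleton _ _, ?_⟩
    intro a ha b hb
    rw [List.mem_singleton.1 hb]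
    exact h.le a ha _ hmem x (List.mem_cons_self)
  · intro a ha l hl y hy
    obtain ⟨l', hl', hsub', -⟩ := hsub l hl
    rcases List.mem_append.1 ha with ha | ha
    · exact h.le a ha l' hl' y (hsub' y hy)
    · rw [List.mem_singleton.1 ha]
      exact hmin l' hl' y (hsub' y hy)
  · intro l hl
    exact (hsub l hl).choose_spec.2.2
  · refine List.Perm.trans ?_ h.perm
    have h1 : rems = rems.take i ++ (x :: t) :: rems.drop (i + 1) := by
      rw [← hx, List.cons_getElem_drop_succ, List.take_append_drop]
    have h2 : rems.set i t = rems.take i ++ t :: rems.drop (i + 1) :=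
      List.set_eq_take_append_cons_drop.trans (if_pos hi)
    rw [h2]
    conv_rhs => rw [h1]
    simp only [List.flatten_append, List.flatten_cons, List.append_assoc, List.singleton_append]
    refine List.Perm.append_left _ ?_
    simpa using (List.perm_middle (a := x) (l₁ := (rems.take i).flatten)
      (l₂ := t ++ (rems.drop (i + 1)).flatten)).symm

theorem sum_map_set {α : Type*} (f : α → ℕ) (l : List α) (i : ℕ) (a : α) (hi : i < l.length) :
    ((l.set i a).map f).sum + f l[i] = (l.map f).sum + f a := by
  induction l generalizing i with
  | nil => simp at hi
  | cons b l ih =>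
    cases i with
    | zero => simp; omega
    | succ i =>
      have := ih i (by simpa using hi)
      simp only [List.set_cons_succ, List.map_cons, List.sum_cons, List.getElem_cons_succ]
      omega

theorem pairwise_region {d : ℕ → ℕ} {x j : ℕ} :
    (region d x j).Pairwise (· ≤ ·) ↔ ∀ i k, i < k → k < j → d (x + i) ≤ d (x + k) := by
  rw [List.pairwise_iff_getElem]
  constructor
  · intro h i k hik hk
    simpa [region] using h i k (by simp; omega) (by simpa using hk) hik
  · intro h i k hi hk hik
    simpa [region] using h i k hik (by simpa using hk)

/-! ### One merge: registers `[q] :: out :: hdr :: [r] :: runs`, a run is `ptr :: end :: buffer` -/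

/-- The two leading words of a run are page numbers, so length at most 2 means an empty buffer; such
a run needs a load if pages are left. -/
def needs (r : List ℕ) : Bool := decide (r.getD 0 0 < r.getD 1 0) && decide (r.length ≤ 2)

def live (r : List ℕ) : Bool := decide (2 < r.length)

def active (r : List ℕ) : Bool := decide (2 < r.length) || decide (r.getD 0 0 < r.getD 1 0)

def minHead (runs : Regs) : ℕ :=
  (sortl ((runs.filter fun r => live r).map fun r => r.getD 2 0)).getD 0 0

def isMin (x : ℕ) (r : List ℕ) : Bool := live r && decide (r.getD 2 0 = x)

def loadRun (pg r : List ℕ) : List ℕ := (r.getD 0 0 + 1) :: r.getD 1 0 :: pg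

def popRun (r : List ℕ) : List ℕ := r.getD 0 0 :: r.getD 1 0 :: r.drop 3

def needsIdx (runs : Regs) : ℕ := runs.findIdx fun r => needs r

def minIdx (runs : Regs) : ℕ := runs.findIdx fun r => isMin (minHead runs) r

section Primrec

variable {α : Type*} [Primcodable α]

@[fun_prop] theorem primrec_needs {f : α → List ℕ} (hf : Primrec f) :
    Primrec fun a => needs (f a) := by unfold needs; fun_prop

@[fun_prop] theorem primrec_live {f : α → List ℕ} (hf : Primrec f) :
    Primrec fun a => live (f a) := by unfold live; fun_prop

@[fun_prop] theorem primrec_active {f : α → List ℕ} (hf : Primrec f) :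
    Primrec fun a => active (f a) := by unfold active; fun_prop

@[fun_prop] theorem primrec_minHead {f : α → Regs} (hf : Primrec f) :
    Primrec fun a => minHead (f a) := by unfold minHead; fun_prop

@[fun_prop] theorem primrec_isMin {g : α → ℕ} {f : α → List ℕ} (hg : Primrec g) (hf : Primrec f) :
    Primrec fun a => isMin (g a) (f a) := by unfold isMin; fun_prop

@[fun_prop] theorem primrec_loadRun {g f : α → List ℕ} (hg : Primrec g) (hf : Primrec f) :
    Primrec fun a => loadRun (g a) (f a) := by unfold loadRun; fun_prop

@[fun_prop] theorem primrec_popRun {f : α → List ℕ} (hf : Primrec f) :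
    Primrec fun a => popRun (f a) := by unfold popRun; fun_prop

@[fun_prop] theorem primrec_needsIdx {f : α → Regs} (hf : Primrec f) :
    Primrec fun a => needsIdx (f a) := by unfold needsIdx; fun_prop

@[fun_prop] theorem primrec_minIdx {f : α → Regs} (hf : Primrec f) :
    Primrec fun a => minIdx (f a) := by unfold minIdx; fun_prop

end Primrec

def mergeLoad (src : ℕ) : Prog :=
  .seq (cmp (fun P rs => [src * arrLen P.2.1 (sc rs 2 0) (sc rs 2 1) +
        sc (rs.drop 4) (needsIdx (rs.drop 4)) 0 * pageLen P.2.1 (sc rs 2 0) (sc rs 2 1),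
        pageLen P.2.1 (sc rs 2 0) (sc rs 2 1)] :: rs) (by fun_prop))
    (.seq readRange
      (cmp (fun _ rs => rs.getD 1 [] :: rs.getD 2 [] :: rs.getD 3 [] :: rs.getD 4 [] ::
        (rs.drop 5).set (needsIdx (rs.drop 5))
          (loadRun (rs.getD 0 []) ((rs.drop 5).getD (needsIdx (rs.drop 5)) []))) (by fun_prop)))

def mergeFlush (dst : ℕ) : Prog :=
  .seq (cmp (fun P rs => [dst * arrLen P.2.1 (sc rs 2 0) (sc rs 2 1) +
        sc rs 0 0 * pageLen P.2.1 (sc rs 2 0) (sc rs 2 1)] :: rs.getD 1 [] :: [sc rs 0 0 + 1] ::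
        [] :: rs.drop 2) (by fun_prop))
    writeRange

def mergePop : Prog :=
  cmp (fun _ rs => rs.getD 0 [] :: (rs.getD 1 [] ++ [minHead (rs.drop 4)]) :: rs.getD 2 [] ::
    rs.getD 3 [] :: (rs.drop 4).set (minIdx (rs.drop 4))
      (popRun ((rs.drop 4).getD (minIdx (rs.drop 4)) []))) (by fun_prop)

/-- Loading has priority. Hence, when a word is popped, every run with an empty buffer is exhausted,
and the least buffered head is the least remaining word. -/
def mergeBody (src dst : ℕ) : Prog :=
  rite (fun _ rs => (rs.drop 4).any fun r => needs r) (by fun_prop) (mergeLoad src)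
    (rite (fun P rs => decide ((rs.getD 1 []).length = pageLen P.2.1 (sc rs 2 0) (sc rs 2 1)))
      (by fun_prop) (mergeFlush dst) mergePop)

/-- A full output buffer keeps the loop alive, so the last page is flushed as well. The merged
length is a multiple of the page length, so nothing is left in the buffer at the end. -/
def mergeTest (P : Params) (rs : Regs) : Bool :=
  decide ((rs.getD 1 []).length = pageLen P.2.1 (sc rs 2 0) (sc rs 2 1)) ||
    (rs.drop 4).any fun r => active r

theorem primrec_mergeTest : Primrec fun v : Params × Regs => mergeTest v.1 v.2 := by
  unfold mergeTest; fun_prop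

def mergeRuns (src dst : ℕ) : Prog := rloop mergeTest primrec_mergeTest (mergeBody src dst)

/-- The words of a run that have not been output yet. -/
def rem (d : ℕ → ℕ) (S b : ℕ) (r : List ℕ) : List ℕ :=
  r.drop 2 ++ region d (S + r.getD 0 0 * b) ((r.getD 1 0 - r.getD 0 0) * b)

theorem size_le (rs : Regs) (k : ℕ) (h : ∀ r ∈ rs, r.length ≤ k) : size rs ≤ rs.length * (k + 1) := by
  induction rs with
  | nil => simp
  | cons r rs ih =>
    have h1 := h r List.mem_cons_self
    have h2 := ih fun r hr => h r (List.mem_cons_of_mem _ hr)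
    simp only [size_cons, List.length_cons, Nat.succ_mul]
    omega

/-! ### State and invariant of one merge. -/

structure MState where
  runs : Regs
  out : List ℕ
  q : ℕ
  disk : ℕ → ℕ

def MState.acc (a : MState) (D q0 b : ℕ) : List ℕ :=
  region a.disk (D + q0 * b) ((a.q - q0) * b) ++ a.out

/-- The unread parts of the runs refer to the initial memory `d`, although reads are made from
`a.disk`: by `disk_eq` the two differ only in the output written so far. -/
structure MState.Inv (a : MState) (W F b np S D q0 qe : ℕ) (d : ℕ → ℕ) (G : List ℕ) : Prop where
  len : a.runs.length = F
  run : ∀ r ∈ a.runs, 2 ≤ r.length ∧ r.length ≤ b + 2 ∧ r.getD 0 0 ≤ r.getD 1 0 ∧ r.getD 1 0 ≤ np ∧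
    ∀ w ∈ r, w < W
  outLen : a.out.length ≤ b
  outLt : ∀ w ∈ a.out, w < W
  q0_le : q0 ≤ a.q
  diskLt : ∀ y, a.disk y < W
  disk_eq : ∀ y, ¬ (D + q0 * b ≤ y ∧ y < D + a.q * b) → a.disk y = d y
  inv : MergeInv (a.acc D q0 b) (a.runs.map (rem d S b)) G

/-- Loading moves the first unread page into the buffer, so the remainder `rem` of the run is
unchanged as a list. -/
theorem MState.Inv.load {a : MState} {W F b np S D q0 qe : ℕ} {d : ℕ → ℕ} {G : List ℕ}
    (h : a.Inv W F b np S D q0 qe d G) {i : ℕ} {r : List ℕ} (hi : i < a.runs.length)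
    (hr : a.runs[i] = r) (hn : needs r = true) (hd : ∀ y, d y < W) (hnp : np < W) :
    MState.Inv ⟨a.runs.set i (loadRun (region d (S + r.getD 0 0 * b) b) r), a.out, a.q, a.disk⟩
      W F b np S D q0 qe d G := by
  have hmem : r ∈ a.runs := hr ▸ List.getElem_mem hi
  obtain ⟨h1, h2, h3, h4, h5⟩ := h.run r hmem
  simp only [needs, Bool.and_eq_true, decide_eq_true_eq] at hn
  refine ⟨by simpa using h.len, ?_, h.outLen, h.outLt, h.q0_le, h.diskLt, h.disk_eq, ?_⟩
  · intro r' hr'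
    rcases List.mem_or_eq_of_mem_set hr' with hr' | rfl
    · exact h.run r' hr'
    · refine ⟨by simp [loadRun], by simp [loadRun], by simp [loadRun] at *; omega,
        by simpa [loadRun] using h4, ?_⟩
      intro w hw
      simp only [loadRun, List.mem_cons, mem_region] at hw
      rcases hw with rfl | rfl | ⟨t, -, rfl⟩
      · omega
      · omega
      · exact hd _
  · have hrem : rem d S b (loadRun (region d (S + r.getD 0 0 * b) b) r) = rem d S b r := by
      have h6 : r.drop 2 = [] := List.drop_eq_nil_of_le hn.2
      have h7 : (r.getD 1 0 - r.getD 0 0) * b = b + (r.getD 1 0 - (r.getD 0 0 + 1)) * b := by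
        obtain ⟨k, hk⟩ := Nat.exists_eq_add_of_lt hn.1
        rw [hk, show r.getD 0 0 + k + 1 - r.getD 0 0 = k + 1 by omega,
          show r.getD 0 0 + k + 1 - (r.getD 0 0 + 1) = k by omega]
        ring
      rw [rem, rem, h6, h7, region_add]
      simp only [loadRun, List.drop_succ_cons, List.drop_zero, List.getD_cons_zero,
        List.getD_cons_succ, List.nil_append]
      congr 2
      ring
    have : (a.runs.set i (loadRun (region d (S + r.getD 0 0 * b) b) r)).map (rem d S b) =
        a.runs.map (rem d S b) := by
      rw [List.map_set, hrem, ← hr]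
      refine List.ext_getElem (by simp) fun k hk hk' => ?_
      rw [List.getElem_set]
      split_ifs with h
      · subst h; simp
      · rfl
    exact this ▸ h.inv

theorem MState.acc_patch {a : MState} {D q0 b : ℕ} (hq : q0 ≤ a.q) (ho : a.out.length = b)
    (runs : Regs) :
    MState.acc ⟨runs, [], a.q + 1, patch a.disk (D + a.q * b) a.out⟩ D q0 b = a.acc D q0 b := by
  simp only [MState.acc, List.append_nil]
  have h1 : (a.q + 1 - q0) * b = (a.q - q0) * b + b := by
    rw [Nat.succ_sub hq, Nat.succ_mul]
  have h2 : q0 * b + (a.q - q0) * b = a.q * b := by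
    rw [← add_mul, Nat.add_sub_cancel' hq]
  rw [h1, region_add, show D + q0 * b + (a.q - q0) * b = D + a.q * b by omega]
  congr 1
  · exact region_congr fun i hi => patch_of_not (by omega)
  · exact region_patch_same ho

/-- Flushing moves the buffered words to the next output page, so the accumulated output is the same
list. -/
theorem MState.Inv.flush {a : MState} {W F b np S D q0 qe : ℕ} {d : ℕ → ℕ} {G : List ℕ}
    (h : a.Inv W F b np S D q0 qe d G) (ho : a.out.length = b) :
    MState.Inv ⟨a.runs, [], a.q + 1, patch a.disk (D + a.q * b) a.out⟩
      W F b np S D q0 qe d G := by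
  have hq : q0 * b ≤ a.q * b := Nat.mul_le_mul_right _ h.q0_le
  refine ⟨h.len, h.run, Nat.zero_le _, by simp, h.q0_le.trans (Nat.le_succ _),
    patch_lt h.diskLt h.outLt, ?_, ?_⟩
  · intro y hy
    dsimp only at hy ⊢
    rw [Nat.succ_mul] at hy
    rw [patch_of_not (by omega)]
    exact h.disk_eq y (by omega)
  · rw [MState.acc_patch h.q0_le ho]
    exact h.inv

theorem minHead_spec {runs : Regs} (h : ∃ r ∈ runs, live r = true) :
    (∃ r ∈ runs, isMin (minHead runs) r = true) ∧
      ∀ r ∈ runs, live r = true → minHead runs ≤ r.getD 2 0 := by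
  set l := (runs.filter fun r => live r).map fun r => r.getD 2 0 with hl
  have hmem : ∀ x, x ∈ sortl l ↔ ∃ r ∈ runs, live r = true ∧ r.getD 2 0 = x := by
    intro x; simp only [mem_sortl, hl, List.mem_map, List.mem_filter, and_assoc]
  have hs := sortl_sorted l
  have hne : sortl l ≠ [] := by
    obtain ⟨r, hr, hv⟩ := h
    exact List.ne_nil_of_mem ((hmem _).2 ⟨r, hr, hv, rfl⟩)
  have hm : minHead runs = (sortl l).getD 0 0 := rfl
  rcases hsl : sortl l with _ | ⟨x, t⟩
  · exact absurd hsl hne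
  · rw [hsl] at hm hs hmem
    have hm' : minHead runs = x := hm
    rw [hm']
    constructor
    · obtain ⟨r, hr, hv, hx⟩ := (hmem x).1 List.mem_cons_self
      exact ⟨r, hr, by simp only [isMin, hv, hx, decide_true, Bool.and_self]⟩
    · intro r hr hv
      rcases List.mem_cons.1 ((hmem _).2 ⟨r, hr, hv, rfl⟩) with h | h
      · exact h.ge
      · exact (List.pairwise_cons.1 hs).1 _ h

/-- The second conclusion bounds the output before the pop strictly by the total length; it makes
truncated subtraction in the termination measure decrease. -/
theorem MState.Inv.pop {a : MState} {W F b np S D q0 qe : ℕ} {d : ℕ → ℕ} {G : List ℕ}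
    (h : a.Inv W F b np S D q0 qe d G) (hnn : ∀ r ∈ a.runs, needs r = false)
    (ho : a.out.length ≠ b) (hlive : ∃ r ∈ a.runs, live r = true) :
    MState.Inv ⟨a.runs.set (minIdx a.runs) (popRun (a.runs.getD (minIdx a.runs) [])),
      a.out ++ [minHead a.runs], a.q, a.disk⟩ W F b np S D q0 qe d G ∧
      (a.acc D q0 b).length < G.length := by
  obtain ⟨hex, hle⟩ := minHead_spec hlive
  have hi : minIdx a.runs < a.runs.length := List.findIdx_lt_length.2 hex
  have hmin : isMin (minHead a.runs) a.runs[minIdx a.runs] = true :=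
    List.findIdx_getElem (w := hi)
  have hget : a.runs.getD (minIdx a.runs) [] = a.runs[minIdx a.runs] :=
    List.getD_eq_getElem _ _ hi
  rw [hget]
  set i := minIdx a.runs with hidef
  set x := minHead a.runs with hx
  have hmem : a.runs[i] ∈ a.runs := List.getElem_mem hi
  set r := a.runs[i] with hr
  obtain ⟨h1, h2, h3, h4, h5⟩ := h.run r hmem
  simp only [isMin, live, Bool.and_eq_true, decide_eq_true_eq] at hmin
  obtain ⟨hlen, hhead⟩ := hmin
  have hdrop : r.drop 2 = x :: r.drop 3 := by
    rw [List.drop_eq_getElem_cons hlen, ← hhead, List.getD_eq_getElem _ _ hlen]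
  have hrem : rem d S b r = x :: rem d S b (popRun r) := by
    simp only [rem, hdrop, popRun, List.cons_append, List.drop_succ_cons, List.drop_zero,
      List.getD_cons_zero, List.getD_cons_succ]
  have hxr : x ∈ r := List.mem_of_mem_drop (hdrop ▸ List.mem_cons_self : x ∈ r.drop 2)
  -- A live run is sorted, so its head bounds all of it from below; a run that is not live has no
  -- unread pages either and is empty.
  have hmi : ∀ l ∈ a.runs.map (rem d S b), ∀ y ∈ l, x ≤ y := by
    intro l hl y hy
    obtain ⟨r', hr', rfl⟩ := List.mem_map.1 hl
    by_cases hlv : live r' = true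
    · have hle' := hle r' hr' hlv
      have hs := h.inv.runs _ hl
      simp only [live, decide_eq_true_eq] at hlv
      rw [rem, List.drop_eq_getElem_cons hlv, List.cons_append, ← List.getD_eq_getElem _ 0 hlv]
        at hs hy
      rcases List.mem_cons.1 hy with rfl | hy
      · exact hle'
      · exact hle'.trans ((List.pairwise_cons.1 hs).1 y hy)
    · have hn := hnn r' hr'
      simp only [live, decide_eq_true_eq, not_lt] at hlv
      simp only [needs, hlv, decide_true, Bool.and_true, decide_eq_false_iff_not, not_lt] at hn
      rw [rem, List.drop_eq_nil_of_le hlv, Nat.sub_eq_zero_of_le hn, zero_mul] at hy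
      simp [region] at hy
  have hinv := h.inv.pop (i := i) (x := x) (t := rem d S b (popRun r)) (by simpa using hi)
    (by rw [List.getElem_map, ← hrem]) hmi
  refine ⟨⟨by simpa using h.len, ?_, ?_, ?_, h.q0_le, h.diskLt, h.disk_eq, ?_⟩, ?_⟩
  · intro r' hr'
    rcases List.mem_or_eq_of_mem_set hr' with hr' | rfl
    · exact h.run r' hr'
    · refine ⟨by simp [popRun], by simp [popRun]; omega, by simpa [popRun] using h3,
        by simpa [popRun] using h4, ?_⟩
      intro w hw
      simp only [popRun, List.mem_cons] at hw
      rcases hw with rfl | rfl | hw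
      · rw [List.getD_eq_getElem _ _ (by omega)]; exact h5 _ (List.getElem_mem _)
      · rw [List.getD_eq_getElem _ _ (by omega)]; exact h5 _ (List.getElem_mem _)
      · exact h5 _ (List.mem_of_mem_drop hw)
  · have := h.outLen
    simp only [List.length_append, List.length_singleton]
    omega
  · intro w hw
    rcases List.mem_append.1 hw with hw | hw
    · exact h.outLt w hw
    · rw [List.mem_singleton.1 hw]; exact h5 x hxr
  · rw [List.map_set]
    simpa [MState.acc] using hinv
  · have := hinv.perm.length_eq
    simp only [List.length_append, List.length_singleton] at this
    omega

def MState.regs (a : MState) (hdr : List ℕ) (r : ℕ) : Regs := [a.q] :: a.out :: hdr :: [r] :: a.runs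

/-- Number of pages that have not been loaded yet. -/
def toLoad (runs : Regs) : ℕ := (runs.map fun r => r.getD 1 0 - r.getD 0 0).sum

/-- The I/O potential charges two I/Os for each page still to be loaded and four for each output
page still to be written; pops are free. -/
theorem exec_mergeRuns {μ : Machine} {n m aux r : ℕ} (hR : Room μ n m) {src : ℕ} (hsrc : src ≤ 2)
    {d : ℕ → ℕ} {o : List ℕ} {b np L q0 qe F : ℕ} {G : List ℕ} (hF : fanIn μ.M μ.B = F)
    (hb : pageLen μ.B n m = b) (hnp : numPages μ.B n m = np) (hL : arrLen μ.B n m = L)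
    (haux : aux < μ.W) (hr : r < μ.W) (hd : ∀ y, d y < μ.W) (hqe : qe ≤ np)
    (hG : G.length = (qe - q0) * b) (a : MState)
    (ha : a.Inv μ.W F b np (src * L) (3 * L) q0 qe d G) (hq : a.q ≤ qe) :
    ∃ (a' : MState) (t : ℕ), Exec μ (mergeRuns src 3) ⟨enc (a.regs [n, m, aux] r), a.disk, o⟩ t
        ⟨enc (a'.regs [n, m, aux] r), a'.disk, o⟩ ∧ a'.Inv μ.W F b np (src * L) (3 * L) q0 qe d G ∧
      a'.q = qe ∧ a'.out = [] ∧ (∀ r ∈ a'.runs, rem d (src * L) b r = []) ∧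
      t ≤ 2 * toLoad a.runs + 4 * (qe - a.q) := by
  have hLe : L = np * b := by rw [← hL, ← hnp, ← hb]; rfl
  have hB := hR.hB
  have hbB := pageLen_le hB n m
  have hb1 := one_le_pageLen μ.B n m
  have hbL := pageLen_le_arrLen μ.B n m
  have hnL := numPages_le_arrLen μ.B n m
  have hcap := hR.cap
  have haddr := hR.addr
  have hn := hR.hn
  have hm := hR.hm
  rw [hb] at hbB hb1 hcap hbL
  rw [hF] at hcap
  rw [hL] at haddr hbL hnL
  rw [hnp] at hnL
  have hsrcL : src * L ≤ 2 * L := Nat.mul_le_mul_right _ hsrc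
  have hsize : ∀ a : MState, a.Inv μ.W F b np (src * L) (3 * L) q0 qe d G →
      size a.runs ≤ F * (b + 3) := by
    intro a ha
    have := size_le a.runs (b + 2) fun r hr => (ha.run r hr).2.1
    rwa [ha.len] at this
  have hgood : ∀ a : MState, a.Inv μ.W F b np (src * L) (3 * L) q0 qe d G →
      Good μ.W a.runs := fun a ha r hr =>
    ⟨by have := (ha.run r hr).2.1; omega, (ha.run r hr).2.2.2.2⟩
  have hgh : ∀ rs : Regs, Good μ.W rs → Good μ.W ([n, m, aux] :: [r] :: rs) := by
    intro rs h
    simp only [good_cons, List.length_cons, List.length_nil, List.forall_mem_cons]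
    exact ⟨⟨by omega, by omega, by omega, by omega, by simp⟩, ⟨by omega, by omega, by simp⟩, h⟩
  have hqb : ∀ q, q ≤ np → q * b ≤ L := fun q hq => hLe ▸ Nat.mul_le_mul_right _ hq
  have hqb' : ∀ q, q < np → q * b + b ≤ L := fun q hq => by
    rw [← Nat.succ_mul]; exact hqb _ hq
  have hqq : ∀ q, q ≤ q * b := fun q => Nat.le_mul_of_pos_right _ hb1
  have haccl : ∀ a : MState, a.Inv μ.W F b np (src * L) (3 * L) q0 qe d G →
      (a.q - q0) * b + a.out.length ≤ (qe - q0) * b := by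
    intro a ha
    have := ha.inv.perm.length_eq
    simp only [List.length_append, MState.acc, length_region] at this
    omega
  obtain ⟨a', t, hex, ⟨ha', hq'⟩, hT, ht⟩ := exec_rloop (μ := μ) (T := mergeTest)
    (hT := primrec_mergeTest) (p := mergeBody src 3) (A := MState)
    (fun a => a.regs [n, m, aux] r) (fun a => a.disk) (fun _ => o)
    (fun a => a.Inv μ.W F b np (src * L) (3 * L) q0 qe d G ∧ a.q ≤ qe)
    -- A load lowers the first term. A flush empties the buffer of `b ≥ 1` words and keeps `acc`. A
    -- pop lengthens `acc` and the buffer by one each, and the factor 2 outweighs the latter.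
    (fun a => toLoad a.runs + 2 * (G.length - (a.acc (3 * L) q0 b).length) + a.out.length)
    (fun a => 2 * toLoad a.runs + 4 * (qe - a.q))
    (by
      rintro a ⟨ha, hq⟩ hT
      have hsz := hsize a ha
      have hgd := hgood a ha
      have hol := ha.outLen
      have hqe' := hqb' a.q
      have hqqa := hqq a.q
      have hqbe := hqb a.q (hq.trans hqe)
      cases hld : (a.runs.any fun r => needs r) with
      | true =>
        have hex : ∃ r ∈ a.runs, needs r = true := List.any_eq_true.1 hld
        have hi : needsIdx a.runs < a.runs.length := List.findIdx_lt_length.2 hex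
        have hnd : needs a.runs[needsIdx a.runs] = true := List.findIdx_getElem (w := hi)
        have hget : a.runs.getD (needsIdx a.runs) [] = a.runs[needsIdx a.runs] :=
          List.getD_eq_getElem _ _ hi
        have hmem : a.runs[needsIdx a.runs] ∈ a.runs := List.getElem_mem hi
        set i := needsIdx a.runs with hidef
        set rr := a.runs[i] with hrr
        rw [← hidef] at hget
        obtain ⟨h1, h2, h3, h4, h5⟩ := ha.run rr hmem
        have hlt : rr.getD 0 0 < rr.getD 1 0 := by
          simp only [needs, Bool.and_eq_true, decide_eq_true_eq] at hnd; exact hnd.1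
        have hpb := hqb' (rr.getD 0 0) (by omega)
        have hload := ha.load hi hrr.symm hnd hd (by omega)
        have hpg : region a.disk (src * L + rr.getD 0 0 * b) b =
            region d (src * L + rr.getD 0 0 * b) b :=
          region_congr fun t ht => ha.disk_eq _ (by omega)
        have hsz' := hsize _ hload
        have hgd' := hgood _ hload
        dsimp only at hsz' hgd'
        have hsum := sum_map_set (fun r : List ℕ => r.getD 1 0 - r.getD 0 0) a.runs i
          (loadRun (region d (src * L + rr.getD 0 0 * b) b) rr) hi
        have hsum' : toLoad (a.runs.set i (loadRun (region d (src * L + rr.getD 0 0 * b) b) rr)) + 1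
            = toLoad a.runs := by
          simp only [loadRun, List.getD_cons_zero, List.getD_cons_succ, ← hrr] at hsum
          unfold toLoad loadRun
          omega
        refine ⟨_, 2, ?_, ⟨hload, hq⟩, ?_, ?_⟩
        · refine exec_rite_true (by simpa [MState.regs] using hld) ?_
          refine Exec.seq_eq (t := 0) (t' := 2) (exec_cmp (rs' := [src * L + rr.getD 0 0 * b, b] ::
              a.regs [n, m, aux] r) ?_ ?_ ?_)
            (Exec.seq_eq (t := 2) (t' := 0) (exec_readRange hB hbB ?_ ?_ ha.diskLt ?_ ?_)
              (exec_cmp ?_ ?_ ?_) rfl) rfl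
          · simp only [MState.regs, sc_succ, sc_zero, List.getD_cons_zero, List.getD_cons_succ,
              List.drop_succ_cons, List.drop_zero, hb, hL]
            rw [sc, ← hidef, hget]
          · simp only [MState.regs, size_cons, List.length_cons, List.length_nil]; omega
          · simp only [MState.regs, good_cons, List.length_cons, List.length_nil,
              List.forall_mem_cons]
            exact ⟨⟨by omega, by omega, by omega, by simp⟩, ⟨by omega, by omega, by simp⟩,
              ⟨by omega, ha.outLt⟩, by simpa using hgh _ hgd⟩
          · omega
          · omega
          · simp only [MState.regs, good_cons, List.length_cons, List.length_nil,
              List.forall_mem_cons]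
            exact ⟨⟨by omega, by omega, by simp⟩,
              ⟨by omega, ha.outLt⟩, by simpa using hgh _ hgd⟩
          · simp only [MState.regs, size_cons, List.length_cons, List.length_nil]; omega
          · simp only [MState.regs, List.getD_cons_zero, List.getD_cons_succ,
              List.drop_succ_cons, List.drop_zero, ← hidef, hget, hpg]
          · simp only [MState.regs, size_cons, List.length_cons, List.length_nil]; omega
          · simp only [MState.regs, good_cons, List.length_cons, List.length_nil,
              List.forall_mem_cons]
            exact ⟨⟨by omega, by omega, by simp⟩,
              ⟨by omega, ha.outLt⟩, by simpa using hgh _ hgd'⟩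
        · dsimp only [MState.acc]; omega
        · dsimp only; omega
      | false =>
        have hnn : ∀ r ∈ a.runs, needs r = false := by
          simpa using hld
        by_cases ho : a.out.length = b
        · have hfl := ha.flush ho
          have hacc := MState.acc_patch (a := a) (D := 3 * L) ha.q0_le ho a.runs
          -- The output cannot be longer than the input, so a full buffer still has a target page.
          have hlt : a.q < qe := by
            have := haccl a ha
            rw [ho, ← Nat.succ_mul] at this
            have := Nat.le_of_mul_le_mul_right this hb1
            have := ha.q0_le
            omega
          refine ⟨_, 4, ?_, ⟨hfl, hlt⟩, ?_, ?_⟩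
          · refine exec_rite_false (by simpa [MState.regs] using hld)
              (exec_rite_true (by simp [MState.regs, hb, ho]) ?_)
            refine Exec.seq_eq (t := 0) (t' := 4) (exec_cmp (rs' := [3 * L + a.q * b] :: a.out ::
              [a.q + 1] :: [] :: [n, m, aux] :: [r] :: a.runs) ?_ ?_ ?_)
              (exec_writeRange hB (by omega) ?_ ?_ ha.diskLt ha.outLt ?_ ?_) rfl
            · simp [MState.regs, hb, hL]
            · simp only [size_cons, List.length_cons, List.length_nil]; omega
            · have := hgh _ hgd
              simp only [good_cons, List.length_cons, List.length_nil,
                List.forall_mem_cons] at this ⊢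
              exact ⟨⟨by omega, by omega, by simp⟩, ⟨by omega, ha.outLt⟩,
                ⟨by omega, by omega, by simp⟩, ⟨by omega, by simp⟩, this⟩
            · have := hqe' (by omega); omega
            · omega
            · have := hgh _ hgd
              simp only [good_cons, List.length_cons, List.length_nil,
                List.forall_mem_cons] at this ⊢
              exact ⟨⟨by omega, by omega, by simp⟩, ⟨by omega, by simp⟩, this⟩
            · simp only [size_cons, List.length_cons, List.length_nil]; omega
          · dsimp only
            rw [hacc, List.length_nil]
            omega
          · dsimp only; omega
        · have hlive : ∃ r ∈ a.runs, live r = true := by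
            have : ∃ r ∈ a.runs, active r = true := by
              simpa [mergeTest, MState.regs, hb, ho] using hT
            obtain ⟨r, hr, hact⟩ := this
            refine ⟨r, hr, ?_⟩
            have := hnn r hr
            simp only [needs, active, live, Bool.and_eq_false_iff, decide_eq_false_iff_not,
              Bool.or_eq_true, decide_eq_true_eq] at *
            omega
          obtain ⟨hpop, hlt⟩ := ha.pop hnn ho hlive
          have hsz' := hsize _ hpop
          have hgd' := hgood _ hpop
          dsimp only at hsz' hgd'
          have hoL := hpop.outLen
          have hoW := hpop.outLt
          obtain ⟨hex, -⟩ := minHead_spec hlive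
          have hi : minIdx a.runs < a.runs.length := List.findIdx_lt_length.2 hex
          have hget : a.runs.getD (minIdx a.runs) [] = a.runs[minIdx a.runs] :=
            List.getD_eq_getElem _ _ hi
          have hsum := sum_map_set (fun r : List ℕ => r.getD 1 0 - r.getD 0 0) a.runs
            (minIdx a.runs) (popRun (a.runs.getD (minIdx a.runs) [])) hi
          have hsum' : toLoad (a.runs.set (minIdx a.runs)
              (popRun (a.runs.getD (minIdx a.runs) []))) = toLoad a.runs := by
            rw [hget] at hsum ⊢
            simp only [popRun, List.getD_cons_zero, List.getD_cons_succ] at hsum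
            unfold toLoad popRun
            omega
          refine ⟨_, 0, ?_, ⟨hpop, hq⟩, ?_, ?_⟩
          · refine exec_rite_false (by simpa [MState.regs] using hld)
              (exec_rite_false (by simpa [MState.regs, hb] using ho) ?_)
            refine exec_cmp ?_ ?_ ?_
            · simp only [MState.regs, List.getD_cons_zero, List.getD_cons_succ,
                List.drop_succ_cons, List.drop_zero]
            · simp only [MState.regs, size_cons, List.length_cons, List.length_nil] at hoL ⊢
              omega
            · simp only [MState.regs, good_cons, List.length_cons, List.length_nil,
                List.forall_mem_cons]
              exact ⟨⟨by omega, by omega, by simp⟩,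
                ⟨by dsimp only at hoL; omega, hoW⟩, by simpa using hgh _ hgd'⟩
          · dsimp only
            rw [hsum']
            simp only [MState.acc, List.length_append, List.length_singleton] at hlt ⊢
            omega
          · dsimp only
            rw [hsum']
            omega) a ⟨ha, hq⟩
  have hT' : a'.out.length ≠ b ∧ ∀ r ∈ a'.runs, active r = false := by
    simpa [mergeTest, MState.regs, hb] using hT
  have hrem : ∀ r ∈ a'.runs, rem d (src * L) b r = [] := by
    intro r hr
    have := hT'.2 r hr
    simp only [active, Bool.or_eq_false_iff, decide_eq_false_iff_not, not_lt] at this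
    rw [rem, List.drop_eq_nil_of_le this.1, Nat.sub_eq_zero_of_le this.2]
    simp [region]
  have hfl : (a'.runs.map (rem d (src * L) b)).flatten = [] := by
    rw [List.flatten_eq_nil_iff]
    intro l hl
    obtain ⟨r, hr, rfl⟩ := List.mem_map.1 hl
    exact hrem r hr
  have hlen := ha'.inv.perm.length_eq
  rw [hfl, List.append_nil, hG] at hlen
  simp only [MState.acc, List.length_append, length_region] at hlen
  have hol := ha'.outLen
  have hq0 := ha'.q0_le
  -- All runs are empty, so written and buffered words together number `(qe - q0) * b`; with a
  -- buffer that is not full, all pages must have been written.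
  have hqq : a'.q = qe := by
    by_contra hne
    have h1 : a'.q - q0 + 1 ≤ qe - q0 := by omega
    have h2 := Nat.mul_le_mul_right b h1
    rw [Nat.succ_mul] at h2
    have := hT'.1
    omega
  refine ⟨a', t, hex, ha', hqq, ?_, hrem, by omega⟩
  rw [hqq] at hlen
  exact List.eq_nil_of_length_eq_zero (by omega)

end ExtMem

namespace ExtMem

/-! ### External sorting -/

/-- The array is divided into runs of `w` words, each of which is sorted. -/
def RunSorted (d : ℕ → ℕ) (x len w : ℕ) : Prop :=
  ∀ i j, i ≤ j → j < len → i / w = j / w → d (x + i) ≤ d (x + j)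

/-- The (still unread) runs of `r` pages from page `q` on. -/
def initRuns (F q r np : ℕ) : Regs :=
  (List.range F).map fun i => [min (q + i * r) np, min (q + (i + 1) * r) np]

@[fun_prop] theorem primrec_initRuns {α : Type*} [Primcodable α] {F q r np : α → ℕ}
    (hF : Primrec F) (hq : Primrec q) (hr : Primrec r) (hnp : Primrec np) :
    Primrec fun a => initRuns (F a) (q a) (r a) (np a) := by
  unfold initRuns; fun_prop

theorem rem_pair (d : ℕ → ℕ) (S b x y : ℕ) :
    rem d S b [x, y] = region d (S + x * b) ((y - x) * b) := by simp [rem]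

theorem flatten_rem_initRuns (d : ℕ → ℕ) (S b F q r np : ℕ) (hq : q ≤ np) :
    ((initRuns F q r np).map (rem d S b)).flatten =
      region d (S + q * b) ((min (q + F * r) np - q) * b) := by
  induction F with
  | zero => simp [initRuns, region, hq]
  | succ F ih =>
    have h1 : initRuns (F + 1) q r np =
        initRuns F q r np ++ [[min (q + F * r) np, min (q + (F + 1) * r) np]] := by
      simp [initRuns, List.range_succ]
    rw [h1, List.map_append, List.flatten_append, ih]
    simp only [List.map_cons, List.map_nil, List.flatten_cons, List.flatten_nil, List.append_nil,
      rem_pair]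
    have h2 : q ≤ min (q + F * r) np := by simp [hq]
    have h3 : min (q + F * r) np ≤ min (q + (F + 1) * r) np := by
      rw [add_mul]; omega
    obtain ⟨u, hu⟩ := Nat.exists_eq_add_of_le h2
    obtain ⟨v, hv⟩ := Nat.exists_eq_add_of_le h3
    rw [hv, hu, show q + u - q = u by omega, show q + u + v - (q + u) = v by omega,
      show q + u + v - q = u + v by omega, add_mul, add_mul, region_add, ← add_assoc]

theorem toLoad_initRuns (F q r np : ℕ) (hq : q ≤ np) :
    toLoad (initRuns F q r np) = min (q + F * r) np - q := by
  induction F with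
  | zero => simp [initRuns, toLoad, hq]
  | succ F ih =>
    have h1 : initRuns (F + 1) q r np =
        initRuns F q r np ++ [[min (q + F * r) np, min (q + (F + 1) * r) np]] := by
      simp [initRuns, List.range_succ]
    unfold toLoad at ih ⊢
    rw [h1, List.map_append, List.sum_append, ih]
    simp only [List.map_cons, List.map_nil, List.sum_cons, List.sum_nil, List.getD_cons_zero,
      List.getD_cons_succ]
    rw [add_mul]
    omega

/-! ### Merge levels, external merge sort, and the combination of a pass with a sort. -/

def mergeLevel (src : ℕ) : Prog :=
  .seq (cmp (fun _ rs => [0] :: rs) (by fun_prop))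
    (.seq (rloop (fun P rs => decide (sc rs 0 0 < numPages P.2.1 (sc rs 1 0) (sc rs 1 1)))
        (by fun_prop)
        (.seq (cmp (fun P rs => rs.getD 0 [] :: [] :: rs.getD 1 [] :: rs.getD 2 [] ::
            initRuns (fanIn P.1 P.2.1) (sc rs 0 0) (sc rs 2 0)
              (numPages P.2.1 (sc rs 1 0) (sc rs 1 1))) (by fun_prop))
          (.seq (mergeRuns src 3)
            (cmp (fun _ rs => rs.getD 0 [] :: rs.getD 2 [] :: rs.getD 3 [] :: []) (by fun_prop)))))
      (cmp (fun _ rs => rs.tail) (by fun_prop)))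

/-- Consecutive groups of `F` runs are merged separately, so sorted runs become `F` times as long.
Every page is loaded once and written once, which gives six I/Os per page. -/
theorem exec_mergeLevel {μ : Machine} {n m aux r : ℕ} (hR : Room μ n m) {src : ℕ} (hsrc : src ≤ 2)
    {d : ℕ → ℕ} {o : List ℕ} {b np L F : ℕ} (hF : fanIn μ.M μ.B = F)
    (hb : pageLen μ.B n m = b) (hnp : numPages μ.B n m = np) (hL : arrLen μ.B n m = L)
    (haux : aux < μ.W) (hr1 : 1 ≤ r) (hr : r ≤ np) (hd : ∀ y, d y < μ.W)
    (hsort : RunSorted d (src * L) L (r * b)) :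
    ∃ d' t, Exec μ (mergeLevel src) ⟨enc [[n, m, aux], [r]], d, o⟩ t
        ⟨enc [[n, m, aux], [r]], d', o⟩ ∧ t ≤ 6 * np ∧ (∀ y, d' y < μ.W) ∧
      (∀ y, ¬ (3 * L ≤ y ∧ y < 3 * L + L) → d' y = d y) ∧
      (region d' (3 * L) L).Perm (region d (src * L) L) ∧
      RunSorted d' (3 * L) L (F * r * b) := by
  have hLe : L = np * b := by rw [← hL, ← hnp, ← hb]; rfl
  have hB := hR.hB
  have hb1 := one_le_pageLen μ.B n m
  have hnL := numPages_le_arrLen μ.B n m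
  have hcap := hR.cap
  have haddr := hR.addr
  have hn := hR.hn
  have hm := hR.hm
  have hF2 : 2 ≤ F := by rw [← hF]; exact Nat.le_add_left _ _
  rw [hb] at hb1 hcap
  rw [hF] at hcap
  rw [hL] at haddr hnL
  rw [hnp] at hnL
  have hsrcL : src * L ≤ 2 * L := Nat.mul_le_mul_right _ hsrc
  have hqb : ∀ q, q ≤ np → q * b ≤ L := fun q hq => hLe ▸ Nat.mul_le_mul_right _ hq
  set w := F * r with hw
  have hw1 : 1 ≤ w := Nat.mul_pos (by omega) hr1
  have hgood : ∀ q ≤ np, Good μ.W [[q], [n, m, aux], [r]] := by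
    intro q hq
    simp only [good_cons, List.length_cons, List.length_nil, List.forall_mem_cons, good_nil]
    exact ⟨⟨by omega, by omega, by simp⟩, ⟨by omega, by omega, by omega, by omega, by simp⟩,
      ⟨by omega, by omega, by simp⟩, trivial⟩
  obtain ⟨⟨g, d'⟩, t, hex, ⟨hdW, hout, hperm, hrs⟩, hT, ht⟩ := exec_rloop (μ := μ)
    (T := fun P rs => decide (sc rs 0 0 < numPages P.2.1 (sc rs 1 0) (sc rs 1 1)))
    (hT := by fun_prop)
    (p := .seq (cmp (fun P rs => rs.getD 0 [] :: [] :: rs.getD 1 [] :: rs.getD 2 [] ::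
            initRuns (fanIn P.1 P.2.1) (sc rs 0 0) (sc rs 2 0)
              (numPages P.2.1 (sc rs 1 0) (sc rs 1 1))) (by fun_prop))
          (.seq (mergeRuns src 3)
            (cmp (fun _ rs => rs.getD 0 [] :: rs.getD 2 [] :: rs.getD 3 [] :: []) (by fun_prop))))
    (A := ℕ × (ℕ → ℕ))
    (fun a => [[min (a.1 * w) np], [n, m, aux], [r]]) (fun a => a.2) (fun _ => o)
    (fun a => (∀ y, a.2 y < μ.W) ∧
      (∀ y, ¬ (3 * L ≤ y ∧ y < 3 * L + min (a.1 * w) np * b) → a.2 y = d y) ∧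
      (region a.2 (3 * L) (min (a.1 * w) np * b)).Perm
        (region d (src * L) (min (a.1 * w) np * b)) ∧
      RunSorted a.2 (3 * L) (min (a.1 * w) np * b) (w * b))
    (fun a => np - min (a.1 * w) np) (fun a => 6 * (np - min (a.1 * w) np))
    (by
      rintro ⟨g, e⟩ ⟨heW, hout, hperm, hrs⟩ hT
      dsimp only at heW hout hperm hrs hT ⊢
      have hq : g * w < np := by
        have : min (g * w) np < np := by simpa [hnp] using hT
        omega
      rw [min_eq_left hq.le] at *
      have hgw : (g + 1) * w = g * w + w := Nat.succ_mul g w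
      set q0 := g * w with hq0
      set qe := min (q0 + w) np with hqe
      have hq0e : q0 < qe := by omega
      have hqe_np : qe ≤ np := min_le_right _ _
      have hq0b := hqb q0 hq.le
      have hqeb := hqb qe hqe_np
      have hsub : q0 * b + (qe - q0) * b = qe * b := by
        rw [← add_mul, Nat.add_sub_cancel' hq0e.le]
      have hed : ∀ i < L, e (src * L + i) = d (src * L + i) := fun i hi => hout _ (by omega)
      set G := region e (src * L + q0 * b) ((qe - q0) * b) with hG
      set a : MState := ⟨initRuns F q0 r np, [], q0, e⟩ with ha
      have hinv : a.Inv μ.W F b np (src * L) (3 * L) q0 qe e G := by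
        refine ⟨by simp [ha, initRuns], ?_, Nat.zero_le _, by simp [ha], le_rfl, heW,
          fun _ _ => rfl, ?_⟩
        · intro rr hrr
          simp only [ha, initRuns, List.mem_map, List.mem_range] at hrr
          obtain ⟨i, hi, rfl⟩ := hrr
          refine ⟨by simp, by simp, ?_, by simp, ?_⟩
          · simp only [List.getD_cons_zero, List.getD_cons_succ, add_mul]
            omega
          · simp only [List.forall_mem_cons]
            exact ⟨by omega, by omega, by simp⟩
        · refine ⟨by simp [ha, MState.acc, region], by simp [ha, MState.acc, region], ?_, ?_⟩
          · intro l hl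
            simp only [ha, initRuns, List.map_map, List.mem_map, List.mem_range,
              Function.comp_apply, rem_pair] at hl
            obtain ⟨i, hi, rfl⟩ := hl
            rw [pairwise_region]
            intro u v huv hv
            have hi1 : (i + 1) * r = i * r + r := Nat.succ_mul i r
            rw [hi1] at hv
            -- Runs clipped at the end of the array are empty and trivially sorted.
            have hx : q0 + i * r < np := by
              by_contra hx
              rw [min_eq_right (by omega), min_eq_right (by omega)] at hv
              simp at hv
            rw [min_eq_left hx.le] at hv ⊢
            set x := q0 + i * r with hxdef
            set y := min (q0 + (i * r + r)) np with hy
            have hv1 : v < r * b := hv.trans_le (Nat.mul_le_mul_right _ (by omega))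
            have hv2 : x * b + v < L := by
              have : x * b + (y - x) * b = y * b := by
                rw [← add_mul, Nat.add_sub_cancel' (by omega)]
              have := hqb y (by omega)
              omega
            have hxb : x * b = (g * F + i) * (r * b) := by
              rw [hxdef, hq0, hw]; ring
            -- The `i`-th run of group `g` is run number `g * F + i` of the source, so all its words
            -- lie in one sorted run of `hsort`.
            have hdiv : ∀ u, u < r * b → (x * b + u) / (r * b) = g * F + i := by
              intro u hu
              rw [hxb, add_comm, Nat.add_mul_div_right _ _ (by omega), Nat.div_eq_of_lt hu,
                zero_add]
            rw [add_assoc, add_assoc, hed _ (by omega), hed _ hv2]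
            exact hsort _ _ (by omega) hv2 (by rw [hdiv u (by omega), hdiv v hv1])
          · have := flatten_rem_initRuns e (src * L) b F q0 r np hq.le
            simp only [ha, MState.acc, Nat.sub_self, zero_mul]
            rw [this]
            exact .refl _
      have hsz : size (initRuns F q0 r np) ≤ F * (b + 3) := by
        have := size_le a.runs (b + 2) fun r hr => (hinv.run r hr).2.1
        rwa [hinv.len] at this
      obtain ⟨a', t, hex, hinv', hq', ho', hrem, ht⟩ := exec_mergeRuns (o := o) hR hsrc hF hb hnp hL
        haux (by omega : r < μ.W) heW hqe_np (by simp [hG]) a hinv hq0e.le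
      have hacc : (region a'.disk (3 * L + q0 * b) ((qe - q0) * b)).Pairwise (· ≤ ·) ∧
          (region a'.disk (3 * L + q0 * b) ((qe - q0) * b)).Perm G := by
        have h1 := hinv'.inv.sorted
        have h2 := hinv'.inv.perm
        have h3 : (a'.runs.map (rem e (src * L) b)).flatten = [] := by
          rw [List.flatten_eq_nil_iff]
          intro l hl
          obtain ⟨r, hr, rfl⟩ := List.mem_map.1 hl
          exact hrem r hr
        rw [h3] at h2
        simp only [MState.acc, hq', ho', List.append_nil] at h1 h2
        exact ⟨h1, h2⟩
      have hsame : ∀ i < q0 * b, a'.disk (3 * L + i) = e (3 * L + i) := fun i hi =>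
        hinv'.disk_eq _ (by omega)
      refine ⟨(g + 1, a'.disk), t, ?_, ?_, ?_, ?_⟩
      · dsimp only
        rw [hgw]
        refine Exec.seq_eq (t := 0) (t' := t) (exec_cmp (rs' := a.regs [n, m, aux] r) ?_ ?_ ?_)
          (Exec.seq_eq (t := t) (t' := 0) hex (exec_cmp ?_ ?_ ?_) rfl) (by omega)
        · simp [MState.regs, ha, hF, hnp]
        · simp only [MState.regs, ha, size_cons, List.length_cons, List.length_nil]
          omega
        · have := hgood q0 hq.le
          simp only [good_cons, List.length_cons, List.length_nil,
            List.forall_mem_cons] at this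
          simp only [MState.regs, ha, good_cons, List.length_cons, List.length_nil,
            List.forall_mem_cons]
          refine ⟨this.1, ⟨by omega, by simp⟩, this.2.1, this.2.2.1, fun rr hrr => ?_⟩
          obtain ⟨-, h1, -, -, h2⟩ := hinv.run rr hrr
          refine ⟨?_, h2⟩
          simp only [initRuns, List.mem_map] at hrr
          obtain ⟨i, -, rfl⟩ := hrr
          simp only [List.length_cons, List.length_nil]
          omega
        · simp only [MState.regs, hq', List.getD_cons_zero, List.getD_cons_succ]; rfl
        · simp only [size_cons, List.length_cons, List.length_nil, size_nil]; omega
        · exact hgood _ (min_le_right _ _)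
      · dsimp only
        rw [hgw, ← hqe]
        refine ⟨hinv'.diskLt, ?_, ?_, ?_⟩
        · intro y hy
          rw [hinv'.disk_eq y (by rw [hq']; omega)]
          exact hout y (by omega)
        · rw [← hsub, region_add, region_add, region_congr hsame]
          refine hperm.append (hacc.2.trans ?_)
          rw [hG]
          refine .of_eq (region_congr fun i hi => ?_)
          rw [add_assoc, hed _ (by omega)]
        · intro i j hij hj hdiv
          rcases lt_or_ge j (q0 * b) with hjq | hjq
          · rw [hsame i (by omega), hsame j hjq]
            exact hrs i j hij hjq hdiv
          · rcases lt_or_ge i (q0 * b) with hiq | hiq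
            -- The new group starts at a multiple of the new run length, so no run straddles its
            -- first word.
            · exfalso
              have h1 : i / (w * b) < g := Nat.div_lt_of_lt_mul (by
                rw [hq0] at hiq
                calc i < g * w * b := hiq
                  _ = w * b * g := by ring)
              have h2 : g ≤ j / (w * b) := (Nat.le_div_iff_mul_le (Nat.mul_pos hw1 hb1)).2 (by
                rw [hq0] at hjq
                calc g * (w * b) = g * w * b := by ring
                  _ ≤ j := hjq)
              omega
            · rcases hij.eq_or_lt with rfl | hlt
              · exact le_rfl
              · have := pairwise_region.1 hacc.1 (i - q0 * b) (j - q0 * b) (by omega) (by omega)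
                rwa [show 3 * L + q0 * b + (i - q0 * b) = 3 * L + i by omega,
                  show 3 * L + q0 * b + (j - q0 * b) = 3 * L + j by omega] at this
      · dsimp only; rw [hgw]; omega
      · dsimp only
        rw [hgw]
        have := toLoad_initRuns F q0 r np hq.le
        simp only [ha] at ht
        omega)
    (0, d) ⟨hd, by simp, by simp [region], by intro i j _ h; simp at h⟩
  dsimp only at hex hdW hout hperm hrs hT ht
  have hq : min (g * w) np = np := by
    have : np ≤ min (g * w) np := by simpa [hnp] using hT
    omega
  rw [hq] at hex hout hperm hrs ht
  rw [← hLe] at hout hperm hrs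
  refine ⟨d', t, Exec.seq_eq (t := 0) (t' := t) (exec_cmp (rs' := [[min (0 * w) np], [n, m, aux], [r]])
    (by simp) ?_ (hgood _ (min_le_right _ _))) (Exec.seq_eq (t := t) (t' := 0) hex
      (exec_cmp (by simp) ?_ ?_) rfl) (by omega), ?_, hdW, hout, hperm, hrs⟩
  · simp only [size_cons, List.length_cons, List.length_nil, size_nil]; omega
  · simp only [size_cons, List.length_cons, List.length_nil, size_nil]; omega
  · exact ((good_cons _ _ _).1 (hgood np le_rfl)).2
  · rw [zero_mul, Nat.zero_min] at ht; omega

def idPass : PassFn where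
  master _ _ := false
  fn _ _ _ x := x
  primrec_master := by fun_prop
  primrec_fn := by fun_prop

theorem passOut_idPass (p : ℕ → Bool) (i s : ℕ) (l : List ℕ) :
    passOut p (fun _ _ x => x) i s l = l := by
  refine List.ext_getElem (length_passOut _ _ _ _ _) fun j h1 h2 => ?_
  simp only [passOut, List.getElem_map, List.getElem_range]
  exact List.getD_eq_getElem _ _ h2

theorem region_eq_of_pages {d d' : ℕ → ℕ} {x x' b np : ℕ}
    (h : ∀ j < np, (region d (x + j * b) b).Perm (region d' (x' + j * b) b)) :
    (region d x (np * b)).Perm (region d' x' (np * b)) := by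
  induction np with
  | zero => simp [region]
  | succ np ih =>
    rw [Nat.succ_mul, region_add, region_add]
    exact (ih fun j hj => h j (by omega)).append (h np (by omega))

/-- Sorts array number `x`; array number `3` is used as scratch space. -/
def sortArr (x : ℕ) : Prog :=
  .seq (cmp (fun _ rs => rs.getD 0 [] :: [1] :: []) (by fun_prop))
    (.seq (rloop (fun P rs => decide (sc rs 1 0 < numPages P.2.1 (sc rs 0 0) (sc rs 0 1)))
        (by fun_prop)
        (.seq (mergeLevel x) (.seq (pass idPass 3 x)
          (cmp (fun P rs => rs.getD 0 [] :: [min (fanIn P.1 P.2.1 * sc rs 1 0)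
            (numPages P.2.1 (sc rs 0 0) (sc rs 0 1))] :: []) (by fun_prop)))))
      (cmp (fun _ rs => rs.getD 0 [] :: []) (by fun_prop)))

/-- After `j` rounds the runs have min(F^j, np) pages, so `Nat.clog F np` rounds suffice. A round
merges into array 3 and copies back, at six I/Os per page each. -/
theorem exec_sortArr {μ : Machine} {n m aux : ℕ} (hR : Room μ n m) {x : ℕ} (hx : x ≤ 2)
    {d : ℕ → ℕ} {o : List ℕ} {b np L F : ℕ} (hF : fanIn μ.M μ.B = F)
    (hb : pageLen μ.B n m = b) (hnp : numPages μ.B n m = np) (hL : arrLen μ.B n m = L)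
    (haux : aux < μ.W) (hd : ∀ y, d y < μ.W) (hsort : RunSorted d (x * L) L b) :
    ∃ d' t, Exec μ (sortArr x) ⟨enc [[n, m, aux]], d, o⟩ t ⟨enc [[n, m, aux]], d', o⟩ ∧
      t ≤ 12 * np * Nat.clog F np ∧ (∀ y, d' y < μ.W) ∧
      (∀ y, ¬ (x * L ≤ y ∧ y < x * L + L) → ¬ (3 * L ≤ y ∧ y < 3 * L + L) → d' y = d y) ∧
      region d' (x * L) L = sortl (region d (x * L) L) := by
  have hLe : L = np * b := by rw [← hL, ← hnp, ← hb]; rfl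
  have hb1 := one_le_pageLen μ.B n m
  have hnL := numPages_le_arrLen μ.B n m
  have hcap := hR.cap
  have haddr := hR.addr
  have hn := hR.hn
  have hm := hR.hm
  have hF2 : 2 ≤ F := by rw [← hF]; exact Nat.le_add_left _ _
  have hnp1 : 1 ≤ np := by rw [← hnp]; exact Nat.succ_pos _
  rw [hb] at hb1 hcap
  rw [hL] at haddr hnL
  rw [hnp] at hnL
  have hxL : x * L ≤ 2 * L := Nat.mul_le_mul_right _ hx
  have hgood : ∀ r ≤ np, Good μ.W [[n, m, aux], [r]] := by
    intro q hq
    simp only [good_cons, List.length_cons, List.length_nil, List.forall_mem_cons, good_nil]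
    exact ⟨⟨by omega, by omega, by omega, by omega, by simp⟩,
      ⟨by omega, by omega, by simp⟩, trivial⟩
  obtain ⟨⟨j, d'⟩, t, hex, ⟨hdW, hout, hperm, hrs⟩, hT, ht⟩ := exec_rloop (μ := μ)
    (T := fun P rs => decide (sc rs 1 0 < numPages P.2.1 (sc rs 0 0) (sc rs 0 1)))
    (hT := by fun_prop)
    (p := .seq (mergeLevel x) (.seq (pass idPass 3 x)
          (cmp (fun P rs => rs.getD 0 [] :: [min (fanIn P.1 P.2.1 * sc rs 1 0)
            (numPages P.2.1 (sc rs 0 0) (sc rs 0 1))] :: []) (by fun_prop))))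
    (A := ℕ × (ℕ → ℕ))
    (fun a => [[n, m, aux], [min (F ^ a.1) np]]) (fun a => a.2) (fun _ => o)
    (fun a => (∀ y, a.2 y < μ.W) ∧
      (∀ y, ¬ (x * L ≤ y ∧ y < x * L + L) → ¬ (3 * L ≤ y ∧ y < 3 * L + L) → a.2 y = d y) ∧
      (region a.2 (x * L) L).Perm (region d (x * L) L) ∧
      RunSorted a.2 (x * L) L (min (F ^ a.1) np * b))
    (fun a => np - min (F ^ a.1) np) (fun a => 12 * np * (Nat.clog F np - a.1))
    (by
      rintro ⟨j, e⟩ ⟨heW, hout, hperm, hrs⟩ hT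
      dsimp only at heW hout hperm hrs hT ⊢
      have hq : F ^ j < np := by
        have : min (F ^ j) np < np := by simpa [hnp] using hT
        omega
      have hjc : j < Nat.clog F np := (Nat.lt_clog_iff_pow_lt hF2).2 hq
      have hpos : 1 ≤ F ^ j := Nat.one_le_pow _ _ (by omega)
      have hgrow : F ^ j < F ^ (j + 1) := Nat.pow_lt_pow_right (by omega) (by omega)
      have hpow : F * F ^ j = F ^ (j + 1) := (pow_succ' F j).symm
      have hmin : min (F ^ j) np = F ^ j := min_eq_left hq.le
      rw [hmin] at hrs ⊢
      obtain ⟨e1, t1, hex1, ht1, he1W, he1out, he1perm, he1rs⟩ := exec_mergeLevel (o := o) hR hx hF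
        hb hnp hL haux hpos hq.le heW hrs
      obtain ⟨e2, t2, hex2, ht2, he2W, he2out, he2reg⟩ := exec_pass (o := o) hR idPass
        (src := 3) (dst := x) le_rfl (by omega) (rest := [[F ^ j]]) (d := e1)
        hb hnp hL haux he1W (fun _ _ _ _ h => h) ((good_cons _ _ _).1 (hgood (F ^ j) hq.le)).2
        (by simp)
      have hpages : ∀ k < np, region e2 (x * L + k * b) b = region e1 (3 * L + k * b) b := by
        intro k hk
        rw [he2reg k hk]
        change sortl (page b (passOut _ (fun _ _ x => x) 0 0 _) k) = _
        rw [passOut_idPass, hLe, page_region hk, ← hLe]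
        -- The copying pass sorts its pages, but run lengths are multiples of the page length; each
        -- page lies inside one sorted run and is left unchanged.
        refine (eq_sortl (.refl _) (pairwise_region.2 fun u v huv hv => ?_)).symm
        have hkb : k * b + b ≤ L := by
          rw [hLe, ← Nat.succ_mul]; exact Nat.mul_le_mul_right _ hk
        rw [add_assoc, add_assoc]
        refine he1rs _ _ (by omega) (by omega) ?_
        have hdv : ∀ c, ∀ u < b, (k * b + u) / (c * b) = k / c := by
          intro c u hu
          rw [mul_comm c b, ← Nat.div_div_eq_div_mul, mul_comm k b, Nat.mul_add_div hb1,
            Nat.div_eq_of_lt hu, add_zero]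
        rw [hdv _ u (by omega), hdv _ v hv]
      have hcopy : ∀ i < L, e2 (x * L + i) = e1 (3 * L + i) := by
        intro i hi
        have hk : i / b < np := Nat.div_lt_of_lt_mul (by rw [mul_comm, ← hLe]; exact hi)
        have h1 := congrArg (fun l => l[i % b]?) (hpages _ hk)
        have h2 : i / b * b + i % b = i := Nat.div_add_mod' i b
        have h3 := Nat.mod_lt i hb1
        simpa [region, h3, add_assoc, h2] using h1
      refine ⟨(j + 1, e2), t1 + t2, ?_, ⟨he2W, ?_, ?_, ?_⟩, ?_, ?_⟩
      · refine Exec.seq_eq (t := t1) (t' := t2) hex1 (Exec.seq_eq (t := t2) (t' := 0) hex2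
          (exec_cmp ?_ ?_ ?_) rfl) rfl
        · simp [hF, hnp, hpow]
        · simp only [size_cons, List.length_cons, List.length_nil, size_nil]; omega
        · exact hgood _ (min_le_right _ _)
      · intro y h1 h2
        dsimp only
        rw [he2out y h1, he1out y h2]
        exact hout y h1 h2
      · refine List.Perm.trans ?_ hperm
        dsimp only
        rw [region_congr (d' := fun y => e1 (3 * L + (y - x * L))) fun i hi => by
          rw [hcopy i hi, Nat.add_sub_cancel_left]]
        refine List.Perm.trans (.of_eq ?_) he1perm
        simp [region]
      · dsimp only
        intro i k hik hk hdiv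
        rw [hcopy i (by omega), hcopy k hk]
        refine he1rs i k hik hk ?_
        rw [hpow]
        rcases le_total (F ^ (j + 1)) np with h | h
        · rwa [min_eq_left h] at hdiv
        -- Here the whole array is a single run and both quotients are 0.
        · have : L ≤ F ^ (j + 1) * b := hLe ▸ Nat.mul_le_mul_right _ h
          rw [Nat.div_eq_of_lt (by omega), Nat.div_eq_of_lt (by omega)]
      · dsimp only; omega
      · dsimp only
        obtain ⟨k, hk⟩ := Nat.exists_eq_add_of_lt hjc
        rw [hk, show j + k + 1 - (j + 1) = k by omega, show j + k + 1 - j = k + 1 by omega, mul_add]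
        omega)
    (0, d) ⟨hd, fun _ _ _ => rfl, .refl _, by
      simpa [min_eq_left hnp1] using hsort⟩
  dsimp only at hex hdW hout hperm hrs hT ht
  have hq : min (F ^ j) np = np := by
    have : np ≤ min (F ^ j) np := by simpa [hnp] using hT
    omega
  rw [hq] at hex hrs
  refine ⟨d', t, Exec.seq_eq (t := 0) (t' := t) (exec_cmp (rs' := [[n, m, aux], [min (F ^ 0) np]])
    ?_ ?_ (hgood _ (min_le_right _ _))) (Exec.seq_eq (t := t) (t' := 0) hex
      (exec_cmp (by simp) ?_ ?_) rfl) (by omega), ?_, hdW, hout, eq_sortl hperm ?_⟩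
  · simp [min_eq_left hnp1]
  · simp only [size_cons, List.length_cons, List.length_nil, size_nil]; omega
  · simp only [size_cons, List.length_cons, List.length_nil, size_nil]; omega
  · have := hgood np le_rfl
    simp only [good_cons] at this ⊢
    exact ⟨this.1, good_nil _⟩
  · rw [Nat.sub_zero] at ht; omega
  · refine pairwise_region.2 fun i k hik hk => hrs i k hik.le hk ?_
    rw [← hLe, Nat.div_eq_of_lt hk, Nat.div_eq_of_lt (hik.trans hk)]

/-- Applies `f` to array number `src` and sorts the result, which becomes array number `dst`. -/
def stage (f : PassFn) (src dst : ℕ) : Prog := .seq (pass f src dst) (sortArr dst)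

/-- The pass already sorts each page, which provides the initial runs of one page. The bound `hf` is
asked for arbitrary arguments, so no knowledge of the array contents is needed to exclude overflow.
-/
theorem exec_stage {μ : Machine} {n m aux : ℕ} (hR : Room μ n m) (f : PassFn) {src dst : ℕ}
    (hsrc : src ≤ 2) (hdst : dst ≤ 2) {d : ℕ → ℕ} {o : List ℕ} {np L F : ℕ}
    (hF : fanIn μ.M μ.B = F) (hnp : numPages μ.B n m = np) (hL : arrLen μ.B n m = L)
    (haux : aux < μ.W) (hd : ∀ y, d y < μ.W)
    (hf : ∀ i s x, f.fn [n, m, aux] i s x < μ.W) :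
    ∃ d' t, Exec μ (stage f src dst) ⟨enc [[n, m, aux]], d, o⟩ t ⟨enc [[n, m, aux]], d', o⟩ ∧
      t ≤ 12 * (np * (Nat.clog F np + 1)) ∧ (∀ y, d' y < μ.W) ∧
      (∀ x ≤ 2, x ≠ dst → region d' (x * L) L = region d (x * L) L) ∧
      region d' (dst * L) L = sortl (passOut (f.master [n, m, aux]) (f.fn [n, m, aux]) 0 0
        (region d (src * L) L)) := by
  obtain ⟨b, hb⟩ : ∃ b, pageLen μ.B n m = b := ⟨_, rfl⟩
  have hLe : L = np * b := by rw [← hL, ← hnp, ← hb]; rfl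
  have hb1 := one_le_pageLen μ.B n m
  rw [hb] at hb1
  obtain ⟨d1, t1, hex1, ht1, hd1W, hd1out, hd1reg⟩ := exec_pass (o := o) hR f (src := src)
    (dst := dst) (by omega) (by omega) (rest := []) hb hnp hL haux hd
    (fun i s x _ _ => hf i s x) (by simp) (by simp)
  set out := passOut (f.master [n, m, aux]) (f.fn [n, m, aux]) 0 0 (region d (src * L) L) with hout
  have houtl : out.length = np * b := by rw [hout, length_passOut, length_region, hLe]
  have hrs : RunSorted d1 (dst * L) L b := by
    intro i j hij hj hdiv
    have hk : i / b < np := Nat.div_lt_of_lt_mul (by rw [mul_comm, ← hLe]; omega)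
    have h1 := hd1reg _ hk
    have h2 := sortl_sorted (page b out (i / b))
    rw [← h1, pairwise_region] at h2
    have hi := Nat.div_add_mod' i b
    have hj' := Nat.div_add_mod' j b
    have hjm := Nat.mod_lt j hb1
    rw [← hdiv] at hj'
    rcases hij.eq_or_lt with rfl | hlt
    · exact le_rfl
    · have := h2 (i % b) (j % b) (by omega) hjm
      rwa [add_assoc, add_assoc, hi, hj'] at this
  obtain ⟨d2, t2, hex2, ht2, hd2W, hd2out, hd2reg⟩ := exec_sortArr (o := o) hR hdst hF hb hnp hL
    haux hd1W hrs
  refine ⟨d2, t1 + t2, .seq hex1 hex2, ?_, hd2W, ?_, ?_⟩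
  · have : 12 * (np * (Nat.clog F np + 1)) = 12 * np * Nat.clog F np + 12 * np := by ring
    omega
  · intro x hx hne
    refine region_congr fun i hi => ?_
    have h3 : ¬ (dst * L ≤ x * L + i ∧ x * L + i < dst * L + L) := by
      rcases lt_or_gt_of_ne hne with h | h
      · have : (x + 1) * L ≤ dst * L := Nat.mul_le_mul_right _ h
        rw [Nat.succ_mul] at this; omega
      · have : (dst + 1) * L ≤ x * L := Nat.mul_le_mul_right _ h
        rw [Nat.succ_mul] at this; omega
    have : x * L ≤ 2 * L := Nat.mul_le_mul_right _ hx
    rw [hd2out _ h3 (by omega), hd1out _ h3]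
  · rw [hd2reg]
    have hp : (region d1 (dst * L) L).Perm out := by
      have h4 : out = region (fun i => out.getD i 0) 0 (np * b) := by
        refine List.ext_getElem (by simp [houtl]) fun i h1 h2 => ?_
        simp [region, h1]
      rw [h4, hLe]
      refine region_eq_of_pages fun j hj => ?_
      rw [← hLe, hd1reg j hj]
      refine (sortl_perm _).trans (.of_eq ?_)
      conv_lhs => rw [h4]
      rw [page_region hj]
    exact eq_sortl ((sortl_perm _).trans hp) (sortl_sorted _)

end ExtMem

namespace ExtMem

/-! ### Trivially perfect graphs and orderings -/

section Graph

variable {V : Type*} (G : SimpleGraph V)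

/-- For `y` before `x` before `v` with `x` adjacent to `v`, the vertex `y` is adjacent to both or to
none of `x` and `v`. -/
def Coherent (ρ : V → ℕ) : Prop :=
  ∀ y x v, ρ y < ρ x → ρ x < ρ v → G.Adj x v → (G.Adj y x ↔ G.Adj y v)

variable {G}

/-- The only pair left open is `a`, `d`: adjacent gives a cycle, otherwise a path. This is why P₄
and C₄ can be treated together throughout. -/
theorem isForbiddenList_of_adj {a b c d : V} (hab : G.Adj a b) (hbc : G.Adj b c) (hcd : G.Adj c d)
    (hac : ¬ G.Adj a c) (hbd : ¬ G.Adj b d) (nac : a ≠ c) (nbd : b ≠ d) (nad : a ≠ d) :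
    IsForbiddenList G [a, b, c, d] := by
  have hinj : Function.Injective ![a, b, c, d] := by
    have h1 := hab.ne
    have h2 := hbc.ne
    have h3 := hcd.ne
    intro i j hij
    fin_cases i <;> fin_cases j <;> simp_all
  have hca : ¬ G.Adj c a := fun h => hac h.symm
  have hdb : ¬ G.Adj d b := fun h => hbd h.symm
  have h1 := hab.symm
  have h2 := hbc.symm
  have h3 := hcd.symm
  by_cases had : G.Adj a d
  · have h4 := had.symm
    have hcyc : ∀ i j : Fin 4, (SimpleGraph.cycleGraph 4).Adj i j ↔
        i.1 + 1 = j.1 ∨ j.1 + 1 = i.1 ∨ i.1 + 3 = j.1 ∨ j.1 + 3 = i.1 := by decide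
    have hrel : ∀ i j, G.Adj (![a, b, c, d] i) (![a, b, c, d] j) ↔
        (SimpleGraph.cycleGraph 4).Adj i j := by
      intro i j
      rw [hcyc]
      fin_cases i <;> fin_cases j <;> simp [*]
    exact .inr ⟨⟨⟨![a, b, c, d], hinj⟩, hrel _ _⟩, rfl⟩
  · have hda : ¬ G.Adj d a := fun h => had h.symm
    have hrel : ∀ i j, G.Adj (![a, b, c, d] i) (![a, b, c, d] j) ↔
        (SimpleGraph.pathGraph 4).Adj i j := by
      intro i j
      rw [SimpleGraph.pathGraph_adj]
      fin_cases i <;> fin_cases j <;> simp [*]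
    exact .inl ⟨⟨⟨![a, b, c, d], hinj⟩, hrel _ _⟩, rfl⟩

theorem not_isTriviallyPerfect_of_isForbiddenList {l : List V} (h : IsForbiddenList G l) :
    ¬ IsTriviallyPerfect G := by
  rintro ⟨h1, h2⟩
  rcases h with ⟨e, -⟩ | ⟨e, -⟩
  · exact h1 ⟨e⟩
  · exact h2 ⟨e⟩

/-- In a coherent order the centre of an induced three-vertex path precedes both ends: if an end
came before the centre, each possible place of the other end would make the two ends adjacent. Here
`b` and `c` are centres and would have to precede each other. -/
theorem Coherent.not_path {ρ : V → ℕ} (hρ : Function.Injective ρ) (h : Coherent G ρ) {a b c d : V}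
    (hab : G.Adj a b) (hbc : G.Adj b c) (hcd : G.Adj c d) (hac : ¬ G.Adj a c)
    (hbd : ¬ G.Adj b d) (nac : a ≠ c) (nbd : b ≠ d) : False := by
  have key : ∀ b c d, G.Adj b c → G.Adj c d → ¬ G.Adj b d → b ≠ d → ρ b < ρ c → False := by
    intro b c d hbc hcd hbd nbd hlt
    rcases lt_trichotomy (ρ d) (ρ b) with h1 | h1 | h1
    · exact hbd ((h d b c h1 hlt hbc).2 hcd.symm).symm
    · exact nbd (hρ h1.symm)
    · rcases lt_trichotomy (ρ d) (ρ c) with h2 | h2 | h2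
      · exact hbd ((h b d c h1 h2 hcd.symm).2 hbc)
      · exact hcd.ne (hρ h2.symm)
      · exact hbd ((h b c d hlt h2 hcd).1 hbc)
  rcases lt_or_gt_of_ne (fun h => hbc.ne (hρ h) : ρ b ≠ ρ c) with hlt | hlt
  · exact key b c d hbc hcd hbd nbd hlt
  · exact key c b a hbc.symm hab.symm (fun h => hac h.symm) nac.symm hlt

theorem Coherent.isTriviallyPerfect {ρ : V → ℕ} (hρ : Function.Injective ρ) (h : Coherent G ρ) :
    IsTriviallyPerfect G := by
  constructor
  · rintro ⟨e⟩
    refine h.not_path hρ (a := e 0) (b := e 1) (c := e 2) (d := e 3) ?_ ?_ ?_ ?_ ?_ ?_ ?_ <;>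
      simp [e.map_adj_iff, SimpleGraph.pathGraph_adj]
  · rintro ⟨e⟩
    refine h.not_path hρ (a := e 0) (b := e 1) (c := e 2) (d := e 3) ?_ ?_ ?_ ?_ ?_ ?_ ?_ <;>
      simp only [e.map_adj_iff, ne_eq, e.injective.eq_iff] <;> decide

/-- Otherwise N(b) without `c` would lie in N(c) without `b` and `w`, giving deg b - 1 ≤ deg c - 2,
against the degree hypothesis. -/
theorem exists_adj_not_adj [Fintype V] [DecidableRel G.Adj] {b c w : V} (hbc : G.Adj b c)
    (hdeg : G.degree c ≤ G.degree b) (hwc : G.Adj w c) (hwb : ¬ G.Adj w b) (nwb : w ≠ b) :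
    ∃ x, G.Adj x b ∧ ¬ G.Adj x c ∧ x ≠ c := by
  classical
  by_contra! hcon
  have hsub : (G.neighborFinset b).erase c ⊆ ((G.neighborFinset c).erase b).erase w := by
    intro x hx
    simp only [Finset.mem_erase, SimpleGraph.mem_neighborFinset] at hx ⊢
    refine ⟨?_, hx.2.ne', ?_⟩
    · rintro rfl; exact hwb hx.2.symm
    · by_contra hxc
      exact hx.1 (hcon x hx.2.symm fun h => hxc h.symm)
  have hcard := Finset.card_le_card hsub
  rw [Finset.card_erase_of_mem (by simpa using hbc), Finset.card_erase_of_mem (by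
      simp only [Finset.mem_erase, SimpleGraph.mem_neighborFinset]; exact ⟨nwb, hwc.symm⟩),
    Finset.card_erase_of_mem (by simpa using hbc.symm)] at hcard
  simp only [SimpleGraph.card_neighborFinset_eq_degree] at hcard
  -- Needed because the subtractions in `hcard` are truncated.
  have h2 : 2 ≤ G.degree c := by
    rw [← SimpleGraph.card_neighborFinset_eq_degree]
    exact Finset.one_lt_card.2 ⟨b, by simpa using hbc.symm, w, by simpa using hwc.symm, nwb.symm⟩
  omega

theorem isForbiddenList_of_witness {x b c w : V} (hbc : G.Adj b c) (hwc : G.Adj w c)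
    (hwb : ¬ G.Adj w b) (nwb : w ≠ b) (hxb : G.Adj x b) (hxc : ¬ G.Adj x c) (nxc : x ≠ c) :
    IsForbiddenList G [x, b, c, w] :=
  isForbiddenList_of_adj hxb hbc hwc.symm hxc (fun h => hwb h.symm) nxc nwb.symm (by
    rintro rfl; exact hwb hxb)

/-- Suppose `y` sees exactly one of `x` and `v`. The middle edge of the forbidden subgraph is then
`y x` (with `w = v`) or `x v` (with `w = y`), and its earlier end has the larger or an equal degree.
-/
theorem IsTriviallyPerfect.coherent [Fintype V] [DecidableRel G.Adj] (h : IsTriviallyPerfect G)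
    {ρ : V → ℕ} (hdeg : ∀ u v, ρ u < ρ v → G.degree v ≤ G.degree u) : Coherent G ρ := by
  intro y x v hyx hxv hadj
  have hyv : y ≠ v := by rintro rfl; omega
  have hyx' : y ≠ x := by rintro rfl; omega
  constructor
  · intro hyx''
    by_contra hn
    obtain ⟨z, h1, h2, h3⟩ := exists_adj_not_adj hyx'' (hdeg _ _ hyx) hadj.symm
      (fun h => hn h.symm) hyv.symm
    exact not_isTriviallyPerfect_of_isForbiddenList (isForbiddenList_of_witness hyx'' hadj.symm
      (fun h => hn h.symm) hyv.symm h1 h2 h3) h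
  · intro hyv'
    by_contra hn
    obtain ⟨z, h1, h2, h3⟩ := exists_adj_not_adj hadj (hdeg _ _ hxv) hyv' hn hyx'
    exact not_isTriviallyPerfect_of_isForbiddenList (isForbiddenList_of_witness hadj hyv'
      hn hyx' h1 h2 h3) h

theorem mem_suffix_iff [DecidableEq V] {pre suf : List V} {y : V} (h : (pre ++ y :: suf).Nodup)
    {z : V} (hz : z ∈ pre ++ y :: suf) :
    z ∈ y :: suf ↔ (pre ++ y :: suf).idxOf y ≤ (pre ++ y :: suf).idxOf z := by
  have hd := (List.nodup_append.1 h).2.2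
  have hy : y ∉ pre := fun hy => hd y hy y List.mem_cons_self rfl
  rw [List.idxOf_append_of_notMem hy, List.idxOf_cons_self, add_zero]
  constructor
  · intro hz
    rw [List.idxOf_append_of_notMem fun h => hd z h z hz rfl]
    omega
  · intro hle
    rcases List.mem_append.1 hz with hz | hz
    · rw [List.idxOf_append_of_mem hz] at hle
      have := List.idxOf_lt_length_iff.2 hz
      omega
    · exact hz

/-- Coherence at `y` says that adjacency to `y` propagates along every edge between later vertices,
hence through the component of `y` among the vertices from `y` on. -/
theorem isUco_iff_coherent [DecidableEq V] {γ : List V} (hγ : IsOrdering γ) :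
    IsUco G γ ↔ Coherent G γ.idxOf := by
  constructor
  · rintro ⟨-, h⟩ y x v hyx hxv hadj
    obtain ⟨pre, suf, rfl⟩ := List.append_of_mem (hγ.2 y)
    have hx := (mem_suffix_iff hγ.1 (hγ.2 x)).2 hyx.le
    have hv := (mem_suffix_iff hγ.1 (hγ.2 v)).2 (hyx.trans hxv).le
    have hu := h pre suf y rfl
    have hxv' : (G.induce {w | w ∈ y :: suf}).Adj ⟨x, hx⟩ ⟨v, hv⟩ := hadj
    constructor
    · intro hyx'
      have hyx'' : (G.induce {w | w ∈ y :: suf}).Adj ⟨y, List.mem_cons_self⟩ ⟨x, hx⟩ := hyx'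
      refine hu ⟨v, hv⟩ (hyx''.reachable.trans hxv'.reachable) fun heq => ?_
      have : v = y := congrArg Subtype.val heq
      subst this; omega
    · intro hyv
      have hyv' : (G.induce {w | w ∈ y :: suf}).Adj ⟨y, List.mem_cons_self⟩ ⟨v, hv⟩ := hyv
      refine hu ⟨x, hx⟩ (hyv'.reachable.trans hxv'.symm.reachable) fun heq => ?_
      have : x = y := congrArg Subtype.val heq
      subst this; omega
  · intro h
    refine ⟨hγ, ?_⟩
    rintro pre suf v rfl w hr hne
    have hidx : ∀ z, z ∈ v :: suf → z ≠ v →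
        (pre ++ v :: suf).idxOf v < (pre ++ v :: suf).idxOf z := by
      intro z hz hzv
      refine lt_of_le_of_ne ((mem_suffix_iff hγ.1 (hγ.2 z)).1 hz) fun heq => hzv ?_
      exact (List.idxOf_inj (hγ.2 v)).1 heq |>.symm
    -- Induction along a walk from `v`: each further edge joins two vertices after `v`, or returns
    -- to `v`.
    have key : ∀ w : {w | w ∈ v :: suf},
        (G.induce {w | w ∈ v :: suf}).Reachable ⟨v, List.mem_cons_self⟩ w →
        w.1 = v ∨ G.Adj v w.1 := by
      intro w hw
      rw [SimpleGraph.reachable_iff_reflTransGen] at hw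
      induction hw with
      | refl => exact .inl rfl
      | @tail w w' _ hadj ih =>
        have hadj' : G.Adj w.1 w'.1 := hadj
        rcases ih with ih | ih
        · exact .inr (by rwa [ih] at hadj')
        · by_cases hw' : w'.1 = v
          · exact .inl hw'
          · right
            have h1 := hidx w.1 w.2 ih.ne'
            have h2 := hidx w'.1 w'.2 hw'
            rcases lt_trichotomy ((pre ++ v :: suf).idxOf w.1) ((pre ++ v :: suf).idxOf w'.1)
              with h3 | h3 | h3
            · exact (h v w.1 w'.1 h1 h3 hadj').1 ih
            · exact absurd ((List.idxOf_inj (hγ.2 _)).1 h3) hadj'.ne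
            · exact (h v w'.1 w.1 h2 h3 hadj'.symm).2 ih
    rcases key w hr with h1 | h1
    · exact absurd (Subtype.ext h1) hne
    · exact h1

theorem isUco_iff_isTriviallyPerfect {n : ℕ} {G : SimpleGraph (Fin n)} [DecidableRel G.Adj]
    {γ : List (Fin n)} (hγ : IsDegreeOrdering G γ) : IsUco G γ ↔ IsTriviallyPerfect G := by
  rw [isUco_iff_coherent hγ.1]
  constructor
  · exact fun h => h.isTriviallyPerfect fun a b hab => (List.idxOf_inj (hγ.1.2 a)).1 hab
  · intro h
    refine h.coherent fun u v huv => ?_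
    have hu := List.idxOf_lt_length_iff.2 (hγ.1.2 u)
    have hv := List.idxOf_lt_length_iff.2 (hγ.1.2 v)
    have := List.pairwise_iff_getElem.1 hγ.2 _ _ hu hv huv
    rwa [List.getElem_idxOf, List.getElem_idxOf] at this

/-- One more than the largest rank of a neighbour of `v` below the bound `k`, and `0` if there is
none. -/
def prevRank [Fintype V] [DecidableRel G.Adj] (ρ : V → ℕ) (v : V) (k : ℕ) : ℕ :=
  ((G.neighborFinset v).filter fun y => ρ y < k).sup fun y => ρ y + 1

/-! ### Testing coherence edge by edge, and the witnesses of failure. -/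

variable [Fintype V] [DecidableRel G.Adj] {ρ : V → ℕ}

theorem prevRank_cases (v : V) (k : ℕ) :
    (prevRank (G := G) ρ v k = 0 ∧ ∀ y, G.Adj y v → ¬ ρ y < k) ∨
      ∃ w, G.Adj w v ∧ ρ w < k ∧ prevRank (G := G) ρ v k = ρ w + 1 ∧
        ∀ y, G.Adj y v → ρ y < k → ρ y ≤ ρ w := by
  have hmem : ∀ y, y ∈ (G.neighborFinset v).filter (fun y => ρ y < k) ↔ G.Adj y v ∧ ρ y < k := by
    intro y
    rw [Finset.mem_filter, SimpleGraph.mem_neighborFinset, SimpleGraph.adj_comm]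
  rcases ((G.neighborFinset v).filter fun y => ρ y < k).eq_empty_or_nonempty with h | h
  · refine .inl ⟨by rw [prevRank, h, Finset.sup_empty]; rfl, fun y hy hk => ?_⟩
    have := (hmem y).2 ⟨hy, hk⟩
    rw [h] at this
    simp at this
  · obtain ⟨w, hw, hs⟩ := Finset.exists_mem_eq_sup _ h fun y => ρ y + 1
    refine .inr ⟨w, ((hmem w).1 hw).1, ((hmem w).1 hw).2, hs, fun y hy hk => ?_⟩
    have : ρ y + 1 ≤ ρ w + 1 := by
      rw [← hs]; exact Finset.le_sup (f := fun y => ρ y + 1) ((hmem y).2 ⟨hy, hk⟩)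
    omega

/-- Strong induction on the rank of the earlier end `u`. Let `a` be the common last neighbour of `u`
and `v` before `u`. After `a` neither has a neighbour before `u`; for `y` before `a`, the edges `a
u` and `a v` are covered by induction, so `y` sees `u` iff it sees `a` iff it sees `v`. -/
theorem coherent_of_prevRank (hρ : Function.Injective ρ)
    (h : ∀ u v, ρ u < ρ v → G.Adj u v →
      prevRank (G := G) ρ v (ρ u) = prevRank (G := G) ρ u (ρ u)) : Coherent G ρ := by
  have key : ∀ k, ∀ y u v, ρ u = k → ρ y < ρ u → ρ u < ρ v → G.Adj u v →
      (G.Adj y u ↔ G.Adj y v) := by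
    intro k
    induction k using Nat.strong_induction_on with
    | _ k ih =>
      intro y u v hk hyu huv hadj
      have hpr := h u v huv hadj
      rcases prevRank_cases (G := G) (ρ := ρ) v (ρ u) with ⟨h1, h2⟩ | ⟨a, h1, h2, h3, h4⟩ <;>
        rcases prevRank_cases (G := G) (ρ := ρ) u (ρ u) with ⟨h5, h6⟩ | ⟨a', h5, h6, h7, h8⟩
      · exact iff_of_false (fun hh => h6 y hh hyu) (fun hh => h2 y hh hyu)
      · omega
      · omega
      · have haa : a = a' := hρ (by omega)
        subst haa
        rcases lt_trichotomy (ρ y) (ρ a) with hya | hya | hya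
        · exact (ih (ρ a) (by omega) y a u rfl hya h6 h5).symm.trans
            (ih (ρ a) (by omega) y a v rfl hya (h6.trans huv) h1)
        · rw [hρ hya]
          exact iff_of_true h5 h1
        · exact iff_of_false (fun hh => absurd (h8 y hh hyu) (by omega))
            (fun hh => absurd (h4 y hh hyu) (by omega))
  exact fun y x v h1 h2 h3 => key _ y x v rfl h1 h2 h3

/-- The edge `b c` and the neighbour `w` of `c` show that no vertex order by degree that puts `b`
before `c` is a universal-in-a-component ordering. -/
def IsWitness (G : SimpleGraph V) (ρ : V → ℕ) (b c w : V) : Prop :=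
  G.Adj b c ∧ ρ b < ρ c ∧ G.Adj w c ∧ ¬ G.Adj w b ∧ w ≠ b

/-- The last neighbour of `v` before `u` comes after every earlier neighbour of `u`, so it is not
adjacent to `u`. -/
theorem isWitness_of_prevRank_lt {u v : V} (huv : ρ u < ρ v)
    (hadj : G.Adj u v) (h : prevRank (G := G) ρ u (ρ u) < prevRank (G := G) ρ v (ρ u)) :
    ∃ w, ρ w + 1 = prevRank (G := G) ρ v (ρ u) ∧ IsWitness G ρ u v w := by
  rcases prevRank_cases (G := G) (ρ := ρ) v (ρ u) with ⟨h1, h2⟩ | ⟨a, h1, h2, h3, h4⟩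
  · omega
  · refine ⟨a, h3.symm, hadj, huv, h1, fun hau => ?_, fun hau => by subst hau; omega⟩
    rcases prevRank_cases (G := G) (ρ := ρ) u (ρ u) with ⟨h5, h6⟩ | ⟨a', h5, h6, h7, h8⟩
    · exact h6 a hau h2
    · have := h8 a hau h2
      omega

/-- Now the last neighbour of `u` before `u` is not adjacent to `v`. It becomes the earlier end of
the witnessing edge, and `v` the extra neighbour. -/
theorem isWitness_of_lt_prevRank {u v : V} (huv : ρ u < ρ v)
    (hadj : G.Adj u v) (h : prevRank (G := G) ρ v (ρ u) < prevRank (G := G) ρ u (ρ u)) :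
    ∃ w, ρ w + 1 = prevRank (G := G) ρ u (ρ u) ∧ IsWitness G ρ w u v := by
  rcases prevRank_cases (G := G) (ρ := ρ) u (ρ u) with ⟨h1, h2⟩ | ⟨a, h1, h2, h3, h4⟩
  · omega
  · refine ⟨a, h3.symm, h1, h2, hadj.symm, fun hau => ?_, fun hau => by subst hau; omega⟩
    rcases prevRank_cases (G := G) (ρ := ρ) v (ρ u) with ⟨h5, h6⟩ | ⟨a', h5, h6, h7, h8⟩
    · exact h6 a hau.symm h2
    · have := h8 a hau.symm h2
      omega

end Graph

end ExtMem

namespace ExtMem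

/-! ### Words that store four digits -/

/-- The base of the digits. -/
def base (n m : ℕ) : ℕ := (n + m + 2) * (n + m + 2) * (n + m + 2)

/-- Reducing the digits bounds every word by R⁴, whatever the arguments, as `exec_stage` requires.
For digits below `R` the order of words is lexicographic, so sorting words sorts records. -/
def word (R a b c d : ℕ) : ℕ := ((a % R * R + b % R) * R + c % R) * R + d % R

def dg0 (R x : ℕ) : ℕ := x / R / R / R

def dg1 (R x : ℕ) : ℕ := x / R / R % R

def dg2 (R x : ℕ) : ℕ := x / R % R

def dg3 (R x : ℕ) : ℕ := x % R

/-- The largest word, which marks an unused entry. -/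
def dummy (R : ℕ) : ℕ := word R (R - 1) 0 0 0

section Primrec

variable {α : Type*} [Primcodable α]

@[fun_prop] theorem primrec_base {f g : α → ℕ} (hf : Primrec f) (hg : Primrec g) :
    Primrec fun a => base (f a) (g a) := by unfold base; fun_prop

@[fun_prop] theorem primrec_word {R a b c d : α → ℕ} (hR : Primrec R) (ha : Primrec a)
    (hb : Primrec b) (hc : Primrec c) (hd : Primrec d) :
    Primrec fun x => word (R x) (a x) (b x) (c x) (d x) := by unfold word; fun_prop

@[fun_prop] theorem primrec_dg0 {R x : α → ℕ} (hR : Primrec R) (hx : Primrec x) :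
    Primrec fun a => dg0 (R a) (x a) := by unfold dg0; fun_prop

@[fun_prop] theorem primrec_dg1 {R x : α → ℕ} (hR : Primrec R) (hx : Primrec x) :
    Primrec fun a => dg1 (R a) (x a) := by unfold dg1; fun_prop

@[fun_prop] theorem primrec_dg2 {R x : α → ℕ} (hR : Primrec R) (hx : Primrec x) :
    Primrec fun a => dg2 (R a) (x a) := by unfold dg2; fun_prop

@[fun_prop] theorem primrec_dg3 {R x : α → ℕ} (hR : Primrec R) (hx : Primrec x) :
    Primrec fun a => dg3 (R a) (x a) := by unfold dg3; fun_prop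

@[fun_prop] theorem primrec_dummy {R : α → ℕ} (hR : Primrec R) :
    Primrec fun a => dummy (R a) := by unfold dummy; fun_prop

end Primrec

section Word

variable {R : ℕ}

theorem mul_add_mod_div (x y : ℕ) (hR : 0 < R) : (x * R + y % R) / R = x := by
  rw [add_comm, Nat.add_mul_div_right _ _ hR, Nat.div_eq_of_lt (Nat.mod_lt _ hR), zero_add]

theorem mul_add_mod_mod (x y : ℕ) : (x * R + y % R) % R = y % R := by
  rw [add_comm, Nat.add_mul_mod_self_right, Nat.mod_mod]

theorem dg0_word {a b c d : ℕ} (ha : a < R) : dg0 R (word R a b c d) = a := by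
  have hR : 0 < R := by omega
  simp only [dg0, word, mul_add_mod_div _ _ hR, Nat.mod_eq_of_lt ha]

theorem dg1_word {a b c d : ℕ} (hb : b < R) : dg1 R (word R a b c d) = b := by
  have hR : 0 < R := by omega
  rw [dg1, word, mul_add_mod_div _ _ hR, mul_add_mod_div _ _ hR, mul_add_mod_mod, Nat.mod_eq_of_lt hb]

theorem dg2_word {a b c d : ℕ} (hc : c < R) : dg2 R (word R a b c d) = c := by
  have hR : 0 < R := by omega
  rw [dg2, word, mul_add_mod_div _ _ hR, mul_add_mod_mod, Nat.mod_eq_of_lt hc]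

theorem dg3_word {a b c d : ℕ} (hd : d < R) : dg3 R (word R a b c d) = d := by
  rw [dg3, word, mul_add_mod_mod, Nat.mod_eq_of_lt hd]

theorem mul_add_lt_mul_add {x y x' y' : ℕ} (hy : y < R) (hy' : y' < R) :
    x * R + y < x' * R + y' ↔ x < x' ∨ x = x' ∧ y < y' := by
  rcases lt_trichotomy x x' with h | rfl | h
  · have := Nat.mul_le_mul_right R h
    rw [Nat.succ_mul] at this
    exact iff_of_true (by omega) (.inl h)
  · simp
  · have := Nat.mul_le_mul_right R h
    rw [Nat.succ_mul] at this
    exact iff_of_false (by omega) (by omega)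

theorem mul_add_inj {x y x' y' : ℕ} (hy : y < R) (hy' : y' < R) :
    x * R + y = x' * R + y' ↔ x = x' ∧ y = y' := by
  constructor
  · intro h
    have h1 := (mul_add_lt_mul_add (x := x) (x' := x') hy hy').not.1 (by omega)
    have h2 := (mul_add_lt_mul_add (x := x') (x' := x) hy' hy).not.1 (by omega)
    omega
  · rintro ⟨rfl, rfl⟩; rfl

theorem word_lt_word {a b c d a' b' c' d' : ℕ} (ha : a < R) (hb : b < R) (hc : c < R) (hd : d < R)
    (ha' : a' < R) (hb' : b' < R) (hc' : c' < R) (hd' : d' < R) :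
    word R a b c d < word R a' b' c' d' ↔
      a < a' ∨ a = a' ∧ (b < b' ∨ b = b' ∧ (c < c' ∨ c = c' ∧ d < d')) := by
  simp only [word, Nat.mod_eq_of_lt, ha, hb, hc, hd, ha', hb', hc', hd',
    mul_add_lt_mul_add, mul_add_inj]
  omega

theorem word_lt (hR : 0 < R) (a b c d : ℕ) : word R a b c d < R * R * R * R := by
  have key : ∀ x y N, x < N → x * R + y % R < N * R := by
    intro x y N h
    have := Nat.mod_lt y hR
    have := Nat.mul_le_mul_right R h
    rw [Nat.succ_mul] at this
    omega
  exact key _ _ _ (key _ _ _ (key _ _ _ (Nat.mod_lt _ hR)))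

theorem dg0_dummy (hR : 0 < R) : dg0 R (dummy R) = R - 1 := dg0_word (by omega)

theorem dg0_zero : dg0 R 0 = 0 := by simp [dg0]

end Word

/-! ### Passes over sorted lists -/

theorem lastM_spec (p : ℕ → Bool) {l : List ℕ} (hl : l.Pairwise (· ≤ ·)) :
    (∀ m ∈ l, p m = true → m ≤ lastM p 0 l) ∧
      ((lastM p 0 l ∈ l ∧ p (lastM p 0 l) = true) ∨
        (lastM p 0 l = 0 ∧ ∀ m ∈ l, p m = false)) := by
  induction l using List.reverseRecOn with
  | nil => simp [lastM]
  | append_singleton l x ih =>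
    obtain ⟨h1, -, h3⟩ := List.pairwise_append.1 hl
    have ih := ih h1
    have hlast : lastM p 0 (l ++ [x]) = bif p x then x else lastM p 0 l := by
      simp [lastM]
    rw [hlast]
    cases hp : p x with
    | true =>
      refine ⟨?_, .inl ⟨by simp, hp⟩⟩
      intro m hm _
      rcases List.mem_append.1 hm with hm | hm
      · exact h3 m hm x (by simp)
      · exact (List.mem_singleton.1 hm).le
    | false =>
      refine ⟨?_, ?_⟩
      · intro m hm hpm
        rcases List.mem_append.1 hm with hm | hm
        · exact ih.1 m hm hpm
        · rw [List.mem_singleton.1 hm, hp] at hpm; exact absurd hpm (by simp)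
      · rcases ih.2 with ⟨h4, h5⟩ | ⟨h4, h5⟩
        · exact .inl ⟨List.mem_append_left _ h4, h5⟩
        · refine .inr ⟨h4, ?_⟩
          intro m hm
          rcases List.mem_append.1 hm with hm | hm
          · exact h5 m hm
          · rw [List.mem_singleton.1 hm, hp]

/-- The largest element of `l` below `x` with property `p`, and `0` if there is none. -/
def maxBelow (p : ℕ → Bool) (l : List ℕ) (x : ℕ) : ℕ := lastM p 0 (l.filter fun y => decide (y < x))

theorem maxBelow_spec (p : ℕ → Bool) {l : List ℕ} (hl : l.Pairwise (· ≤ ·)) (x : ℕ) :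
    (∀ m ∈ l, p m = true → m < x → m ≤ maxBelow p l x) ∧
      ((maxBelow p l x ∈ l ∧ p (maxBelow p l x) = true ∧ maxBelow p l x < x) ∨
        (maxBelow p l x = 0 ∧ ∀ m ∈ l, p m = true → ¬ m < x)) := by
  obtain ⟨h1, h2⟩ := lastM_spec p (hl.filter fun y => decide (y < x))
  refine ⟨fun m hm hp hx => h1 m (by simp [hm, hx]) hp, ?_⟩
  rcases h2 with ⟨h2, h3⟩ | ⟨h2, h3⟩
  · simp only [List.mem_filter, decide_eq_true_eq] at h2
    exact .inl ⟨h2.1, h3, h2.2⟩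
  · refine .inr ⟨h2, fun m hm hp hx => ?_⟩
    have := h3 m (by simp [hm, hx])
    rw [hp] at this
    exact absurd this (by simp)

theorem maxBelow_eq {p : ℕ → Bool} {l : List ℕ} (hl : l.Pairwise (· ≤ ·)) {x m : ℕ} (hm : m ∈ l)
    (hp : p m = true) (hx : m < x) (h : ∀ m' ∈ l, p m' = true → m' < x → m' ≤ m) :
    maxBelow p l x = m := by
  obtain ⟨h1, h2⟩ := maxBelow_spec p hl x
  rcases h2 with ⟨h2, h3, h4⟩ | ⟨h2, h3⟩
  · exact le_antisymm (h _ h2 h3 h4) (h1 m hm hp hx)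
  · exact absurd hx (h3 m hm hp)

/-- In a sorted list the words before position `j` are those below `l[j]`, and possibly copies of
`l[j]`; the second alternative accounts for such copies. -/
theorem lastM_take {p : ℕ → Bool} {l : List ℕ} (hl : l.Pairwise (· ≤ ·)) {j : ℕ}
    (hj : j < l.length) :
    lastM p 0 (l.take j) = maxBelow p l l[j] ∨
      lastM p 0 (l.take j) = l[j] ∧ p l[j] = true := by
  have hle : ∀ m ∈ l.take j, m ≤ l[j] := by
    intro m hm
    obtain ⟨i, hi, rfl⟩ := List.mem_iff_getElem.1 hm
    simp only [List.length_take] at hi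
    rw [List.getElem_take]
    exact List.pairwise_iff_getElem.1 hl _ _ _ _ (by omega)
  have hmem : ∀ m ∈ l, m < l[j] → m ∈ l.take j := by
    intro m hm hlt
    obtain ⟨i, hi, rfl⟩ := List.mem_iff_getElem.1 hm
    have hij : i < j := by
      by_contra hij
      rcases (not_lt.1 hij).eq_or_lt with h | h
      · subst h; omega
      · have := List.pairwise_iff_getElem.1 hl _ _ hj hi h; omega
    exact List.mem_take_iff_getElem.2 ⟨i, by omega, rfl⟩
  obtain ⟨h1, h2⟩ := lastM_spec p (hl.sublist (List.take_sublist j l))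
  rcases h2 with ⟨h2, h3⟩ | ⟨h2, h3⟩
  · rcases (hle _ h2).eq_or_lt with h | h
    · exact .inr ⟨h, h ▸ h3⟩
    · exact .inl (maxBelow_eq hl (List.mem_of_mem_take h2) h3 h fun m' hm' hp' hlt =>
        h1 m' (hmem m' hm' hlt) hp').symm
  · left
    rw [h2]
    rcases (maxBelow_spec p hl l[j]).2 with ⟨h4, h5, h6⟩ | ⟨h4, -⟩
    · have := h3 _ (hmem _ h4 h6)
      rw [h5] at this
      exact absurd this (by simp)
    · exact h4.symm

theorem mem_passOut {p : ℕ → Bool} {f : ℕ → ℕ → ℕ} {l : List ℕ} (hl : l.Pairwise (· ≤ ·)) {y : ℕ}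
    (hy : y ∈ passOut p (fun _ => f) 0 0 l) :
    ∃ x ∈ l, y = f (maxBelow p l x) x ∨ (p x = true ∧ y = f x x) := by
  simp only [passOut, List.mem_map, List.mem_range] at hy
  obtain ⟨j, hj, rfl⟩ := hy
  rw [List.getD_eq_getElem _ _ hj]
  refine ⟨l[j], List.getElem_mem hj, ?_⟩
  rcases lastM_take (p := p) hl hj with h | ⟨h, h'⟩
  · exact .inl (by rw [h])
  · exact .inr ⟨h', by rw [h]⟩

/-- The first copy of `x` has no copy before it, so it is processed with the last word strictly
below it. -/
theorem passOut_mem {p : ℕ → Bool} {f : ℕ → ℕ → ℕ} {l : List ℕ} (hl : l.Pairwise (· ≤ ·)) {x : ℕ}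
    (hx : x ∈ l) : f (maxBelow p l x) x ∈ passOut p (fun _ => f) 0 0 l := by
  have hj := List.idxOf_lt_length_iff.2 hx
  have hget : l[l.idxOf x] = x := List.getElem_idxOf hj
  simp only [passOut, List.mem_map, List.mem_range]
  refine ⟨l.idxOf x, hj, ?_⟩
  rw [List.getD_eq_getElem _ _ hj, hget]
  rcases lastM_take (p := p) hl hj with h | ⟨h, h'⟩
  · rw [h, hget]
  · rw [hget] at h
    have hnot : x ∉ l.take (l.idxOf x) := fun hmem => by
      obtain ⟨i, hi, hix⟩ := List.mem_take_iff_getElem.1 hmem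
      have := List.not_of_lt_findIdx (p := (· == x)) (xs := l) (i := i)
        (lt_of_lt_of_le hi (min_le_left _ _))
      simp [hix] at this
    rcases lastM_mem p 0 (l.take (l.idxOf x)) with h0 | h0
    -- The initial carried word 0 may coincide with `x`; then nothing lies below `x` and the values
    -- agree.
    · have hx0 : x = 0 := h.symm.trans h0
      have : maxBelow p l x = 0 := by simp [maxBelow, hx0, lastM]
      rw [h0, this]
    · rw [h] at h0; exact absurd h0 hnot

theorem passOut_eq_map {p : ℕ → Bool} {f : ℕ → ℕ → ℕ} {l : List ℕ} (hl : l.Pairwise (· ≤ ·))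
    (hf : ∀ x ∈ l, p x = true → ∀ s, f s x = f 0 x) :
    passOut p (fun _ => f) 0 0 l = l.map fun x => f (maxBelow p l x) x := by
  refine List.ext_getElem (by simp [passOut]) fun j h1 h2 => ?_
  have hj : j < l.length := by simpa using h2
  simp only [passOut, List.getElem_map, List.getElem_range]
  rw [List.getD_eq_getElem _ _ hj]
  rcases lastM_take (p := p) hl hj with h | ⟨-, h⟩
  · rw [h]
  · rw [hf _ (List.getElem_mem hj) h, hf _ (List.getElem_mem hj) h (maxBelow _ _ _)]

end ExtMem

namespace ExtMem

/-! ### The passes of the algorithm -/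

/-- Position of vertex `u`, of degree `d`, in a non-increasing degree order. -/
def rankOf (n u d : ℕ) : ℕ := (n - d) * (n + 1) + u

/-- Is the word a key, i.e. a word that describes a vertex? -/
def isKey (R x : ℕ) : Bool := decide (dg1 R x = 0) && decide (dg0 R x < R - 1)

/-- Does the word describe a pair of adjacent vertices, of which the first one is ranked later? -/
def isBack (R x : ℕ) : Bool := decide (dg0 R x = 1) && decide (dg2 R x < dg1 R x)

/-- Turns the adjacency arrays into keys `(start, 0, vertex, degree)` and entries
`(position, 1, vertex, 0)`. -/
def splitFn (R n m i s x : ℕ) : ℕ :=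
  bif decide (i = 0) then dummy R else
  bif decide (i ≤ n) then word R s 0 (i - 1) (x - s) else
  bif decide (i ≤ n + 2 * m) then word R (i - n - 1) 1 x 0 else dummy R

/-- Gives each entry the rank of the vertex in whose list it stands. -/
def tailFn (R n s x : ℕ) : ℕ :=
  bif decide (dg0 R x < R - 1) then
    bif decide (dg1 R x = 0) then word R (dg2 R x) 0 (rankOf n (dg2 R x) (dg3 R x)) 0
    else word R (dg2 R x) 1 (rankOf n (dg2 R s) (dg3 R s)) 0
  else dummy R

/-- Replaces the other vertex of each entry by its rank. -/
def headFn (R s x : ℕ) : ℕ :=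
  bif decide (dg0 R x < R - 1) then
    bif decide (dg1 R x = 0) then word R 0 (dg2 R x) 0 0
    else word R 1 (dg2 R s) (dg2 R x) 0
  else dummy R

/-- For each pair of adjacent vertices, finds the last neighbour that precedes both of them. -/
def prevFn (R s x : ℕ) : ℕ :=
  bif decide (dg0 R x = 1) && !decide (s = x) then
    bif decide (dg2 R x < dg1 R x) then
      word R (dg2 R x) 1 (bif decide (dg0 R s = 1) && decide (dg1 R s = dg1 R x)
        then dg2 R s + 1 else 0) (dg1 R x)
    else word R (dg1 R x) 0 (bif decide (dg0 R s = 1) && decide (dg1 R s = dg1 R x)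
        then dg2 R s + 1 else 0) 0
  else dummy R

/-- Compares these neighbours for the two ends of each edge. -/
def witnessFn (R s x : ℕ) : ℕ :=
  bif decide (dg0 R x < R - 1) && !decide (dg1 R x = 0) then
    bif decide (dg2 R s < dg2 R x) then word R (dg0 R x) (dg3 R x) (dg2 R x - 1) 0 else
    bif decide (dg2 R x < dg2 R s) then word R (dg2 R s - 1) (dg0 R x) (dg3 R x) 0 else dummy R
  else dummy R

/-- The neighbours of the two vertices in `a`. -/
def starFn (R a x : ℕ) : ℕ :=
  bif decide (dg0 R x = 1) then
    bif decide (dg2 R x = dg1 R a) then word R (dg1 R x) 0 0 0 else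
    bif decide (dg2 R x = dg0 R a) then word R (dg1 R x) 1 0 0 else dummy R
  else dummy R

/-- The neighbours of the first vertex in `a` that are not neighbours of the second one. -/
def obstructFn (R a s x : ℕ) : ℕ :=
  bif decide (dg0 R x < R - 1) && !decide (dg1 R x = 0) then
    bif decide (dg0 R s = dg0 R x) || decide (dg0 R x = dg1 R a) then dummy R
    else word R (dg0 R x) (dg0 R a) (dg1 R a) (dg2 R a)
  else dummy R

section Primrec

variable {α : Type*} [Primcodable α] {R n m i s x a : α → ℕ}

@[fun_prop] theorem primrec_rankOf (h1 : Primrec n) (h2 : Primrec i) (h3 : Primrec x) :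
    Primrec fun v => rankOf (n v) (i v) (x v) := by unfold rankOf; fun_prop

@[fun_prop] theorem primrec_isKey (h1 : Primrec R) (h2 : Primrec x) :
    Primrec fun v => isKey (R v) (x v) := by unfold isKey; fun_prop

@[fun_prop] theorem primrec_isBack (h1 : Primrec R) (h2 : Primrec x) :
    Primrec fun v => isBack (R v) (x v) := by unfold isBack; fun_prop

@[fun_prop] theorem primrec_splitFn (h1 : Primrec R) (h2 : Primrec n) (h3 : Primrec m)
    (h4 : Primrec i) (h5 : Primrec s) (h6 : Primrec x) :
    Primrec fun v => splitFn (R v) (n v) (m v) (i v) (s v) (x v) := by unfold splitFn; fun_prop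

@[fun_prop] theorem primrec_tailFn (h1 : Primrec R) (h2 : Primrec n) (h5 : Primrec s)
    (h6 : Primrec x) : Primrec fun v => tailFn (R v) (n v) (s v) (x v) := by
  unfold tailFn; fun_prop

@[fun_prop] theorem primrec_headFn (h1 : Primrec R) (h5 : Primrec s)
    (h6 : Primrec x) : Primrec fun v => headFn (R v) (s v) (x v) := by
  unfold headFn; fun_prop

@[fun_prop] theorem primrec_prevFn (h1 : Primrec R) (h5 : Primrec s)
    (h6 : Primrec x) : Primrec fun v => prevFn (R v) (s v) (x v) := by
  unfold prevFn; fun_prop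

@[fun_prop] theorem primrec_witnessFn (h1 : Primrec R) (h5 : Primrec s)
    (h6 : Primrec x) : Primrec fun v => witnessFn (R v) (s v) (x v) := by
  unfold witnessFn; fun_prop

@[fun_prop] theorem primrec_starFn (h1 : Primrec R) (h5 : Primrec a)
    (h6 : Primrec x) : Primrec fun v => starFn (R v) (a v) (x v) := by
  unfold starFn; fun_prop

@[fun_prop] theorem primrec_obstructFn (h1 : Primrec R) (h4 : Primrec a) (h5 : Primrec s)
    (h6 : Primrec x) : Primrec fun v => obstructFn (R v) (a v) (s v) (x v) := by
  unfold obstructFn; fun_prop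

end Primrec

/-- The base of the digits, given the header `[n, m, aux]`. -/
def hdrBase (hdr : List ℕ) : ℕ := base (hdr.getD 0 0) (hdr.getD 1 0)

@[fun_prop] theorem primrec_hdrBase {α : Type*} [Primcodable α] {f : α → List ℕ}
    (hf : Primrec f) : Primrec fun a => hdrBase (f a) := by unfold hdrBase; fun_prop

def splitPass : PassFn where
  master _ _ := true
  fn hdr i s x := splitFn (hdrBase hdr) (hdr.getD 0 0) (hdr.getD 1 0) i s x
  primrec_master := by fun_prop
  primrec_fn := by fun_prop

def tailPass : PassFn where
  master hdr x := isKey (hdrBase hdr) x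
  fn hdr _ s x := tailFn (hdrBase hdr) (hdr.getD 0 0) s x
  primrec_master := by fun_prop
  primrec_fn := by fun_prop

def headPass : PassFn where
  master hdr x := isKey (hdrBase hdr) x
  fn hdr _ s x := headFn (hdrBase hdr) s x
  primrec_master := by fun_prop
  primrec_fn := by fun_prop

def prevPass : PassFn where
  master hdr x := isBack (hdrBase hdr) x
  fn hdr _ s x := prevFn (hdrBase hdr) s x
  primrec_master := by fun_prop
  primrec_fn := by fun_prop

def witnessPass : PassFn where
  master hdr x := isKey (hdrBase hdr) x
  fn hdr _ s x := witnessFn (hdrBase hdr) s x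
  primrec_master := by fun_prop
  primrec_fn := by fun_prop

def starPass : PassFn where
  master _ _ := false
  fn hdr _ _ x := starFn (hdrBase hdr) (hdr.getD 2 0) x
  primrec_master := by fun_prop
  primrec_fn := by fun_prop

def obstructPass : PassFn where
  master hdr x := isKey (hdrBase hdr) x
  fn hdr _ s x := obstructFn (hdrBase hdr) (hdr.getD 2 0) s x
  primrec_master := by fun_prop
  primrec_fn := by fun_prop

/-! ### Attaching keys to entries -/

variable {n : ℕ}

/-- The list `A` consists of one key `X i` for each vertex `i`, entries `E u v` for the pairs of adjacent
vertices, and dummies `D`. -/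
def KeyEntries (G : SimpleGraph (Fin n)) (D : ℕ) (X : Fin n → ℕ) (E : Fin n → Fin n → ℕ → Prop)
    (A : List ℕ) : Prop :=
  ∃ Y, A.Perm (List.ofFn X ++ Y) ∧ (∀ y ∈ Y, y = D ∨ ∃ u v, G.Adj u v ∧ E u v y) ∧
    ∀ u v, G.Adj u v → ∃ y ∈ Y, E u v y

theorem KeyEntries.perm {G : SimpleGraph (Fin n)} {D : ℕ} {X : Fin n → ℕ}
    {E : Fin n → Fin n → ℕ → Prop} {A A' : List ℕ} (h : KeyEntries G D X E A) (hA : A'.Perm A) :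
    KeyEntries G D X E A' := by
  obtain ⟨Y, h1, h2⟩ := h
  exact ⟨Y, hA.trans h1, h2⟩

/-- The effect of a pass that attaches to each entry the key of a vertex. -/
theorem KeyEntries.passOut {G : SimpleGraph (Fin n)} {D : ℕ} {X X' : Fin n → ℕ}
    {E E' : Fin n → Fin n → ℕ → Prop} {A : List ℕ} (h : KeyEntries G D X E A)
    (hA : A.Pairwise (· ≤ ·)) {p : ℕ → Bool} {f : ℕ → ℕ → ℕ}
    (hpX : ∀ i, p (X i) = true) (hpD : p D = false)
    (hpE : ∀ u v y, G.Adj u v → E u v y → p y = false)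
    (hX : ∀ s i, f s (X i) = X' i) (hD : ∀ s, f s D = D)
    (hE : ∀ u v y, G.Adj u v → E u v y →
      ∃ i, X i < y ∧ (∀ j, X j < y → X j ≤ X i) ∧ E' u v (f (X i) y)) :
    KeyEntries G D X' E' (ExtMem.passOut p (fun _ => f) 0 0 A) := by
  obtain ⟨Y, h1, h2, h3⟩ := h
  have hmem : ∀ x, x ∈ A ↔ (∃ i, X i = x) ∨ x ∈ Y := fun x => by
    rw [h1.mem_iff, List.mem_append, List.mem_ofFn]
  have hkey : ∀ x ∈ A, p x = true → ∃ i, x = X i := by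
    intro x hx hp
    rcases (hmem x).1 hx with ⟨i, rfl⟩ | hx
    · exact ⟨i, rfl⟩
    · rcases h2 x hx with rfl | ⟨u, v, huv, hE⟩
      · rw [hpD] at hp; exact absurd hp (by simp)
      · rw [hpE u v x huv hE] at hp; exact absurd hp (by simp)
  have hent : ∀ u v y, G.Adj u v → E u v y → E' u v (f (maxBelow p A y) y) := by
    intro u v y huv hy
    obtain ⟨i, hi, hmax, hE'⟩ := hE u v y huv hy
    rwa [maxBelow_eq hA ((hmem _).2 (.inl ⟨i, rfl⟩)) (hpX i) hi fun m hm hp hlt => by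
      obtain ⟨j, rfl⟩ := hkey m hm hp
      exact hmax j hlt]
  have hout : ExtMem.passOut p (fun _ => f) 0 0 A = A.map fun x => f (maxBelow p A x) x := by
    have : ∀ x ∈ A, p x = true → ∀ s, f s x = f 0 x := by
      intro x hx hp s
      obtain ⟨i, rfl⟩ := hkey x hx hp
      rw [hX, hX]
    exact passOut_eq_map hA this
  refine ⟨Y.map fun x => f (maxBelow p A x) x, ?_, ?_, ?_⟩
  · rw [hout]
    refine (h1.map _).trans (.of_eq ?_)
    rw [List.map_append, List.map_ofFn]
    congr 2
    funext i
    exact hX _ i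
  · intro y hy
    obtain ⟨x, hx, rfl⟩ := List.mem_map.1 hy
    rcases h2 x hx with rfl | ⟨u, v, huv, hE⟩
    · exact .inl (hD _)
    · exact .inr ⟨u, v, huv, hent u v x huv hE⟩
  · intro u v huv
    obtain ⟨y, hy, hE⟩ := h3 u v huv
    exact ⟨_, List.mem_map_of_mem hy, hent u v y huv hE⟩

end ExtMem

namespace ExtMem

/-! ### Positions in the adjacency arrays -/

theorem getElem?_flatten_add {α : Type*} (ls : List (List α)) {u : ℕ} (hu : u < ls.length) {k : ℕ}
    (hk : k < ls[u].length) : ls.flatten[(ls.take u).flatten.length + k]? = some ls[u][k] := by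
  conv_lhs => rw [← List.take_append_drop u ls, List.drop_eq_getElem_cons hu]
  rw [List.take_append_of_le_length (by simp; omega), List.take_take, min_self,
    List.flatten_append, List.flatten_cons, List.getElem?_append_right (by omega),
    Nat.add_sub_cancel_left, List.getElem?_append_left hk, List.getElem?_eq_getElem hk]

theorem exists_eq_flatten_add {α : Type*} (ls : List (List α)) {j : ℕ} (hj : j < ls.flatten.length) :
    ∃ u, ∃ hu : u < ls.length, ∃ k < ls[u].length, j = (ls.take u).flatten.length + k := by
  induction ls generalizing j with
  | nil => simp at hj
  | cons l ls ih =>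
    by_cases h : j < l.length
    · exact ⟨0, by simp, j, h, by simp⟩
    · rw [List.flatten_cons, List.length_append] at hj
      obtain ⟨u, hu, k, hk, hjk⟩ := ih (j := j - l.length) (by omega)
      refine ⟨u + 1, by simpa using hu, k, by simpa using hk, ?_⟩
      rw [List.take_succ_cons, List.flatten_cons, List.length_append]
      omega

variable {n : ℕ}

/-- The position at which the list of vertex `i` starts. -/
def startPos (adj : Fin n → List (Fin n)) (i : ℕ) : ℕ :=
  ((List.ofFn adj).take i).flatten.length

theorem startPos_succ (adj : Fin n → List (Fin n)) (u : Fin n) :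
    startPos adj (u + 1) = startPos adj u + (adj u).length := by
  simp [startPos, List.take_add_one]

theorem startPos_mono (adj : Fin n → List (Fin n)) {i j : ℕ} (h : i ≤ j) :
    startPos adj i ≤ startPos adj j := by
  obtain ⟨k, rfl⟩ := Nat.exists_eq_add_of_le h
  rw [startPos, startPos, List.take_add, List.flatten_append, List.length_append]
  omega

theorem startPos_le (adj : Fin n → List (Fin n)) (i : ℕ) :
    startPos adj i ≤ (List.ofFn adj).flatten.length := by
  conv_rhs => rw [← List.take_append_drop i (List.ofFn adj), List.flatten_append, List.length_append]
  exact Nat.le_add_right _ _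

section

variable {G : SimpleGraph (Fin n)} [DecidableRel G.Adj] {adj : Fin n → List (Fin n)}

theorem IsAdjLists.length_eq (h : IsAdjLists G adj) (u : Fin n) : (adj u).length = G.degree u := by
  rw [← List.toFinset_card_of_nodup (h u).1, ← SimpleGraph.card_neighborFinset_eq_degree]
  congr 1
  ext w
  rw [List.mem_toFinset, (h u).2, SimpleGraph.mem_neighborFinset]

theorem IsAdjLists.length_flatten (h : IsAdjLists G adj) :
    (List.ofFn adj).flatten.length = 2 * G.edgeFinset.card := by
  rw [List.length_flatten, List.map_ofFn, List.sum_ofFn, ← SimpleGraph.sum_degrees_eq_twice_card_edges]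
  exact Finset.sum_congr rfl fun u _ => h.length_eq u

end

theorem getD_adjRow_of_le (adj : Fin n → List (Fin n)) {i : ℕ} (hi : i ≤ n) :
    (adjRow adj).getD i 0 = startPos adj i := by
  rw [adjRow, List.getD_append _ _ _ _ (by simp; omega), List.getD_eq_getElem _ _ (by simp; omega)]
  simp [startPos]

theorem getD_adjRow_add (adj : Fin n → List (Fin n)) (j : ℕ) :
    (adjRow adj).getD (n + 1 + j) 0 = ((List.ofFn adj).flatten.map Fin.val).getD j 0 := by
  rw [adjRow, List.getD_append_right _ _ _ _ (by simp)]
  simp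

theorem getD_adjRow_lt (adj : Fin n → List (Fin n)) {W : ℕ} (h1 : n < W)
    (h2 : (List.ofFn adj).flatten.length < W) (i : ℕ) : (adjRow adj).getD i 0 < W := by
  rcases Nat.lt_or_ge n i with h | h
  · obtain ⟨j, rfl⟩ := Nat.exists_eq_add_of_le h
    rw [Nat.succ_eq_add_one, getD_adjRow_add, List.getD_eq_getElem?_getD, List.getElem?_map]
    cases (List.ofFn adj).flatten[j]? with
    | none => simp; omega
    | some v => simp; omega
  · rw [getD_adjRow_of_le _ h]
    exact (startPos_le adj i).trans_lt h2

/-! ### The first three stages -/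

/-- The first bound lets list positions and degrees be digits, the second one ranks; both leave the
leading digit `R - 1` to dummies. -/
theorem base_bound (n m : ℕ) : n + 2 * m + 2 < base n m ∧ n * (n + 1) + n + 2 < base n m := by
  have h : base n m = (n + m + 2) * ((n + m + 2) * (n + m + 2)) := Nat.mul_assoc _ _ _
  have h1 : 2 * ((n + m + 2) * (n + m + 2)) ≤ base n m := h ▸ Nat.mul_le_mul_right _ (by omega)
  constructor
  · nlinarith
  · nlinarith

variable (G : SimpleGraph (Fin n)) [DecidableRel G.Adj]

/-- The rank of a vertex in the order that the algorithm uses. -/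
def vRank (u : Fin n) : ℕ := rankOf n u (G.degree u)

/-- Degrees are below `n`, so ranks are positive; hence the initial carried word 0 and the zero
digits of a dummy are never mistaken for a vertex. -/
theorem vRank_bounds (u : Fin n) : n < vRank G u ∧ vRank G u ≤ n * (n + 1) + n := by
  have h : G.degree u < n := by simpa using G.degree_lt_card_verts u
  have h1 : 1 * (n + 1) ≤ (n - G.degree u) * (n + 1) := Nat.mul_le_mul_right _ (by omega)
  have h2 : (n - G.degree u) * (n + 1) ≤ n * (n + 1) := Nat.mul_le_mul_right _ (by omega)
  unfold vRank rankOf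
  omega

theorem vRank_mod (u : Fin n) : vRank G u % (n + 1) = u := by
  rw [vRank, rankOf, Nat.mul_add_mod', Nat.mod_eq_of_lt (by omega)]

theorem vRank_injective : Function.Injective (vRank G) := fun u v h => by
  have := vRank_mod G v
  rw [← h, vRank_mod] at this
  exact Fin.ext this

theorem degree_le_of_vRank_lt {u v : Fin n} (h : vRank G u < vRank G v) :
    G.degree v ≤ G.degree u := by
  by_contra! hlt
  have hv : G.degree v < n := by simpa using G.degree_lt_card_verts v
  have h1 : (n - G.degree v + 1) * (n + 1) ≤ (n - G.degree u) * (n + 1) :=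
    Nat.mul_le_mul_right _ (by omega)
  rw [Nat.succ_mul] at h1
  unfold vRank rankOf at h
  omega

variable {G} {adj : Fin n → List (Fin n)} {m R : ℕ}

/-- Every word is carried, so at index `i + 1` the pass sees two consecutive starting positions,
whose difference is the degree of vertex `i`. The `r` words after them contain the lists and
padding, which becomes dummies. -/
theorem keyEntries_split (hadj : IsAdjLists G adj) (hm : G.edgeFinset.card = m)
    {r : ℕ} (hr : 2 * m ≤ r) :
    KeyEntries G (dummy R) (fun i => word R (startPos adj i) 0 i (G.degree i))
      (fun u v y => ∃ p, startPos adj u ≤ p ∧ p < startPos adj (u + 1) ∧ y = word R p 1 v 0)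
      (passOut (fun _ => true) (splitFn R n m) 0 0
        (region (fun x => (adjRow adj).getD x 0) 0 (1 + n + r))) := by
  have hlen := hadj.length_flatten
  rw [hm] at hlen
  set l := region (fun x => (adjRow adj).getD x 0) 0 (1 + n + r) with hl
  have hget : ∀ i < 1 + n + r, l.getD i 0 = (adjRow adj).getD i 0 := by
    intro i hi
    rw [hl, List.getD_eq_getElem _ _ (by simpa using hi)]
    simp [region]
  set g : ℕ → ℕ := fun i =>
    splitFn R n m (0 + i) (lastM (fun _ => true) 0 (l.take i)) (l.getD i 0) with hg
  have hout : passOut (fun _ => true) (splitFn R n m) 0 0 l =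
      dummy R :: ((List.range n).map (fun i => g (1 + i)) ++
        (List.range r).map fun j => g (1 + n + j)) := by
    have h1 : passOut (fun _ => true) (splitFn R n m) 0 0 l = (List.range (1 + n + r)).map g := by
      rw [passOut, hl, length_region]
    rw [h1, List.range_add, List.range_add, List.map_append, List.map_append, List.map_map,
      List.map_map, List.append_assoc]
    have h2 : g 0 = dummy R := by simp [hg, splitFn]
    simp [h2, Function.comp_def]
  have hkey : (List.range n).map (fun i => g (1 + i)) =
      List.ofFn fun i : Fin n => word R (startPos adj i) 0 i (G.degree i) := by
    refine List.ext_getElem (by simp) fun i h1 h2 => ?_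
    have hi : i < n := by simpa using h1
    have h3 : lastM (fun _ => true) 0 (l.take (1 + i)) = startPos adj i := by
      rw [← getD_adjRow_of_le adj hi.le, ← hget i (by omega), add_comm, List.take_add_one,
        lastM_append, List.getElem?_eq_getElem (by simp [hl]; omega)]
      simp [lastM, List.getD_eq_getElem?_getD, List.getElem?_eq_getElem (l := l) (i := i) (by simp [hl]; omega)]
    have h4 : l.getD (1 + i) 0 - startPos adj i = G.degree ⟨i, hi⟩ := by
      have := startPos_succ adj ⟨i, hi⟩
      rw [hadj.length_eq] at this
      rw [hget _ (by omega), getD_adjRow_of_le _ (by omega), add_comm, this]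
      simp
    simp only [List.getElem_map, List.getElem_range, List.getElem_ofFn, hg, h3]
    simp only [splitFn, zero_add, h4, Nat.add_sub_cancel_left]
    simp [show 1 + i ≤ n by omega]
  have hent : ∀ u k (hk : k < (adj u).length),
      startPos adj u + k < 2 * m ∧
      g (1 + n + (startPos adj u + k)) = word R (startPos adj u + k) 1 ((adj u)[k] : Fin n) 0 := by
    intro u k hk
    have hpos : startPos adj u + k < 2 * m := by
      have h1 := startPos_succ adj u
      have h2 := startPos_le adj (u + 1)
      omega
    refine ⟨hpos, ?_⟩
    have h1 : l.getD (1 + n + (startPos adj u + k)) 0 = ((adj u)[k] : Fin n) := by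
      have h2 := getElem?_flatten_add (List.ofFn adj) (u := u) (by simp) (k := k) (by simpa using hk)
      rw [hget _ (by omega), add_comm 1 n, getD_adjRow_add, List.getD_eq_getElem?_getD,
        List.getElem?_map, startPos, h2]
      simp
    simp only [hg, h1]
    simp only [splitFn, zero_add]
    simp [show ¬ (1 + n + (startPos adj u + k) ≤ n) by omega,
      show 1 + n + (startPos adj u + k) ≤ n + 2 * m by omega,
      show 1 + n + (startPos adj u + k) - n - 1 = startPos adj u + k by omega]
  refine ⟨dummy R :: (List.range r).map fun j => g (1 + n + j), ?_, ?_, ?_⟩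
  · rw [hout, hkey]
    exact List.perm_middle.symm
  · intro y hy
    rcases List.mem_cons.1 hy with rfl | hy
    · exact .inl rfl
    obtain ⟨j, hj, rfl⟩ := List.mem_map.1 hy
    by_cases hj2 : j < 2 * m
    · obtain ⟨u, hu, k, hk, rfl⟩ := exists_eq_flatten_add (List.ofFn adj) (hlen ▸ hj2)
      rw [List.length_ofFn] at hu
      rw [List.getElem_ofFn] at hk
      have h1 := hent ⟨u, hu⟩ k hk
      refine .inr ⟨⟨u, hu⟩, (adj ⟨u, hu⟩)[k], ((hadj _).2 _).1 (List.getElem_mem hk),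
        startPos adj u + k, by simp, ?_, h1.2⟩
      rw [startPos_succ adj ⟨u, hu⟩]
      simpa using hk
    · left
      simp [hg, splitFn, show ¬ (1 + n + j ≤ n) by omega, show ¬ (1 + n + j ≤ n + 2 * m) by omega]
  · intro u v huv
    obtain ⟨k, hk, hv⟩ := List.mem_iff_getElem.1 (((hadj u).2 v).2 huv)
    have h1 := hent u k hk
    rw [hv] at h1
    refine ⟨_, List.mem_cons_of_mem _ (List.mem_map.2 ⟨_, List.mem_range.2 (by omega), rfl⟩),
      startPos adj u + k, by omega, ?_, h1.2⟩
    rw [startPos_succ]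
    omega

theorem dummy_not_lt (hR : base n m = R) : ¬ dg0 R (dummy R) < R - 1 := by
  have := base_bound n m
  rw [dg0_dummy (by omega)]; omega

/-- An entry at position `p` belongs to the last vertex whose list starts at or before `p`. Vertices
with empty lists share a starting position with the next one; the third digit, the vertex number,
puts the right key last. -/
theorem keyEntries_tail (hadj : IsAdjLists G adj) (hm : G.edgeFinset.card = m) (hR : base n m = R)
    {A : List ℕ} (hA : A.Pairwise (· ≤ ·))
    (h : KeyEntries G (dummy R) (fun i => word R (startPos adj i) 0 i (G.degree i))
      (fun u v y => ∃ p, startPos adj u ≤ p ∧ p < startPos adj (u + 1) ∧ y = word R p 1 v 0) A) :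
    KeyEntries G (dummy R) (fun i => word R i 0 (vRank G i) 0)
      (fun u v y => y = word R v 1 (vRank G u) 0)
      (passOut (isKey R) (fun _ => tailFn R n) 0 0 A) := by
  obtain ⟨hb1, hb2⟩ := hR ▸ base_bound n m
  have hstart : ∀ i, startPos adj i ≤ 2 * m := fun i => hm ▸ hadj.length_flatten ▸ startPos_le adj i
  have hdeg : ∀ u : Fin n, G.degree u < R := fun u => by
    have : G.degree u < n := by simpa using G.degree_lt_card_verts u
    omega
  have hfin : ∀ u : Fin n, (u : ℕ) < R := fun u => by omega
  have hs : ∀ i, startPos adj i < R - 1 := fun i => by have := hstart i; omega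
  have hs' : ∀ i, startPos adj i < R := fun i => by have := hstart i; omega
  have h0 : 0 < R := by omega
  have h1 : 1 < R := by omega
  refine h.passOut hA ?_ ?_ ?_ ?_ ?_ ?_
  · intro i
    simp [isKey, dg0_word, dg1_word, hs, hs', h0]
  · simp only [isKey, dummy_not_lt hR, decide_false, Bool.and_false]
  · rintro u v y huv ⟨p, hp1, hp2, rfl⟩
    simp [isKey, dg1_word, h1]
  · intro s i
    simp [tailFn, dg0_word, dg1_word, dg2_word, dg3_word, hs, hs', h0, hfin, hdeg, vRank]
  · intro s
    simp only [tailFn, dummy_not_lt hR, decide_false, cond_false]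
  · rintro u v y huv ⟨p, hp1, hp2, rfl⟩
    have hp : p < R - 1 := hp2.trans (hs _)
    have hp' : p < R := by omega
    refine ⟨u, ?_, ?_, ?_⟩
    · rw [word_lt_word (hs' _) h0 (hfin _) (hdeg _) hp' h1 (hfin _) h0]
      omega
    · intro j hj
      rw [word_lt_word (hs' _) h0 (hfin _) (hdeg _) hp' h1 (hfin _) h0] at hj
      -- Lists of later vertices start at `startPos adj (u + 1)` or beyond, hence after `p`.
      have hju : (j : ℕ) ≤ u := by
        by_contra! hlt
        have := startPos_mono adj (i := u + 1) (j := j) hlt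
        omega
      have h2 := startPos_mono adj hju
      rcases hju.eq_or_lt with h3 | h3
      · rw [Fin.ext h3]
      · refine (not_lt.1 ?_)
        rw [word_lt_word (hs' _) h0 (hfin _) (hdeg _) (hs' _) h0 (hfin _) (hdeg _)]
        omega
    · simp [tailFn, dg0_word, dg1_word, dg2_word, dg3_word, hp, hp', h1, hfin, hdeg, vRank]

/-- Entries are now sorted by their other vertex `v` and directly follow the key of `v`. In the
result keys have leading digit 0 and arcs 1, so the vertices come first in order of rank. -/
theorem keyEntries_head (hR : base n m = R) {A : List ℕ} (hA : A.Pairwise (· ≤ ·))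
    (h : KeyEntries G (dummy R) (fun i => word R i 0 (vRank G i) 0)
      (fun u v y => y = word R v 1 (vRank G u) 0) A) :
    KeyEntries G (dummy R) (fun i => word R 0 (vRank G i) 0 0)
      (fun u v y => y = word R 1 (vRank G v) (vRank G u) 0)
      (passOut (isKey R) (fun _ => headFn R) 0 0 A) := by
  obtain ⟨hb1, hb2⟩ := hR ▸ base_bound n m
  have hfin : ∀ u : Fin n, (u : ℕ) < R := fun u => by omega
  have hfin' : ∀ u : Fin n, (u : ℕ) < R - 1 := fun u => by omega
  have hrank : ∀ u, vRank G u < R := fun u => by have := vRank_bounds G u; omega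
  have h0 : 0 < R := by omega
  have h1 : 1 < R := by omega
  refine h.passOut hA ?_ ?_ ?_ ?_ ?_ ?_
  · intro i
    simp [isKey, dg0_word, dg1_word, hfin, hfin', h0]
  · simp only [isKey, dummy_not_lt hR, decide_false, Bool.and_false]
  · rintro u v y huv rfl
    simp [isKey, dg1_word, h1]
  · intro s i
    simp [headFn, dg0_word, dg1_word, dg2_word, hfin, hfin', hrank, h0]
  · intro s
    simp only [headFn, dummy_not_lt hR, decide_false, cond_false]
  · rintro u v y huv rfl
    refine ⟨v, ?_, ?_, ?_⟩
    · rw [word_lt_word (hfin _) h0 (hrank _) h0 (hfin _) h1 (hrank _) h0]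
      omega
    · intro j hj
      rw [word_lt_word (hfin _) h0 (hrank _) h0 (hfin _) h1 (hrank _) h0] at hj
      have hjv : (j : ℕ) ≤ v := by omega
      rcases hjv.eq_or_lt with h3 | h3
      · rw [Fin.ext h3]
      · refine (not_lt.1 ?_)
        rw [word_lt_word (hfin _) h0 (hrank _) h0 (hfin _) h0 (hrank _) h0]
        omega
    · simp [headFn, dg0_word, dg1_word, dg2_word, hfin, hfin', hrank, h1]

end ExtMem

namespace ExtMem

/-! ### Finding a witness -/

variable {n m R : ℕ} {G : SimpleGraph (Fin n)} [DecidableRel G.Adj]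

theorem vRank_lt (hR : base n m = R) (u : Fin n) : vRank G u < R - 2 := by
  have := vRank_bounds G u
  have := hR ▸ base_bound n m
  omega

theorem prevRank_lt (hR : base n m = R) (v : Fin n) (k : ℕ) :
    prevRank (G := G) (vRank G) v k < R := by
  have := hR ▸ base_bound n m
  rcases prevRank_cases (G := G) (ρ := vRank G) v k with ⟨h, -⟩ | ⟨w, -, -, h, -⟩
  · omega
  · have := vRank_lt (G := G) hR w; omega

/-- The sorted list `A` contains a word for each ordered pair of adjacent vertices. -/
structure Arcs (G : SimpleGraph (Fin n)) [DecidableRel G.Adj] (R : ℕ) (A : List ℕ) : Prop where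
  sorted : A.Pairwise (· ≤ ·)
  cases : ∀ y ∈ A, y = dummy R ∨ (∃ i, y = word R 0 (vRank G i) 0 0) ∨
    ∃ u v, G.Adj u v ∧ y = word R 1 (vRank G v) (vRank G u) 0
  mem : ∀ u v, G.Adj u v → word R 1 (vRank G v) (vRank G u) 0 ∈ A

theorem KeyEntries.arcs {A : List ℕ} (hA : A.Pairwise (· ≤ ·))
    (h : KeyEntries G (dummy R) (fun i => word R 0 (vRank G i) 0 0)
      (fun u v y => y = word R 1 (vRank G v) (vRank G u) 0) A) : Arcs G R A := by
  obtain ⟨Y, h1, h2, h3⟩ := h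
  refine ⟨hA, fun y hy => ?_, fun u v huv => ?_⟩
  · rw [h1.mem_iff, List.mem_append, List.mem_ofFn] at hy
    rcases hy with ⟨i, rfl⟩ | hy
    · exact .inr (.inl ⟨i, rfl⟩)
    · rcases h2 y hy with h | h
      · exact .inl h
      · exact .inr (.inr h)
  · obtain ⟨y, hy, rfl⟩ := h3 u v huv
    rw [h1.mem_iff]
    exact List.mem_append_right _ hy

theorem Arcs.eq_of_isBack (hR : base n m = R) {A : List ℕ} (h : Arcs G R A) {y : ℕ} (hy : y ∈ A)
    (hb : isBack R y = true) :
    ∃ u v, G.Adj u v ∧ vRank G u < vRank G v ∧ y = word R 1 (vRank G v) (vRank G u) 0 := by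
  have hbd := hR ▸ base_bound n m
  have hr : ∀ u, vRank G u < R := fun u => by have := vRank_lt (G := G) hR u; omega
  simp only [isBack, Bool.and_eq_true, decide_eq_true_eq] at hb
  rcases h.cases y hy with rfl | ⟨i, rfl⟩ | ⟨u, v, huv, rfl⟩
  · rw [dg0_dummy (by omega)] at hb; omega
  · rw [dg0_word (by omega)] at hb; omega
  · rw [dg2_word (hr _), dg1_word (hr _)] at hb
    exact ⟨u, v, huv, hb.2, rfl⟩

/-- Arcs are sorted by `v`, then by neighbour. Among the arcs of `v` before the current one, the
last whose neighbour precedes `v` carries the last neighbour before both `u` and `v`. If that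
carried arc belongs to another vertex, there is none. -/
theorem Arcs.prev_eq (hR : base n m = R) {A : List ℕ} (h : Arcs G R A) {u v : Fin n}
    {s : ℕ} (hs : s = maxBelow (isBack R) A (word R 1 (vRank G v) (vRank G u) 0)) :
    (bif decide (dg0 R s = 1) && decide (dg1 R s = vRank G v) then dg2 R s + 1 else 0) =
      prevRank (G := G) (vRank G) v (min (vRank G u) (vRank G v)) := by
  have hbd := hR ▸ base_bound n m
  have hr : ∀ u, vRank G u < R := fun u => by have := vRank_lt (G := G) hR u; omega
  have h0 : 0 < R := by omega
  have h1 : 1 < R := by omega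
  rcases prevRank_cases (G := G) (ρ := vRank G) v (min (vRank G u) (vRank G v)) with
    ⟨h2, h3⟩ | ⟨w, h2, h3, h4, h5⟩
  · rw [h2]
    by_contra hne
    have hcond : dg0 R s = 1 ∧ dg1 R s = vRank G v := by
      by_contra hcond
      have : (decide (dg0 R s = 1) && decide (dg1 R s = vRank G v)) = false := by
        rw [Bool.eq_false_iff]; simpa using hcond
      rw [this] at hne
      exact hne rfl
    rcases (maxBelow_spec (isBack R) h.sorted (word R 1 (vRank G v) (vRank G u) 0)).2 with
      ⟨h6, h7, h8⟩ | ⟨h6, -⟩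
    · rw [← hs] at h6 h7 h8
      obtain ⟨u', v', huv', hlt', rfl⟩ := h.eq_of_isBack hR h6 h7
      rw [dg1_word (hr _)] at hcond
      obtain rfl := vRank_injective G hcond.2
      rw [word_lt_word h1 (hr _) (hr _) h0 h1 (hr _) (hr _) h0] at h8
      exact h3 u' huv' (by omega)
    · rw [hs, h6, dg0_zero] at hcond
      omega
  · have hs' : s = word R 1 (vRank G v) (vRank G w) 0 := by
      rw [hs]
      refine maxBelow_eq h.sorted (h.mem _ _ h2) ?_ ?_ ?_
      · simp only [isBack, dg0_word h1, dg1_word (hr _), dg2_word (hr _)]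
        simp; omega
      · rw [word_lt_word h1 (hr _) (hr _) h0 h1 (hr _) (hr _) h0]
        omega
      · intro y hy hp hlt
        obtain ⟨u', v', huv', hlt', rfl⟩ := h.eq_of_isBack hR hy hp
        rw [word_lt_word h1 (hr _) (hr _) h0 h1 (hr _) (hr _) h0] at hlt
        refine not_lt.1 ?_
        rw [word_lt_word h1 (hr _) (hr _) h0 h1 (hr _) (hr _) h0]
        by_cases hv : vRank G v' = vRank G v
        · obtain rfl := vRank_injective G hv
          have := h5 u' huv' (by omega)
          omega
        · omega
    rw [h4, hs']
    simp [dg0_word h1, dg1_word (hr _), dg2_word (hr _)]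

theorem Arcs.prevFn_eq (hR : base n m = R) {A : List ℕ} (h : Arcs G R A) {u v : Fin n} :
    prevFn R (maxBelow (isBack R) A (word R 1 (vRank G v) (vRank G u) 0))
        (word R 1 (vRank G v) (vRank G u) 0) =
      if vRank G u < vRank G v then
        word R (vRank G u) 1 (prevRank (G := G) (vRank G) v (vRank G u)) (vRank G v)
      else word R (vRank G v) 0 (prevRank (G := G) (vRank G) v (vRank G v)) 0 := by
  have hbd := hR ▸ base_bound n m
  have hr : ∀ u, vRank G u < R := fun u => by have := vRank_lt (G := G) hR u; omega
  have h1 : 1 < R := by omega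
  obtain ⟨s, hs⟩ : ∃ s, s = maxBelow (isBack R) A (word R 1 (vRank G v) (vRank G u) 0) := ⟨_, rfl⟩
  have h2 := h.prev_eq hR hs
  -- `prevFn` discards a word equal to the carried one as a repeated copy; this never happens to a
  -- first copy.
  have hne : s ≠ word R 1 (vRank G v) (vRank G u) 0 := by
    rcases (maxBelow_spec (isBack R) h.sorted (word R 1 (vRank G v) (vRank G u) 0)).2 with
      ⟨h6, h7, h8⟩ | ⟨h6, -⟩
    · omega
    · intro h3
      have h4 : dg0 R (word R 1 (vRank G v) (vRank G u) 0) = dg0 R 0 := by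
        rw [← h3, hs, h6]
      rw [dg0_word h1, dg0_zero] at h4
      omega
  rw [← hs]
  unfold prevFn
  rw [dg0_word h1, dg1_word (hr _), dg2_word (hr _), h2]
  split_ifs with hlt
  · simp [hne, hlt, min_eq_left hlt.le]
  · simp [hne, hlt, min_eq_right (not_lt.1 hlt)]

/-- The sorted list `A` contains, for the two ends of each edge, the last neighbour that precedes both
ends. -/
structure Prevs (G : SimpleGraph (Fin n)) [DecidableRel G.Adj] (R : ℕ) (A : List ℕ) : Prop where
  sorted : A.Pairwise (· ≤ ·)
  cases : ∀ y ∈ A, y = dummy R ∨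
    (∃ v, y = word R (vRank G v) 0 (prevRank (G := G) (vRank G) v (vRank G v)) 0) ∨
    ∃ u v, G.Adj u v ∧ vRank G u < vRank G v ∧
      y = word R (vRank G u) 1 (prevRank (G := G) (vRank G) v (vRank G u)) (vRank G v)
  mem_fst : ∀ u v, G.Adj u v → vRank G u < vRank G v →
    word R (vRank G u) 0 (prevRank (G := G) (vRank G) u (vRank G u)) 0 ∈ A
  mem_snd : ∀ u v, G.Adj u v → vRank G u < vRank G v →
    word R (vRank G u) 1 (prevRank (G := G) (vRank G) v (vRank G u)) (vRank G v) ∈ A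

theorem Arcs.prevs (hR : base n m = R) {A : List ℕ} (h : Arcs G R A) :
    Prevs G R (sortl (passOut (isBack R) (fun _ => prevFn R) 0 0 A)) := by
  have hbd := hR ▸ base_bound n m
  refine ⟨sortl_sorted _, fun y hy => ?_, fun u v huv hlt => ?_, fun u v huv hlt => ?_⟩
  · obtain ⟨x, hx, hxy⟩ := mem_passOut h.sorted (mem_sortl.1 hy)
    rcases hxy with rfl | ⟨-, rfl⟩
    · rcases h.cases x hx with rfl | ⟨i, rfl⟩ | ⟨u, v, huv, rfl⟩
      · left
        unfold prevFn
        rw [dg0_dummy (by omega)]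
        simp [show R - 1 ≠ 1 by omega]
      · left
        unfold prevFn
        rw [dg0_word (by omega)]
        simp
      · right
        rw [h.prevFn_eq hR]
        split_ifs with hlt
        · exact .inr ⟨u, v, huv, hlt, rfl⟩
        · exact .inl ⟨v, rfl⟩
    · left
      simp [prevFn]
  · rw [mem_sortl]
    -- The value for `u` itself is obtained at the opposite arc, where the neighbour `v` is the
    -- later vertex and the minimum of the ranks is that of `u`.
    have := passOut_mem (p := isBack R) (f := prevFn R) h.sorted (h.mem v u huv.symm)
    rwa [h.prevFn_eq hR, if_neg (by omega)] at this
  · rw [mem_sortl]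
    have := passOut_mem (p := isBack R) (f := prevFn R) h.sorted (h.mem u v huv)
    rwa [h.prevFn_eq hR, if_pos hlt] at this

/-- The words of the list `A` describe witnesses, and there is one if the order is not coherent. -/
structure Witnesses (G : SimpleGraph (Fin n)) [DecidableRel G.Adj] (R : ℕ) (A : List ℕ) : Prop where
  sorted : A.Pairwise (· ≤ ·)
  cases : ∀ y ∈ A, y = dummy R ∨ ∃ b c w, IsWitness G (vRank G) b c w ∧
    y = word R (vRank G b) (vRank G c) (vRank G w) 0
  coherent : (∀ y ∈ A, y = dummy R) → Coherent G (vRank G)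

/-- The words are grouped by the earlier end `u`, with the value of `u` as key in front. Each edge
is compared with this key; the larger value, less one, is the rank of the vertex that only one end
sees. -/
theorem Prevs.witnesses (hR : base n m = R) {A : List ℕ} (h : Prevs G R A) :
    Witnesses G R (sortl (passOut (isKey R) (fun _ => witnessFn R) 0 0 A)) := by
  have hbd := hR ▸ base_bound n m
  have hr1 : ∀ u, vRank G u < R - 1 := fun u => by have := vRank_lt (G := G) hR u; omega
  have hr : ∀ u, vRank G u < R := fun u => by have := vRank_lt (G := G) hR u; omega
  have hp := prevRank_lt (G := G) hR
  have h0 : 0 < R := by omega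
  have h1 : 1 < R := by omega
  have heval : ∀ u v, G.Adj u v → vRank G u < vRank G v → ∀ y z,
      prevRank (G := G) (vRank G) v (vRank G u) = y → prevRank (G := G) (vRank G) u (vRank G u) = z →
      witnessFn R (maxBelow (isKey R) A (word R (vRank G u) 1 y (vRank G v)))
        (word R (vRank G u) 1 y (vRank G v)) =
      if z < y then word R (vRank G u) (vRank G v) (y - 1) 0 else
      if y < z then word R (z - 1) (vRank G u) (vRank G v) 0 else dummy R := by
    intro u v huv hlt y z hy hz
    have hyR : y < R := hy ▸ hp _ _
    have hzR : z < R := hz ▸ hp _ _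
    have hmax : maxBelow (isKey R) A (word R (vRank G u) 1 y (vRank G v)) =
        word R (vRank G u) 0 z 0 := by
      refine maxBelow_eq h.sorted (hz ▸ h.mem_fst u v huv hlt) ?_ ?_ ?_
      · simp [isKey, dg0_word (hr _), dg1_word h0, hr1]
      · rw [word_lt_word (hr _) h0 hzR h0 (hr _) h1 hyR (hr _)]
        omega
      · intro x hx hk hlt
        rcases h.cases x hx with rfl | ⟨v', rfl⟩ | ⟨u', v', -, -, rfl⟩
        · simp only [isKey, dummy_not_lt hR, decide_false, Bool.and_false] at hk
          exact absurd hk (by simp)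
        · rw [word_lt_word (hr _) h0 (hp _ _) h0 (hr _) h1 hyR (hr _)] at hlt
          refine not_lt.1 ?_
          rw [word_lt_word (hr _) h0 hzR h0 (hr _) h0 (hp _ _) h0]
          by_cases he : vRank G v' = vRank G u
          · obtain rfl := vRank_injective G he
            omega
          · omega
        · simp [isKey, dg1_word h1] at hk
    rw [hmax]
    unfold witnessFn
    rw [dg0_word (hr _), dg1_word h1, dg2_word hyR, dg2_word hzR, dg3_word (hr _)]
    split_ifs <;> simp [*]
  refine ⟨sortl_sorted _, fun y hy => ?_, fun hall => ?_⟩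
  · obtain ⟨x, hx, hxy⟩ := mem_passOut h.sorted (mem_sortl.1 hy)
    rcases h.cases x hx with rfl | ⟨i, rfl⟩ | ⟨u, v, huv, hlt, rfl⟩
    · left
      have : ∀ s, witnessFn R s (dummy R) = dummy R := fun s => by
        simp only [witnessFn, dummy_not_lt hR, decide_false, Bool.false_and, cond_false]
      rcases hxy with rfl | ⟨-, rfl⟩ <;> exact this _
    · left
      have : ∀ s, witnessFn R s (word R (vRank G i) 0 (prevRank (G := G) (vRank G) i (vRank G i)) 0) =
          dummy R := fun s => by
        simp [witnessFn, dg1_word h0]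
      rcases hxy with rfl | ⟨-, rfl⟩ <;> exact this _
    · rcases hxy with rfl | ⟨hk, -⟩
      · rw [heval u v huv hlt _ _ rfl rfl]
        split_ifs with h2 h3
        · obtain ⟨w, hw, hw'⟩ := isWitness_of_prevRank_lt hlt huv h2
          exact .inr ⟨u, v, w, hw', by rw [← hw, Nat.add_sub_cancel]⟩
        · obtain ⟨w, hw, hw'⟩ := isWitness_of_lt_prevRank hlt huv h3
          exact .inr ⟨w, u, v, hw', by rw [← hw, Nat.add_sub_cancel]⟩
        · exact .inl rfl
      · simp [isKey, dg1_word h1] at hk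
  · refine coherent_of_prevRank (vRank_injective G) fun u v hlt huv => ?_
    have h2 := hall _ (mem_sortl.2 (passOut_mem (p := isKey R) (f := witnessFn R) h.sorted
      (h.mem_snd u v huv hlt)))
    rw [heval u v huv hlt _ _ rfl rfl] at h2
    -- A dummy has leading digit `R - 1`, which is not a rank; only the case of equal values
    -- survives.
    have h3 := congrArg (dg0 R) h2
    rw [dg0_dummy h0] at h3
    split_ifs at h3 with h4 h5
    · rw [dg0_word (hr _)] at h3
      have := hr1 u
      omega
    · rw [dg0_word (by have := hp u (vRank G u); omega)] at h3
      have h6 := prevRank_cases (G := G) (ρ := vRank G) u (vRank G u)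
      rcases h6 with ⟨h6, -⟩ | ⟨w, -, -, h6, -⟩
      · omega
      · have := hr1 w
        omega
    · omega

end ExtMem

namespace ExtMem

variable {n m R : ℕ} {G : SimpleGraph (Fin n)} [DecidableRel G.Adj]

/-! ### The degree ordering -/

/-- Vertex keys are smaller than arcs and dummies, so they are the first `n` words. The vertex is
recovered from its rank modulo `n + 1`. -/
theorem KeyEntries.exists_isDegreeOrdering (hR : base n m = R) {A : List ℕ}
    (hA : A.Pairwise (· ≤ ·)) (h : KeyEntries G (dummy R) (fun i => word R 0 (vRank G i) 0 0)
      (fun u v y => y = word R 1 (vRank G v) (vRank G u) 0) A) :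
    ∃ γ : List (Fin n), IsDegreeOrdering G γ ∧ n ≤ A.length ∧
      (A.take n).map (fun x => dg1 R x % (n + 1)) = γ.map Fin.val := by
  have hbd := hR ▸ base_bound n m
  have hr : ∀ u, vRank G u < R := fun u => by have := vRank_lt (G := G) hR u; omega
  have h0 : 0 < R := by omega
  have h1 : 1 < R := by omega
  obtain ⟨Y, hperm, hY, -⟩ := h
  set X : Fin n → ℕ := fun i => word R 0 (vRank G i) 0 0 with hX
  set le : Fin n → Fin n → Bool := fun u v => decide (vRank G u ≤ vRank G v) with hle
  set γ := (List.finRange n).mergeSort le with hγ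
  have hγp : γ.Perm (List.finRange n) := List.mergeSort_perm _ _
  have hγs : γ.Pairwise fun u v => vRank G u ≤ vRank G v := by
    have := List.pairwise_mergeSort (le := le) (fun a b c hab hbc => by
      simp only [hle, decide_eq_true_eq] at *; omega) (fun a b => by
      simp only [hle, Bool.or_eq_true, decide_eq_true_eq]; omega) (List.finRange n)
    simpa [hle] using this
  have hXs : (γ.map X).Pairwise (· ≤ ·) := by
    refine List.pairwise_map.2 (hγs.imp fun {u v} huv => not_lt.1 ?_)
    rw [word_lt_word h0 (hr _) h0 h0 h0 (hr _) h0 h0]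
    omega
  have hAeq : γ.map X ++ sortl Y = A := by
    have h2 : (γ.map X ++ sortl Y).Perm A := by
      refine (List.Perm.append ?_ (sortl_perm Y)).trans hperm.symm
      rw [List.ofFn_eq_map]
      exact hγp.map X
    refine h2.eq_of_pairwise (fun _ _ _ _ => le_antisymm) ?_ hA
    refine List.pairwise_append.2 ⟨hXs, sortl_sorted Y, ?_⟩
    intro a ha y hy
    obtain ⟨i, -, rfl⟩ := List.mem_map.1 ha
    rw [mem_sortl] at hy
    rcases hY y hy with rfl | ⟨u, v, -, rfl⟩
    · refine le_of_lt ?_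
      rw [dummy, word_lt_word h0 (hr _) h0 h0 (by omega) h0 h0 h0]
      omega
    · refine le_of_lt ?_
      rw [word_lt_word h0 (hr _) h0 h0 h1 (hr _) (hr _) h0]
      omega
  have hlen : (γ.map X).length = n := by
    rw [List.length_map, hγp.length_eq, List.length_finRange]
  refine ⟨γ, ⟨⟨hγp.nodup_iff.2 (List.nodup_finRange n), fun v => hγp.mem_iff.2 (List.mem_finRange v)⟩,
    ?_⟩, ?_, ?_⟩
  · refine hγs.imp fun {u v} huv => ?_
    rcases huv.lt_or_eq with h2 | h2
    · exact degree_le_of_vRank_lt G h2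
    · rw [vRank_injective G h2]
  · rw [← hAeq, List.length_append]; omega
  · rw [← hAeq, List.take_append_of_le_length hlen.ge, List.take_of_length_le hlen.le, List.map_map]
    refine List.map_congr_left fun u _ => ?_
    simp only [Function.comp_apply, hX]
    rw [dg1_word (hr _), vRank_mod]

/-! ### From a witness to a forbidden subgraph -/

theorem getD_zero_mem {A : List ℕ} (h : A ≠ []) : A.getD 0 0 ∈ A := by
  cases A with
  | nil => exact absurd rfl h
  | cons a A => simp

theorem getD_zero_le {A : List ℕ} (hA : A.Pairwise (· ≤ ·)) {y : ℕ} (hy : y ∈ A) :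
    A.getD 0 0 ≤ y := by
  cases A with
  | nil => simp at hy
  | cons a A =>
    rcases List.mem_cons.1 hy with rfl | hy
    · simp
    · exact (List.pairwise_cons.1 hA).1 y hy

theorem word_vRank_lt_dummy (hR : base n m = R) (u : Fin n) {b c d : ℕ} (hb : b < R) (hc : c < R)
    (hd : d < R) : word R (vRank G u) b c d < dummy R := by
  have := vRank_lt (G := G) hR u
  rw [dummy, word_lt_word (by omega) hb hc hd (by omega) (by omega) (by omega) (by omega)]
  omega

/-- A dummy exceeds every witness word, so one look at the first word of the sorted list tells
whether any witness exists. -/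
theorem Witnesses.head (hR : base n m = R) {A : List ℕ} (h : Witnesses G R A) (hne : A ≠ []) :
    (A.getD 0 0 = dummy R ∧ Coherent G (vRank G)) ∨ ∃ b c w, IsWitness G (vRank G) b c w ∧
      A.getD 0 0 = word R (vRank G b) (vRank G c) (vRank G w) 0 := by
  have hr : ∀ u, vRank G u < R := fun u => by have := vRank_lt (G := G) hR u; omega
  rcases h.cases _ (getD_zero_mem hne) with h1 | h1
  · refine .inl ⟨h1, h.coherent fun y hy => ?_⟩
    rcases h.cases y hy with h2 | ⟨b, c, w, -, rfl⟩
    · exact h2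
    · have h3 := getD_zero_le h.sorted hy
      have := word_vRank_lt_dummy (G := G) hR b (hr c) (hr w) (by have := hr b; omega : 0 < R)
      omega
  · exact .inr h1

/-- The sorted list `A` contains a key for each neighbour of `c` and an entry for each neighbour
of `b`. -/
structure Stars (G : SimpleGraph (Fin n)) [DecidableRel G.Adj] (R : ℕ) (b c : Fin n)
    (A : List ℕ) : Prop where
  sorted : A.Pairwise (· ≤ ·)
  cases : ∀ y ∈ A, y = dummy R ∨ (∃ v, G.Adj v c ∧ y = word R (vRank G v) 0 0 0) ∨
    ∃ v, G.Adj v b ∧ y = word R (vRank G v) 1 0 0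
  mem_key : ∀ v, G.Adj v c → word R (vRank G v) 0 0 0 ∈ A
  mem_entry : ∀ v, G.Adj v b → word R (vRank G v) 1 0 0 ∈ A

theorem Arcs.stars (hR : base n m = R) {A : List ℕ} (h : Arcs G R A) {b c : Fin n} {a : ℕ}
    (hb : dg0 R a = vRank G b) (hc : dg1 R a = vRank G c) (hbc : vRank G b ≠ vRank G c) :
    Stars G R b c (sortl (passOut (fun _ => false) (fun _ _ => starFn R a) 0 0 A)) := by
  have hbd := hR ▸ base_bound n m
  have hr : ∀ u, vRank G u < R := fun u => by have := vRank_lt (G := G) hR u; omega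
  have h0 : 0 < R := by omega
  have h1 : 1 < R := by omega
  have heval : ∀ u v, starFn R a (word R 1 (vRank G v) (vRank G u) 0) =
      if u = c then word R (vRank G v) 0 0 0 else if u = b then word R (vRank G v) 1 0 0
      else dummy R := by
    intro u v
    simp only [starFn, dg0_word h1, dg1_word (hr _), dg2_word (hr _), hb, hc,
      (vRank_injective G).eq_iff]
    simp [Bool.cond_decide]
  have hmem := fun x (hx : x ∈ A) =>
    passOut_mem (p := fun _ => false) (f := fun _ => starFn R a) h.sorted hx
  refine ⟨sortl_sorted _, fun y hy => ?_, fun v hv => ?_, fun v hv => ?_⟩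
  · obtain ⟨x, hx, hxy⟩ := mem_passOut h.sorted (mem_sortl.1 hy)
    have hxy : y = starFn R a x := by rcases hxy with h | ⟨-, h⟩ <;> exact h
    subst hxy
    rcases h.cases x hx with rfl | ⟨i, rfl⟩ | ⟨u, v, huv, rfl⟩
    · left
      unfold starFn
      rw [dg0_dummy h0]
      simp [show R - 1 ≠ 1 by omega]
    · left
      unfold starFn
      rw [dg0_word h0]
      simp
    · rw [heval]
      split_ifs with h2 h3
      · subst h2; exact .inr (.inl ⟨v, huv.symm, rfl⟩)
      · subst h3; exact .inr (.inr ⟨v, huv.symm, rfl⟩)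
      · exact .inl rfl
  · rw [mem_sortl]
    have := hmem _ (h.mem c v hv.symm)
    rwa [heval, if_pos rfl] at this
  · rw [mem_sortl]
    have := hmem _ (h.mem b v hv.symm)
    rwa [heval, if_neg (fun he => hbc (congrArg _ he)), if_pos rfl] at this

/-- A neighbour of `b` survives if it is neither a neighbour of `c` nor `c` itself; each survivor
completes the forbidden subgraph, and `exists_adj_not_adj` provides one. -/
theorem Stars.obstruct (hR : base n m = R) {A : List ℕ} {b c w : Fin n} (h : Stars G R b c A)
    {a : ℕ} (ha : a = word R (vRank G b) (vRank G c) (vRank G w) 0)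
    (hw : IsWitness G (vRank G) b c w) :
    (∀ y ∈ passOut (isKey R) (fun _ => obstructFn R a) 0 0 A, y = dummy R ∨
      ∃ x, IsForbiddenList G [x, b, c, w] ∧
        y = word R (vRank G x) (vRank G b) (vRank G c) (vRank G w)) ∧
    ∃ y ∈ passOut (isKey R) (fun _ => obstructFn R a) 0 0 A, y ≠ dummy R := by
  classical
  have hbd := hR ▸ base_bound n m
  have hr1 : ∀ u, vRank G u < R - 1 := fun u => by have := vRank_lt (G := G) hR u; omega
  have hr : ∀ u, vRank G u < R := fun u => by have := vRank_lt (G := G) hR u; omega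
  have h0 : 0 < R := by omega
  have h1 : 1 < R := by omega
  obtain ⟨hbc, hlt, hwc, hwb, nwb⟩ := hw
  have hbc' : b ≠ c := hbc.ne
  -- If `v` is a neighbour of `c`, its key is the last one below its entry; otherwise the last key
  -- has another leading digit, or the default 0, which is not a rank.
  have hs : ∀ v, dg0 R (maxBelow (isKey R) A (word R (vRank G v) 1 0 0)) = vRank G v ↔ G.Adj v c := by
    intro v
    have hpos := vRank_bounds G v
    constructor
    · intro hv
      rcases (maxBelow_spec (isKey R) h.sorted (word R (vRank G v) 1 0 0)).2 with
        ⟨h2, h3, -⟩ | ⟨h2, -⟩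
      · rcases h.cases _ h2 with h4 | ⟨v', h5, h4⟩ | ⟨v', h5, h4⟩
        · rw [h4] at h3
          simp only [isKey, dummy_not_lt hR, decide_false, Bool.and_false] at h3
          exact absurd h3 (by simp)
        · rw [h4, dg0_word (hr _)] at hv
          rwa [← vRank_injective G hv]
        · rw [h4] at h3
          simp [isKey, dg1_word h1] at h3
      · rw [h2, dg0_zero] at hv
        omega
    · intro hv
      rw [maxBelow_eq h.sorted (h.mem_key v hv), dg0_word (hr _)]
      · simp [isKey, dg0_word (hr _), dg1_word h0, hr1]
      · rw [word_lt_word (hr _) h0 h0 h0 (hr _) h1 h0 h0]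
        omega
      · intro x hx hk hlt
        rcases h.cases _ hx with rfl | ⟨v', h5, rfl⟩ | ⟨v', h5, rfl⟩
        · simp only [isKey, dummy_not_lt hR, decide_false, Bool.and_false] at hk
          exact absurd hk (by simp)
        · rw [word_lt_word (hr _) h0 h0 h0 (hr _) h1 h0 h0] at hlt
          refine not_lt.1 ?_
          rw [word_lt_word (hr _) h0 h0 h0 (hr _) h0 h0 h0]
          omega
        · simp [isKey, dg1_word h1] at hk
  have heval : ∀ v, obstructFn R a (maxBelow (isKey R) A (word R (vRank G v) 1 0 0))
      (word R (vRank G v) 1 0 0) = if G.Adj v c ∨ v = c then dummy R else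
        word R (vRank G v) (vRank G b) (vRank G c) (vRank G w) := by
    intro v
    unfold obstructFn
    rw [dg0_word (hr v), dg1_word h1, ha, dg0_word (hr b), dg1_word (hr c), dg2_word (hr w)]
    simp only [hs, (vRank_injective G).eq_iff, hr1]
    by_cases h2 : G.Adj v c <;> by_cases h3 : v = c <;> simp [h2, h3]
  constructor
  · intro y hy
    obtain ⟨x, hx, hxy⟩ := mem_passOut h.sorted hy
    rcases h.cases x hx with rfl | ⟨v, hv, rfl⟩ | ⟨v, hv, rfl⟩
    · left
      have : ∀ s, obstructFn R a s (dummy R) = dummy R := fun s => by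
        simp only [obstructFn, dummy_not_lt hR, decide_false, Bool.false_and, cond_false]
      rcases hxy with rfl | ⟨-, rfl⟩ <;> exact this _
    · left
      have : ∀ s, obstructFn R a s (word R (vRank G v) 0 0 0) = dummy R := fun s => by
        simp [obstructFn, dg1_word h0]
      rcases hxy with rfl | ⟨-, rfl⟩ <;> exact this _
    · rcases hxy with rfl | ⟨hk, -⟩
      · rw [heval]
        split_ifs with h2
        · exact .inl rfl
        · rw [not_or] at h2
          exact .inr ⟨v, isForbiddenList_of_witness hbc hwc hwb nwb hv h2.1 h2.2, rfl⟩
      · simp [isKey, dg1_word h1] at hk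
  · obtain ⟨x, hxb, hxc, nxc⟩ := exists_adj_not_adj hbc (degree_le_of_vRank_lt G hlt) hwc hwb nwb
    refine ⟨_, passOut_mem (p := isKey R) (f := obstructFn R a) h.sorted (h.mem_entry x hxb), ?_⟩
    rw [heval, if_neg (by tauto)]
    exact (word_vRank_lt_dummy hR x (hr b) (hr c) (hr w)).ne

/-- Without a witness the last stages still run, but produce only dummies; the program needs no
branch. -/
theorem Arcs.starFn_dummy (hR : base n m = R) {A : List ℕ} (h : Arcs G R A) {y : ℕ}
    (hy : y ∈ passOut (fun _ => false) (fun _ _ => starFn R (dummy R)) 0 0 A) : y = dummy R := by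
  have hbd := hR ▸ base_bound n m
  have hr1 : ∀ u, vRank G u < R - 1 := fun u => by have := vRank_lt (G := G) hR u; omega
  have hr : ∀ u, vRank G u < R := fun u => by have := vRank_lt (G := G) hR u; omega
  have h0 : 0 < R := by omega
  have h1 : 1 < R := by omega
  obtain ⟨x, hx, hxy⟩ := mem_passOut h.sorted hy
  have hxy : y = starFn R (dummy R) x := by rcases hxy with h | ⟨-, h⟩ <;> exact h
  subst hxy
  have hd1 : dg1 R (dummy R) = 0 := dg1_word h0
  have hd0 : dg0 R (dummy R) = R - 1 := dg0_dummy h0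
  unfold starFn
  rw [hd1, hd0]
  rcases h.cases x hx with rfl | ⟨i, rfl⟩ | ⟨u, v, huv, rfl⟩
  · rw [hd0]
    simp [show R - 1 ≠ 1 by omega]
  · rw [dg0_word h0]
    simp
  · have := vRank_bounds G u
    have := hr1 u
    rw [dg0_word h1, dg2_word (hr _)]
    simp [show vRank G u ≠ 0 by omega, show vRank G u ≠ R - 1 by omega]

theorem obstructFn_dummy (hR : base n m = R) {A : List ℕ} (hA : ∀ y ∈ A, y = dummy R) {a y : ℕ}
    (hy : y ∈ passOut (isKey R) (fun _ => obstructFn R a) 0 0 A) : y = dummy R := by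
  simp only [passOut, List.mem_map, List.mem_range] at hy
  obtain ⟨j, hj, rfl⟩ := hy
  rw [List.getD_eq_getElem _ _ hj, hA _ (List.getElem_mem hj)]
  simp only [obstructFn, dummy_not_lt hR, decide_false, Bool.false_and, cond_false]

theorem passOut_ne_nil {p : ℕ → Bool} {f : ℕ → ℕ → ℕ → ℕ} {A : List ℕ} (h : A ≠ []) :
    sortl (passOut p f 0 0 A) ≠ [] := by
  rw [← List.length_pos_iff] at h ⊢
  rwa [length_sortl, length_passOut]

/-- Correctness of the last four stages. -/
theorem Arcs.certificate (hR : base n m = R) {A B C S O : List ℕ} (h : Arcs G R A) (hne : A ≠ [])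
    (hB : B = sortl (passOut (isBack R) (fun _ => prevFn R) 0 0 A))
    (hC : C = sortl (passOut (isKey R) (fun _ => witnessFn R) 0 0 B))
    (hS : S = sortl (passOut (fun _ => false) (fun _ _ => starFn R (C.getD 0 0)) 0 0 A))
    (hO : O = sortl (passOut (isKey R) (fun _ => obstructFn R (C.getD 0 0)) 0 0 S)) :
    (O.getD 0 0 = dummy R ∧ IsTriviallyPerfect G) ∨
      ∃ x b c w, IsForbiddenList G [x, b, c, w] ∧ O.getD 0 0 ≠ dummy R ∧
        O.getD 0 0 = word R (vRank G x) (vRank G b) (vRank G c) (vRank G w) := by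
  have hbd := hR ▸ base_bound n m
  have hr : ∀ u, vRank G u < R := fun u => by have := vRank_lt (G := G) hR u; omega
  have hBne : B ≠ [] := hB ▸ passOut_ne_nil hne
  have hCne : C ≠ [] := hC ▸ passOut_ne_nil hBne
  have hOne : O ≠ [] := hO ▸ passOut_ne_nil (hS ▸ passOut_ne_nil hne)
  have hOmem : O.getD 0 0 ∈ passOut (isKey R) (fun _ => obstructFn R (C.getD 0 0)) 0 0 S := by
    have := getD_zero_mem hOne
    conv at this => enter [1]; rw [hO]
    exact mem_sortl.1 this
  have hwit : Witnesses G R C := hC ▸ Prevs.witnesses hR (hB ▸ h.prevs hR)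
  rcases hwit.head hR hCne with ⟨h1, h2⟩ | ⟨b, c, w, hw, h1⟩
  · refine .inl ⟨?_, h2.isTriviallyPerfect (vRank_injective G)⟩
    refine obstructFn_dummy hR (fun y hy => ?_) hOmem
    rw [hS, mem_sortl, h1] at hy
    exact h.starFn_dummy hR hy
  · right
    have hst : Stars G R b c S := by
      rw [hS]
      refine h.stars hR (by rw [h1, dg0_word (hr _)]) (by rw [h1, dg1_word (hr _)]) hw.2.1.ne
    obtain ⟨h3, y, h4, h5⟩ := hst.obstruct hR h1 hw
    have hno : O.getD 0 0 ≠ dummy R := by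
      intro h6
      rcases h3 y h4 with h7 | ⟨x, -, h7⟩
      · exact h5 h7
      · have h8 := getD_zero_le (A := O) (hO ▸ sortl_sorted _) (y := y) (by rw [hO]; exact mem_sortl.2 h4)
        have := word_vRank_lt_dummy (G := G) hR x (hr b) (hr c) (hr w)
        omega
    rcases h3 _ hOmem with h6 | ⟨x, h6, h7⟩
    · exact absurd h6 hno
    · exact ⟨x, b, c, w, h6, hno, h7⟩

end ExtMem

namespace ExtMem

/-! ### The programs -/

theorem primrec_raw {f : View → List ℕ} (hf : Primrec f) : Computable f := hf.to_comp

/-- Encodes the numbers `n` and `m`, which are preceded by `k` other words. -/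
def start (k : ℕ) : Prog := .compute (fun v => enc [v.2.drop k ++ [0]]) (primrec_raw (by fun_prop))

/-- Loads the first word of array number 2 into the header. -/
def loadHead : Prog :=
  .seq (cmp (fun P rs => [2 * arrLen P.2.1 (sc rs 0 0) (sc rs 0 1), 1] :: rs) (by fun_prop))
    (.seq readRange (cmp (fun _ rs => [[sc rs 1 0, sc rs 1 1, sc rs 0 0]]) (by fun_prop)))

/-- The final content of main memory. -/
def verdict (n m a : ℕ) : List ℕ :=
  bif decide (a = dummy (base n m)) then [1, n, m] else
    [0, dg0 (base n m) a % (n + 1), dg1 (base n m) a % (n + 1), dg2 (base n m) a % (n + 1),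
      dg3 (base n m) a % (n + 1)]

@[fun_prop] theorem primrec_verdict {α : Type*} [Primcodable α] {n m a : α → ℕ} (hn : Primrec n)
    (hm : Primrec m) (ha : Primrec a) : Primrec fun x => verdict (n x) (m x) (a x) := by
  unfold verdict; fun_prop

/-- The raw memory is used here; index 0 holds the length of the single register. -/
def finish : Prog :=
  .compute (fun v => verdict (v.2.getD 1 0) (v.2.getD 2 0) (v.2.getD 3 0)) (primrec_raw (by fun_prop))

/-- Array 0 is the input. Array 1 holds the sorted arcs from the third stage on and is then never
overwritten, since later stages write to array 2 and sorting uses array 3. -/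
def certifyProg : Prog :=
  .seq (start 0) (.seq (stage splitPass 0 1) (.seq (stage tailPass 1 1) (.seq (stage headPass 1 1)
    (.seq (stage prevPass 1 2) (.seq (stage witnessPass 2 2) (.seq loadHead
      (.seq (stage starPass 1 2) (.seq (stage obstructPass 2 2) (.seq loadHead finish)))))))))

/-- Extracts the vertices from a page. -/
def vertices (R n : ℕ) (l : List ℕ) : List ℕ := l.map fun x => dg1 R x % (n + 1)

@[fun_prop] theorem primrec_vertices {α : Type*} [Primcodable α] {R n : α → ℕ} {l : α → List ℕ}
    (hR : Primrec R) (hn : Primrec n) (hl : Primrec l) :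
    Primrec fun x => vertices (R x) (n x) (l x) := by unfold vertices; fun_prop

/-- The verdict word is dropped; the third header word counts the pages that have been output. -/
def reportProg : Prog :=
  .seq (start 1) (rloop
    (fun P rs => decide (sc rs 0 2 * pageLen P.2.1 (sc rs 0 0) (sc rs 0 1) < sc rs 0 0)) (by fun_prop)
    (.seq (cmp (fun P rs => [arrLen P.2.1 (sc rs 0 0) (sc rs 0 1) +
          sc rs 0 2 * pageLen P.2.1 (sc rs 0 0) (sc rs 0 1),
          min (pageLen P.2.1 (sc rs 0 0) (sc rs 0 1))
            (sc rs 0 0 - sc rs 0 2 * pageLen P.2.1 (sc rs 0 0) (sc rs 0 1))] :: rs) (by fun_prop))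
      (.seq readRange
        (.seq (cmp (fun _ rs => [vertices (base (sc rs 1 0) (sc rs 1 1)) (sc rs 1 0) (rs.getD 0 []),
          [sc rs 1 0, sc rs 1 1, sc rs 1 2 + 1]]) (by fun_prop)) .emit))))

theorem exec_start {μ : Machine} {n m k : ℕ} {l : List ℕ} (hl : l.length = k) (hn : n < μ.W)
    (hm : m < μ.W) (h3 : 3 < μ.W) (hc : 4 ≤ μ.cap) {d : ℕ → ℕ} {o : List ℕ} :
    Exec μ (start k) ⟨l ++ [n, m], d, o⟩ 0 ⟨enc [[n, m, 0]], d, o⟩ := by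
  have h : enc [(l ++ [n, m]).drop k ++ [0]] = enc [[n, m, 0]] := by
    rw [List.drop_left' hl]; rfl
  have := @Exec.compute μ (fun v => enc [v.2.drop k ++ [0]]) (primrec_raw (by fun_prop))
    ⟨l ++ [n, m], d, o⟩
  simp only [Machine.view, h] at this
  exact this (fits_enc (by simp; omega) (by simp; omega))

theorem exec_loadHead {μ : Machine} {n m aux L : ℕ} (hR : Room μ n m) (hL : arrLen μ.B n m = L)
    (haux : aux < μ.W) {d : ℕ → ℕ} {o : List ℕ} (hd : ∀ y, d y < μ.W) :
    Exec μ loadHead ⟨enc [[n, m, aux]], d, o⟩ 2 ⟨enc [[n, m, (region d (2 * L) L).getD 0 0]], d, o⟩ := by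
  have hcap := hR.cap
  have haddr := hR.addr
  have hn := hR.hn
  have hm := hR.hm
  have hB := hR.hB
  have hL1 : 1 ≤ L := hL ▸ (one_le_pageLen μ.B n m).trans (pageLen_le_arrLen μ.B n m)
  have hfst : (region d (2 * L) L).getD 0 0 = d (2 * L) := by
    rw [List.getD_eq_getElem _ _ (by simp; omega)]
    simp [region]
  rw [hL] at haddr
  have hg : Good μ.W [[n, m, aux]] := by simp; omega
  rw [hfst]
  refine Exec.seq_eq (t := 0) (t' := 2) (exec_cmp (rs' := [[2 * L, 1], [n, m, aux]]) ?_ ?_ ?_)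
    (Exec.seq_eq (t := 2) (t' := 0) (exec_readRange hB hB (by omega) (by omega) hd hg (by
      simp; omega)) (exec_cmp ?_ ?_ ?_) rfl) rfl
  · simp [hL]
  · simp; omega
  · simp; omega
  · simp [region]
  · simp; omega
  · have := hd (2 * L)
    simp; omega

theorem exec_finish {μ : Machine} {n m aux : ℕ} (hn : n < μ.W) (hm : m < μ.W) (h3 : 3 < μ.W)
    (hc : 5 ≤ μ.cap) {d : ℕ → ℕ} {o : List ℕ} :
    Exec μ finish ⟨enc [[n, m, aux]], d, o⟩ 0 ⟨verdict n m aux, d, o⟩ := by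
  have key : μ.Fits (verdict n m aux) →
      Exec μ finish ⟨enc [[n, m, aux]], d, o⟩ 0 ⟨verdict n m aux, d, o⟩ := fun h =>
    @Exec.compute μ (fun v => verdict (v.2.getD 1 0) (v.2.getD 2 0) (v.2.getD 3 0))
      (primrec_raw (by fun_prop)) ⟨enc [[n, m, aux]], d, o⟩ h
  refine key ?_
  have hmod : ∀ x, x % (n + 1) < μ.W := fun x => by
    have := Nat.mod_lt x (show 0 < n + 1 by omega); omega
  rw [verdict, Bool.cond_decide]
  split_ifs
  · refine ⟨by simp; omega, ?_⟩
    simp; omega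
  · refine ⟨by simp; omega, ?_⟩
    simp only [List.mem_cons, List.not_mem_nil, or_false]
    rintro w (rfl | rfl | rfl | rfl | rfl)
    · omega
    all_goals exact hmod _

/-! ### Word bounds for the passes, and the runs of the two programs. -/

theorem splitFn_lt {R : ℕ} (hR : 0 < R) (n m i s x : ℕ) : splitFn R n m i s x < R * R * R * R := by
  simp only [splitFn, Bool.cond_eq_ite]
  split_ifs <;> exact word_lt hR _ _ _ _

theorem tailFn_lt {R : ℕ} (hR : 0 < R) (n s x : ℕ) : tailFn R n s x < R * R * R * R := by
  simp only [tailFn, Bool.cond_eq_ite]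
  split_ifs <;> exact word_lt hR _ _ _ _

theorem headFn_lt {R : ℕ} (hR : 0 < R) (s x : ℕ) : headFn R s x < R * R * R * R := by
  simp only [headFn, Bool.cond_eq_ite]
  split_ifs <;> exact word_lt hR _ _ _ _

theorem prevFn_lt {R : ℕ} (hR : 0 < R) (s x : ℕ) : prevFn R s x < R * R * R * R := by
  simp only [prevFn, Bool.cond_eq_ite]
  split_ifs <;> exact word_lt hR _ _ _ _

theorem witnessFn_lt {R : ℕ} (hR : 0 < R) (s x : ℕ) : witnessFn R s x < R * R * R * R := by
  simp only [witnessFn, Bool.cond_eq_ite]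
  split_ifs <;> exact word_lt hR _ _ _ _

theorem starFn_lt {R : ℕ} (hR : 0 < R) (a x : ℕ) : starFn R a x < R * R * R * R := by
  simp only [starFn, Bool.cond_eq_ite]
  split_ifs <;> exact word_lt hR _ _ _ _

theorem obstructFn_lt {R : ℕ} (hR : 0 < R) (a s x : ℕ) : obstructFn R a s x < R * R * R * R := by
  simp only [obstructFn, Bool.cond_eq_ite]
  split_ifs <;> exact word_lt hR _ _ _ _

variable {n m : ℕ} {G : SimpleGraph (Fin n)} [DecidableRel G.Adj] {adj : Fin n → List (Fin n)}

theorem verdict_dummy (n m : ℕ) : verdict n m (dummy (base n m)) = [1, n, m] := by simp [verdict]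

theorem verdict_word {R : ℕ} (hR : base n m = R) {x b c w : Fin n}
    (hne : word R (vRank G x) (vRank G b) (vRank G c) (vRank G w) ≠ dummy R) :
    verdict n m (word R (vRank G x) (vRank G b) (vRank G c) (vRank G w)) =
      0 :: [x, b, c, w].map Fin.val := by
  subst hR
  have hr : ∀ u, vRank G u < base n m := fun u => by have := vRank_lt (G := G) (m := m) rfl u; omega
  rw [verdict, Bool.cond_decide, if_neg hne, dg0_word (hr _), dg1_word (hr _), dg2_word (hr _),
    dg3_word (hr _)]
  simp [vRank_mod]

/-- The factor 84 is seven stages at 12, and the summand 4 is two loads at two I/Os each. The facts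
about array 1 in the final memory are what the report needs. -/
theorem exec_certifyProg {μ : Machine} {R np L F : ℕ} (hRoom : Room μ n m)
    (hadj : IsAdjLists G adj) (hm : G.edgeFinset.card = m) (hR : base n m = R)
    (hW : R * R * R * R ≤ μ.W) (hF : fanIn μ.M μ.B = F) (hnp : numPages μ.B n m = np)
    (hL : arrLen μ.B n m = L) (hLe : n + 2 * m + 1 ≤ L) :
    ∃ d t mem, Exec μ certifyProg (initState m adj) t ⟨mem, d, []⟩ ∧
      t ≤ 84 * (np * (Nat.clog F np + 1)) + 4 ∧ (∀ y, d y < μ.W) ∧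
      (region d L L).Pairwise (· ≤ ·) ∧
      KeyEntries G (dummy R) (fun i => word R 0 (vRank G i) 0 0)
        (fun u v y => y = word R 1 (vRank G v) (vRank G u) 0) (region d L L) ∧
      ((mem = [1, n, m] ∧ IsTriviallyPerfect G) ∨
        ∃ l, IsForbiddenList G l ∧ mem = 0 :: l.map Fin.val) := by
  have hbd := hR ▸ base_bound n m
  have hR0 : 0 < R := by omega
  have hn := hRoom.hn
  have hmW := hRoom.hm
  have haddr := hRoom.addr
  have hcap := hRoom.cap
  have hlen := hadj.length_flatten
  rw [hm] at hlen
  have hd0 : ∀ y, (fun x => (adjRow adj).getD x 0) y < μ.W := fun y =>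
    getD_adjRow_lt adj hn (by omega) y
  have h0W : 0 < μ.W := by omega
  obtain ⟨d1, t1, hex1, ht1, hW1, -, he1⟩ := exec_stage (o := []) (aux := 0) hRoom splitPass
    (src := 0) (dst := 1) (by omega) (by omega) hF hnp hL h0W hd0 (fun i s x =>
      ((hR ▸ splitFn_lt hR0 n m i s x : _ < _)).trans_le hW)
  obtain ⟨d2, t2, hex2, ht2, hW2, -, he2⟩ := exec_stage (o := []) (aux := 0) hRoom tailPass
    (src := 1) (dst := 1) (by omega) (by omega) hF hnp hL h0W hW1 (fun i s x =>
      ((hR ▸ tailFn_lt hR0 n s x : _ < _)).trans_le hW)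
  obtain ⟨d3, t3, hex3, ht3, hW3, -, he3⟩ := exec_stage (o := []) (aux := 0) hRoom headPass
    (src := 1) (dst := 1) (by omega) (by omega) hF hnp hL h0W hW2 (fun i s x =>
      ((hR ▸ headFn_lt hR0 s x : _ < _)).trans_le hW)
  obtain ⟨d4, t4, hex4, ht4, hW4, hk4, he4⟩ := exec_stage (o := []) (aux := 0) hRoom prevPass
    (src := 1) (dst := 2) (by omega) (by omega) hF hnp hL h0W hW3 (fun i s x =>
      ((hR ▸ prevFn_lt hR0 s x : _ < _)).trans_le hW)
  obtain ⟨d5, t5, hex5, ht5, hW5, hk5, he5⟩ := exec_stage (o := []) (aux := 0) hRoom witnessPass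
    (src := 2) (dst := 2) (by omega) (by omega) hF hnp hL h0W hW4 (fun i s x =>
      ((hR ▸ witnessFn_lt hR0 s x : _ < _)).trans_le hW)
  have hlt : ∀ {d : ℕ → ℕ}, (∀ y, d y < μ.W) → (region d (2 * L) L).getD 0 0 < μ.W := by
    intro d hd
    rw [List.getD_eq_getElem _ _ (by simp; omega)]
    simp [region, hd]
  have hex6 := exec_loadHead (o := []) hRoom hL h0W hW5
  obtain ⟨a, ha⟩ : ∃ a, a = (region d5 (2 * L) L).getD 0 0 := ⟨_, rfl⟩
  have haW : a < μ.W := ha ▸ hlt hW5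
  rw [← ha] at hex6
  obtain ⟨d7, t7, hex7, ht7, hW7, hk7, he7⟩ := exec_stage (o := []) (aux := a) hRoom starPass
    (src := 1) (dst := 2) (by omega) (by omega) hF hnp hL haW hW5 (fun i s x =>
      ((hR ▸ starFn_lt hR0 a x : _ < _)).trans_le hW)
  obtain ⟨d8, t8, hex8, ht8, hW8, hk8, he8⟩ := exec_stage (o := []) (aux := a) hRoom obstructPass
    (src := 2) (dst := 2) (by omega) (by omega) hF hnp hL haW hW7 (fun i s x =>
      ((hR ▸ obstructFn_lt hR0 a s x : _ < _)).trans_le hW)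
  have hex9 := exec_loadHead (o := []) hRoom hL haW hW8
  have hk : region d8 L L = region d3 L L := by
    have h1 := hk8 1 (by omega) (by omega)
    have h2 := hk7 1 (by omega) (by omega)
    have h3 := hk5 1 (by omega) (by omega)
    have h4 := hk4 1 (by omega) (by omega)
    rw [h2, h3, h4, one_mul] at h1
    exact h1
  have hsplit : region d1 L L = sortl (passOut (fun _ => true) (splitFn R n m) 0 0
      (region (fun x => (adjRow adj).getD x 0) 0 L)) := by
    rw [one_mul, zero_mul] at he1
    rw [he1, ← hR]
    rfl
  have htail : region d2 L L = sortl (passOut (isKey R) (fun _ => tailFn R n) 0 0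
      (region d1 L L)) := by
    rw [one_mul] at he2
    rw [he2, ← hR]
    rfl
  have hhead : region d3 L L = sortl (passOut (isKey R) (fun _ => headFn R) 0 0
      (region d2 L L)) := by
    rw [one_mul] at he3
    rw [he3, ← hR]
    rfl
  have hprev : region d4 (2 * L) L = sortl (passOut (isBack R) (fun _ => prevFn R) 0 0
      (region d3 L L)) := by
    rw [one_mul] at he4
    rw [he4, ← hR]
    rfl
  have hwit : region d5 (2 * L) L = sortl (passOut (isKey R) (fun _ => witnessFn R) 0 0
      (region d4 (2 * L) L)) := by
    rw [he5, ← hR]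
    rfl
  have hstar : region d7 (2 * L) L = sortl (passOut (fun _ => false) (fun _ _ => starFn R a) 0 0
      (region d3 L L)) := by
    have h3 := hk5 1 (by omega) (by omega)
    have h4 := hk4 1 (by omega) (by omega)
    rw [h3, h4, one_mul] at he7
    rw [he7, ← hR]
    rfl
  have hobs : region d8 (2 * L) L = sortl (passOut (isKey R) (fun _ => obstructFn R a) 0 0
      (region d7 (2 * L) L)) := by
    rw [he8, ← hR]
    rfl
  have hsorted : ∀ {d : ℕ → ℕ} {x : ℕ} {l : List ℕ}, region d x L = sortl l →
      (region d x L).Pairwise (· ≤ ·) := fun h => h ▸ sortl_sorted _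
  have hkey1 : KeyEntries G (dummy R) (fun i => word R (startPos adj i) 0 i (G.degree i))
      (fun u v y => ∃ p, startPos adj u ≤ p ∧ p < startPos adj (u + 1) ∧ y = word R p 1 v 0)
      (region d1 L L) := by
    obtain ⟨r, rfl⟩ : ∃ r, L = 1 + n + r := ⟨L - (1 + n), by omega⟩
    rw [hsplit]
    exact (keyEntries_split hadj hm (r := r) (by omega)).perm (sortl_perm _)
  have hkey2 := ((keyEntries_tail hadj hm hR (hsorted hsplit) hkey1).perm (sortl_perm _))
  rw [← htail] at hkey2
  have hkey3 := ((keyEntries_head hR (hsorted htail) hkey2).perm (sortl_perm _))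
  rw [← hhead] at hkey3
  have harcs := KeyEntries.arcs (hsorted hhead) hkey3
  have hne : region d3 L L ≠ [] := by
    rw [← List.length_pos_iff, length_region]; omega
  have hcert := harcs.certificate hR hne hprev hwit (ha ▸ hstar) (ha ▸ hobs)
  obtain ⟨z, hz⟩ : ∃ z, z = (region d8 (2 * L) L).getD 0 0 := ⟨_, rfl⟩
  rw [← hz] at hex9 hcert
  have hst : initState m adj = ⟨[] ++ [n, m], fun x => (adjRow adj).getD x 0, []⟩ := rfl
  refine ⟨d8, t1 + (t2 + (t3 + (t4 + (t5 + (2 + (t7 + (t8 + 2))))))), verdict n m z, ?_, by omega,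
    hW8, ?_, ?_, ?_⟩
  · rw [hst]
    exact Exec.seq_eq (exec_start (l := []) rfl hn hmW (by omega) (by omega)) (.seq hex1 (.seq hex2 (.seq hex3
      (.seq hex4 (.seq hex5 (.seq hex6 (.seq hex7 (.seq hex8 (.seq_eq hex9
        (exec_finish hn hmW (by omega) (by omega)) rfl))))))))) (by omega)
  · rw [hk]; exact hsorted hhead
  · rw [hk]; exact hkey3
  · rcases hcert with ⟨h1, h2⟩ | ⟨x, b, c, w, h1, h2, h3⟩
    · exact .inl ⟨by rw [h1, ← hR, verdict_dummy], h2⟩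
    · refine .inr ⟨_, h1, ?_⟩
      rw [h3] at h2
      rw [h3, verdict_word hR h2]

theorem exec_reportProg {μ : Machine} {R L : ℕ} (hRoom : Room μ n m) (hR : base n m = R)
    (hL : arrLen μ.B n m = L) (hnL : n ≤ L) {d : ℕ → ℕ} (hd : ∀ y, d y < μ.W) :
    ∃ s t, Exec μ reportProg ⟨[1, n, m], d, []⟩ t s ∧ t ≤ 3 * (n / pageLen μ.B n m + 1) ∧
      s.out = vertices R n ((region d L L).take n) := by
  obtain ⟨b, hb⟩ : ∃ b, pageLen μ.B n m = b := ⟨_, rfl⟩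
  have hB := hRoom.hB
  have hbB := pageLen_le hB n m
  have hb1 := one_le_pageLen μ.B n m
  have hcap := hRoom.cap
  have haddr := hRoom.addr
  have hn := hRoom.hn
  have hm := hRoom.hm
  have hbL := pageLen_le_arrLen μ.B n m
  rw [hb] at hbB hb1 hcap hbL
  rw [hL] at haddr hbL
  rw [hb]
  have hnb : n / b ≤ n := Nat.div_le_self _ _
  set out := vertices R n ((region d L L).take n) with hout
  have houtl : out.length = n := by simp [hout, vertices, hnL]
  have hvW : ∀ w, w % (n + 1) < μ.W := fun w => by
    have := Nat.mod_lt w (show 0 < n + 1 by omega); omega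
  obtain ⟨i, t, hex, hi, hT, ht⟩ := exec_rloop (μ := μ)
    (T := fun P rs => decide (sc rs 0 2 * pageLen P.2.1 (sc rs 0 0) (sc rs 0 1) < sc rs 0 0))
    (hT := by fun_prop)
    (p := .seq (cmp (fun P rs => [arrLen P.2.1 (sc rs 0 0) (sc rs 0 1) +
          sc rs 0 2 * pageLen P.2.1 (sc rs 0 0) (sc rs 0 1),
          min (pageLen P.2.1 (sc rs 0 0) (sc rs 0 1))
            (sc rs 0 0 - sc rs 0 2 * pageLen P.2.1 (sc rs 0 0) (sc rs 0 1))] :: rs) (by fun_prop))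
      (.seq readRange
        (.seq (cmp (fun _ rs => [vertices (base (sc rs 1 0) (sc rs 1 1)) (sc rs 1 0) (rs.getD 0 []),
          [sc rs 1 0, sc rs 1 1, sc rs 1 2 + 1]]) (by fun_prop)) .emit)))
    (fun i => [[n, m, i]]) (fun _ => d) (fun i => out.take (i * b)) (fun i => i ≤ n / b + 1)
    (fun i => n / b + 1 - i) (fun i => 3 * (n / b + 1 - i)) (by
      intro i hi hT
      have hlt : i * b < n := by simpa [hb] using hT
      have hin : i ≤ n / b := (Nat.le_div_iff_mul_le (by omega)).2 hlt.le
      obtain ⟨j, hj⟩ : ∃ j, min b (n - i * b) = j := ⟨_, rfl⟩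
      have hjb : j ≤ b := hj ▸ min_le_left _ _
      have hjn : i * b + j ≤ n := by omega
      have hpage : vertices R n (region d (L + i * b) j) = (out.drop (i * b)).take j := by
        refine List.ext_getElem (by simp [vertices, houtl]; omega) fun k h1 h2 => ?_
        simp [vertices, hout, region, add_assoc]
      refine ⟨i + 1, 3, ?_, by omega, by omega, by omega⟩
      refine Exec.seq_eq (t := 0) (t' := 3) (exec_cmp (rs' := [[L + i * b, j], [n, m, i]]) ?_ ?_ ?_)
        (Exec.seq_eq (t := 2) (t' := 1) (exec_readRange hB (by omega) (by omega) (by omega) hd ?_ ?_)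
          (Exec.seq_eq (t := 0) (t' := 1) (exec_cmp
            (rs' := [vertices R n (region d (L + i * b) j), [n, m, i + 1]]) ?_ ?_ ?_) ?_ rfl) rfl) rfl
      · simp [hL, hb, hj]
      · simp; omega
      · simp; omega
      · simp; omega
      · simp; omega
      · simp [hR]
      · simp [vertices]; omega
      · simp only [good_cons, vertices, List.length_map, length_region, List.mem_map]
        refine ⟨⟨by omega, ?_⟩, by simp; omega⟩
        rintro w ⟨x, -, rfl⟩
        exact hvW _
      · have h1 : out.take ((i + 1) * b) = out.take (i * b) ++ vertices R n (region d (L + i * b) j) := by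
          rw [hpage, Nat.succ_mul, List.take_add]
          congr 1
          rw [← hj, ← List.take_take, List.take_of_length_le (i := n - i * b)
            (by simp [houtl])]
        -- The length prefix of the first register is exactly the count that `emit` expects.
        rw [h1, enc_cons]
        exact .emit (by simp [vertices]; omega) rfl)
    0 (Nat.zero_le _)
  rw [Nat.zero_mul, List.take_zero] at hex
  refine ⟨_, t, Exec.seq_eq (t := 0) (exec_start (l := [1]) rfl hn hm (by omega) (by omega)) hex
    (by omega), by omega, ?_⟩
  have hge : n ≤ i * b := by simpa [hb] using hT
  dsimp only
  rw [List.take_of_length_le (by omega)]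

end ExtMem

namespace ExtMem

/-! ### Room and cost -/

/-- With q = M/(32B) and e = B/8, the buffers take at most (q+2)(e+4) words. Here qe ≤ M/256 and q ≤
M/32, and the remaining terms are at most a fraction of `M` beyond the constant 100. -/
theorem fanIn_mul_le {M B b : ℕ} (hB : 1 ≤ B) (hM : 2 * B ≤ M) (hb : b ≤ B / 8 + 1) :
    B + 2 * b + fanIn M B * (b + 3) + 40 ≤ M + 100 := by
  obtain ⟨q, hq⟩ : ∃ q, M / (32 * B) = q := ⟨_, rfl⟩
  obtain ⟨e, he⟩ : ∃ e, B / 8 = e := ⟨_, rfl⟩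
  have h1 : q * (32 * B) ≤ M := hq ▸ Nat.div_mul_le_self M (32 * B)
  have h2 : 8 * e ≤ B := by omega
  have h3 : 256 * (q * e) ≤ M := by
    calc 256 * (q * e) = q * (32 * (8 * e)) := by ring
      _ ≤ q * (32 * B) := Nat.mul_le_mul_left _ (Nat.mul_le_mul_left _ h2)
      _ ≤ M := h1
  have h4 : q * 32 ≤ M := (Nat.mul_le_mul_left q (by omega)).trans h1
  have h5 : fanIn M B * (b + 3) ≤ (q + 2) * (e + 4) := by
    unfold fanIn
    rw [hq]
    exact Nat.mul_le_mul_left _ (by omega)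
  have h6 : (q + 2) * (e + 4) = q * e + 4 * q + 2 * e + 8 := by ring
  omega

/-- The upper bound holds even for huge `B`, because a page is never longer than the data; so
addresses stay linear in n + m. -/
theorem arrLen_bounds (B n m : ℕ) :
    n + 2 * m + 1 ≤ arrLen B n m ∧ arrLen B n m ≤ 2 * (n + 2 * m) + 1 := by
  obtain ⟨b, hb⟩ : ∃ b, pageLen B n m = b := ⟨_, rfl⟩
  have h1 : 1 ≤ b := hb ▸ one_le_pageLen B n m
  have h2 : b ≤ n + 2 * m + 1 := hb ▸ min_le_right _ _
  have h3 := Nat.div_add_mod' (n + 2 * m) b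
  have h4 := Nat.mod_lt (n + 2 * m) h1
  have h5 : arrLen B n m = (n + 2 * m) / b * b + b := by
    rw [arrLen, numPages, hb, Nat.add_mul ((n + 2 * m) / b), one_mul]
  omega

theorem base_pow (n m : ℕ) : base n m * base n m * base n m * base n m = (n + m + 2) ^ 12 := by
  unfold base; ring

theorem room {M B W n m : ℕ} (hB : 1 ≤ B) (hM : 2 * B ≤ M) (hW : (n + m + 2) ^ 12 ≤ W) :
    Room ⟨M, B, W, M + 100⟩ n m := by
  have h1 : (n + m + 2) * 2 ^ 11 ≤ W :=
    calc (n + m + 2) * 2 ^ 11 ≤ (n + m + 2) * (n + m + 2) ^ 11 :=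
          Nat.mul_le_mul_left _ (Nat.pow_le_pow_left (by omega) _)
      _ = (n + m + 2) ^ 12 := by ring
      _ ≤ W := hW
  refine ⟨hB, fanIn_mul_le hB hM (min_le_left _ _), ?_, ?_, ?_⟩
  · have := (arrLen_bounds B n m).2
    dsimp only
    omega
  · dsimp only; omega
  · dsimp only; omega

theorem div_pageLen_le {B n m k : ℕ} (hB : 1 ≤ B) (hk : k ≤ n + 2 * m) :
    ((k / pageLen B n m : ℕ) : ℝ) ≤ 8 * ((k : ℝ) / B) := by
  have hB' : (0 : ℝ) < B := by exact_mod_cast hB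
  rcases le_total (B / 8 + 1) (n + 2 * m + 1) with h | h
  · rw [pageLen, min_eq_left h]
    have h2 : (B : ℝ) / 8 ≤ (B / 8 + 1 : ℕ) := by
      rw [div_le_iff₀ (by norm_num)]
      exact_mod_cast (by omega : B ≤ (B / 8 + 1) * 8)
    calc ((k / (B / 8 + 1) : ℕ) : ℝ) ≤ (k : ℝ) / (B / 8 + 1 : ℕ) := Nat.cast_div_le
      _ ≤ (k : ℝ) / (B / 8) := by gcongr
      _ = 8 * ((k : ℝ) / B) := by field_simp
  · rw [pageLen, min_eq_right h, Nat.div_eq_of_lt (by omega), Nat.cast_zero]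
    positivity

theorem numPages_le {B n m : ℕ} (hB : 1 ≤ B) :
    (numPages B n m : ℝ) ≤ 17 * max 1 (((n + m : ℕ) : ℝ) / B) := by
  have hB' : (0 : ℝ) < B := by exact_mod_cast hB
  have h1 := div_pageLen_le (B := B) (n := n) (m := m) hB le_rfl
  have h2 : ((n + 2 * m : ℕ) : ℝ) / B ≤ 2 * (((n + m : ℕ) : ℝ) / B) := by
    rw [← mul_div_assoc]
    gcongr
    exact_mod_cast (by omega : n + 2 * m ≤ 2 * (n + m))
  have h3 := le_max_left 1 (((n + m : ℕ) : ℝ) / B)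
  have h4 := le_max_right 1 (((n + m : ℕ) : ℝ) / B)
  rw [numPages, Nat.cast_add, Nat.cast_one]
  linarith

/-- M/B is at most 32 times the fan-in, and 32 is at most its fifth power since it is at least 2. So
changing the base of the logarithm from the fan-in to M/B costs a factor 6. -/
theorem le_fanIn_pow {M B : ℕ} (hB : 1 ≤ B) : (M : ℝ) / B ≤ (fanIn M B : ℝ) ^ 6 := by
  have hB' : (0 : ℝ) < B := by exact_mod_cast hB
  have h1 : (2 : ℝ) ≤ fanIn M B := by exact_mod_cast Nat.le_add_left _ _
  have h2 : (M : ℝ) / B ≤ 32 * fanIn M B := by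
    rw [div_le_iff₀ hB']
    have := Nat.lt_div_mul_add (a := M) (b := 32 * B) (by omega)
    have h3 : M ≤ 32 * fanIn M B * B := by
      unfold fanIn
      have : 32 * (M / (32 * B) + 2) * B = M / (32 * B) * (32 * B) + 64 * B := by ring
      omega
    exact_mod_cast h3
  calc (M : ℝ) / B ≤ 2 ^ 5 * fanIn M B := by linarith
    _ ≤ (fanIn M B : ℝ) ^ 5 * fanIn M B := by gcongr
    _ = (fanIn M B : ℝ) ^ 6 := by ring

/-- With l the logarithmic factor of `sortIO`, the number of pages is at most 17(M/B)^l, hence at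
most the fan-in to the power 5 + ⌈6l⌉. Rounding up and the extra 1 give 6l + 7 ≤ 13l. -/
theorem clog_numPages_le {M B n m : ℕ} (hB : 1 ≤ B) (hM : 2 * B ≤ M) :
    ((Nat.clog (fanIn M B) (numPages B n m) + 1 : ℕ) : ℝ) ≤
      13 * max 1 (Real.logb ((M : ℝ) / B) (((n + m : ℕ) : ℝ) / B)) := by
  have hB' : (0 : ℝ) < B := by exact_mod_cast hB
  have hnp := numPages_le (n := n) (m := m) hB
  set F := fanIn M B with hF
  set r := (M : ℝ) / B with hr
  set y := ((n + m : ℕ) : ℝ) / B with hy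
  set l := max 1 (Real.logb r y) with hl
  have hr2 : 2 ≤ r := by
    rw [hr, le_div_iff₀ hB']
    exact_mod_cast hM
  have hF2 : (2 : ℝ) ≤ F := by exact_mod_cast Nat.le_add_left _ _
  have hl1 : 1 ≤ l := le_max_left _ _
  have hy0 : 0 ≤ y := by positivity
  have hX : max 1 y ≤ r ^ l := by
    refine max_le (Real.one_le_rpow (by linarith) (by linarith)) ?_
    rcases hy0.eq_or_lt with h | h
    · rw [← h]; positivity
    · calc y = r ^ Real.logb r y := (Real.rpow_logb (by linarith) (by linarith) h).symm
        _ ≤ r ^ l := Real.rpow_le_rpow_of_exponent_le (by linarith) (le_max_right _ _)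
  have hpow : max 1 y ≤ (F : ℝ) ^ ⌈6 * l⌉₊ :=
    calc max 1 y ≤ r ^ l := hX
      _ ≤ ((F : ℝ) ^ 6) ^ l := Real.rpow_le_rpow (by linarith) (le_fanIn_pow hB) (by linarith)
      _ = (F : ℝ) ^ (6 * l) := by
          rw [← Real.rpow_natCast, ← Real.rpow_mul (by positivity)]; norm_num
      _ ≤ (F : ℝ) ^ ((⌈6 * l⌉₊ : ℕ) : ℝ) :=
          Real.rpow_le_rpow_of_exponent_le (by linarith) (Nat.le_ceil _)
      _ = (F : ℝ) ^ ⌈6 * l⌉₊ := Real.rpow_natCast _ _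
  have hle : (numPages B n m : ℝ) ≤ (F : ℝ) ^ (5 + ⌈6 * l⌉₊) :=
    calc (numPages B n m : ℝ) ≤ 17 * max 1 y := hnp
      _ ≤ 2 ^ 5 * max 1 y := by
          gcongr; norm_num
      _ ≤ (F : ℝ) ^ 5 * (F : ℝ) ^ ⌈6 * l⌉₊ := by gcongr
      _ = (F : ℝ) ^ (5 + ⌈6 * l⌉₊) := (pow_add _ _ _).symm
  have hc : Nat.clog F (numPages B n m) ≤ 5 + ⌈6 * l⌉₊ :=
    Nat.clog_le_of_le_pow (by exact_mod_cast hle)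
  have hc' : ((Nat.clog F (numPages B n m) : ℕ) : ℝ) ≤ 5 + (⌈6 * l⌉₊ : ℕ) := by exact_mod_cast hc
  have := Nat.ceil_lt_add_one (a := 6 * l) (by linarith)
  push_cast
  linarith

end ExtMem

/-! ### Assembly of the graph theory, the two programs and the cost bounds. -/

theorem mainTheorem3 :
    -- soundness and completeness of the certificates
    (∀ (n : ℕ) (G : SimpleGraph (Fin n)) [DecidableRel G.Adj] (γ : List (Fin n)),
      ExtMem.IsDegreeOrdering G γ → (ExtMem.IsUco G γ ↔ ExtMem.IsTriviallyPerfect G)) ∧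
    (∀ (n : ℕ) (G : SimpleGraph (Fin n)) (l : List (Fin n)),
      ExtMem.IsForbiddenList G l → ¬ ExtMem.IsTriviallyPerfect G) ∧
    -- the certifying algorithm: `certify` decides, `report` outputs the certificate of a member
    ∃ (certify report : ExtMem.Prog) (k c : ℕ) (C : ℝ),
      ∀ (M B W n : ℕ) (G : SimpleGraph (Fin n)) [DecidableRel G.Adj] (adj : Fin n → List (Fin n)),
        1 ≤ B → 2 * B ≤ M → (n + G.edgeFinset.card + 2) ^ c ≤ W → ExtMem.IsAdjLists G adj →
        ∃ (t : ℕ) (s : ExtMem.State),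
          ExtMem.Exec ⟨M, B, W, M + k⟩ certify (ExtMem.initState G.edgeFinset.card adj) t s ∧
          (t : ℝ) ≤ C * ExtMem.sortIO M B (n + G.edgeFinset.card) ∧
          s.out = [] ∧
          (ExtMem.IsTriviallyPerfect G →
            s.mem.head? = some 1 ∧
            ∃ (t' : ℕ) (s' : ExtMem.State) (γ : List (Fin n)),
              ExtMem.Exec ⟨M, B, W, M + k⟩ report s t' s' ∧
              (t' : ℝ) ≤ C * ExtMem.scanIO B n ∧
              s'.out = γ.map Fin.val ∧
              ExtMem.IsDegreeOrdering G γ ∧ ExtMem.IsUco G γ) ∧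
          (¬ ExtMem.IsTriviallyPerfect G →
            ∃ l : List (Fin n), ExtMem.IsForbiddenList G l ∧ s.mem = 0 :: l.map Fin.val) := by
  refine ⟨fun n G _ γ => ExtMem.isUco_iff_isTriviallyPerfect,
    fun n G l => ExtMem.not_isTriviallyPerfect_of_isForbiddenList,
    -- The memory slack comes from `fanIn_mul_le`, the exponent from four digits in base (n+m+2)³.
    -- The constant covers 84·17·13 + 4 for certifying, and amply the 27 for reporting.
    ExtMem.certifyProg, ExtMem.reportProg, 100, 12, 20000, ?_⟩
  intro M B W n G _ adj hB hM hW hadj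
  obtain ⟨m, hm⟩ : ∃ m, G.edgeFinset.card = m := ⟨_, rfl⟩
  rw [hm] at hW ⊢
  have hRoom := ExtMem.room hB hM hW
  have hlen := ExtMem.arrLen_bounds B n m
  obtain ⟨d, t, mem, hex, ht, hd, hsorted, hkey, hres⟩ := ExtMem.exec_certifyProg hRoom hadj hm rfl
    (by rw [ExtMem.base_pow]; exact hW) rfl rfl rfl hlen.1
  have hnp := ExtMem.numPages_le (n := n) (m := m) hB
  have hcl := ExtMem.clog_numPages_le (n := n) (m := m) hB hM
  refine ⟨t, ⟨mem, d, []⟩, hex, ?_, rfl, fun hTP => ?_, fun hTP => ?_⟩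
  · have ht' : (t : ℝ) ≤ 84 * ((ExtMem.numPages B n m : ℝ) *
        ((Nat.clog (ExtMem.fanIn M B) (ExtMem.numPages B n m) + 1 : ℕ) : ℝ)) + 4 := by
      exact_mod_cast ht
    have h1 := le_max_left 1 (((n + m : ℕ) : ℝ) / B)
    have h2 := le_max_left 1 (Real.logb ((M : ℝ) / B) (((n + m : ℕ) : ℝ) / B))
    have h3 := mul_le_mul hnp hcl (Nat.cast_nonneg _) (by positivity)
    have h4 := one_le_mul_of_one_le_of_one_le h1 h2
    unfold ExtMem.sortIO
    linarith
  · rcases hres with ⟨rfl, -⟩ | ⟨l, hl, -⟩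
    · obtain ⟨γ, hγ, -, hmap⟩ := hkey.exists_isDegreeOrdering rfl hsorted
      obtain ⟨s', t', hex', ht', hout⟩ := ExtMem.exec_reportProg hRoom rfl rfl (by dsimp only; omega) hd
      refine ⟨rfl, t', s', γ, hex', ?_, hout.trans hmap, hγ,
        (ExtMem.isUco_iff_isTriviallyPerfect hγ).2 hTP⟩
      have h1 := ExtMem.div_pageLen_le (B := B) (n := n) (m := m) (k := n) hB (by omega)
      have h2 : (t' : ℝ) ≤ 3 * (((n / ExtMem.pageLen B n m : ℕ) : ℝ) + 1) := by exact_mod_cast ht'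
      have h3 := le_max_left 1 ((n : ℝ) / B)
      have h4 := le_max_right 1 ((n : ℝ) / B)
      unfold ExtMem.scanIO
      linarith
    · exact absurd hTP (ExtMem.not_isTriviallyPerfect_of_isForbiddenList hl)
  · rcases hres with ⟨-, h⟩ | h
    · exact absurd h hTP
    · exact h
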